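/- **MNL contextual bandit.** There are $N$ items, $\mathcal S=\{S\subseteq[N]:|S|\le K\}$ with $1\le K\le N$, dimension $d\ge1$, and an unknown $\theta^*\in\mathbb R^d$. In round $t$ the agent sees features $x_{ti}\in\mathbb R^d$ and revenues $|r_{ti}|\le 1$ ($i\in[N]$), offers $S_t\in\mathcal S$, and observes $c_t\in S_t\cup\{0\}$, drawn given the past with $p_t(i|S,\theta)=e^{x_{ti}^\top\theta}/(1+\sum_{j\in S}e^{x_{tj}^\top\theta})$, $p_t(0|S,\theta)=1/(1+\sum_{j\in S}e^{x_{tj}^\top\theta})$ at $S=S_t$, $\theta=\theta^*$. The features and revenues are exogenous: given all features, all revenues, the random initial assortments and $c_1,\dots,c_{t-1}$, the law of $c_t$ is $p_t(\cdot|S_t,\theta^*)$. Put $y_{ti}=\mathbb 1(c_t=i)$, $R_t(S,\theta)=\sum_{i\in S}r_{ti}p_t(i|S,\theta)$ and $\mathcal R_T=\mathbb E\sum_{t=1}^T\big(\max_{S\in\mathcal S}R_t(S,\theta^*)-R_t(S_t,\theta^*)\big)$. **Assumptions.** (1) The $x_{ti}$ are i.i.d. over all $t,i$, $\|x_{ti}\|\le1$,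 and $\mathbb E[x_{ti}x_{ti}^\top]\succeq\sigma_0 I$ with $\sigma_0>0$. (2) There is $\kappa>0$ such that almost surely $p_t(i|S,\theta)\,p_t(0|S,\theta)\ge\kappa$ for all $t$, all $S\in\mathcal S$, all $i\in S$ and all $\theta$ with $\|\theta-\theta^*\|\le1$. **Algorithm supCB-MNL** (input $T$, $T_0$, $\alpha$). In rounds $t\le T_0$ offer $S_t$ uniformly random with $|S_t|=K$ (independently over rounds and of features and revenues). All index sets $\Psi_0,\Psi_1,\dots$ start empty. In each round $t=T_0+1,\dots,T$ set $A_1=\mathcal S$ and go through the stages $\ell=1,2,\dots$ until $S_t$ is chosen. In stage $\ell$ let $D=\Psi_\ell\cup[T_0]$, let $\hat\theta$ be a solution of $\sum_{s\in D}\sum_{i\in S_s}(p_s(i|S_s,\theta)-y_{si})x_{si}=0$, computed by a fixed measurable rule from the data of the rounds in $D$ (arbitrary if there is no solution), and let $V=\sum_{s\in D}\sum_{i\in S_s}x_{si}x_{si}^\top$, $w_{i}=\alpha\|x_{ti}\|_{V^{-1}}$ (with $V^{-1}:=0$ if $V$ is singular), $\mathcal W=2\max\{w_{i}: i\in S\in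 A_\ell\}$ (the maximum of the empty set being $0$). (b) If $\mathcal W\le1/\sqrt T$, choose $S_t\in\arg\max_{S\in A_\ell}R_t(S,\hat\theta)$ and add $t$ to $\Psi_0$. (c) Else if $\mathcal W>2^{-\ell}$, choose $S_t\in\arg\max_{S\in A_\ell}\sum_{i\in S}w_{i}$ and add $t$ to $\Psi_\ell$. (d) Else let $A_{\ell+1}=\{S\in A_\ell:R_t(S,\hat\theta)\ge\max_{S'\in A_\ell}R_t(S',\hat\theta)-2^{-\ell+1}\}$ and pass to stage $\ell+1$. Ties in (b), (c) are broken by an arbitrary fixed function of the set of maximizers. **Theorem.** There are universal constants $C_0,C_2>0$ and, for all $\kappa,\sigma_0>0$, a constant $C_1>0$ depending only on $\kappa$ and $\sigma_0$, such that the following holds for all $d,N,K,T$, all $\theta^*$, and all feature distributions and revenues as above. If assumptions (1) and (2) hold, if $$T\ \ge\ C_1\max\Big\{\frac{\log^2(TN\log_2T)}{d},\ d^3\Big\},$$ and if supCB-MNL is run with $$T_0=\left\lceil\frac{C_0}{\kappa^4}\max\Big\{\frac{\sqrt{dT}}{\sigma_0},\ \frac{d+2\log(TN\log_2T)}{\sigma_0^2}\Big\}\right\rceil,\qquad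 \alpha=\frac5\kappa\sqrt{2\log(TN\log_2T)},$$ then the regret is integrable and its expectation satisfies $$\mathcal R_T\ \le\ \frac{C_2}{\kappa^4\sigma_0}\sqrt{dT\,\log(T/d)\,\log(TN\log_2T)\,\log_2T}.$$ In particular $\mathcal R_T=\tilde{\mathcal O}(\sqrt{dT})$ for fixed $\kappa,\sigma_0$. -/

import Mathlib

open MeasureTheory ProbabilityTheory
open scoped Matrix

noncomputable section

namespace MNLBandit

/-- The feature space `ℝ^d` with the Euclidean norm. -/
abbrev Vec (d : ℕ) := EuclideanSpace ℝ (Fin d)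

variable {N d : ℕ}

/-! ### The multinomial logit choice model -/

/-- MNL choice probability given the parameter `θ`, the item features `x` and the offered
assortment `S`: `some i` means that item `i` is bought, `none` is the outside option. -/
def choiceProb (θ : Vec d) (x : Fin N → Vec d) (S : Finset (Fin N)) : Option (Fin N) → ℝ
  | none => 1 / (1 + ∑ j ∈ S, Real.exp (inner ℝ (x j) θ))
  | some i =>
      if i ∈ S then Real.exp (inner ℝ (x i) θ) / (1 + ∑ j ∈ S, Real.exp (inner ℝ (x j) θ)) else 0

/-- Expected revenue `R(S, θ)` for item features `x` and item revenues `r`. -/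
def revenue (θ : Vec d) (x : Fin N → Vec d) (r : Fin N → ℝ) (S : Finset (Fin N)) : ℝ :=
  ∑ i ∈ S, r i * choiceProb θ x S (some i)

/-- The candidate assortments: all sets of at most `K` items. -/
def assortments (N K : ℕ) : Finset (Finset (Fin N)) :=
  Finset.univ.filter fun S => S.card ≤ K

lemma assortments_nonempty (N K : ℕ) : (assortments N K).Nonempty :=
  ⟨∅, by simp [assortments]⟩

/-- Revenue of the offline optimal assortment, `max_S R(S, θ)`. -/
def optRevenue (K : ℕ) (θ : Vec d) (x : Fin N → Vec d) (r : Fin N → ℝ) : ℝ :=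
  (assortments N K).sup' (assortments_nonempty N K) (revenue θ x r)

/-! ### Maximum likelihood estimation -/

/-- Gradient at `θ` of the negative log-likelihood of the rounds in `Ψ`, where in round `t ∈ Ψ`
the features were `x t`, the assortment `S t` was offered and the response was `c t`. -/
def score (Ψ : Finset ℕ) (x : Ψ → Fin N → Vec d) (S : Ψ → Finset (Fin N))
    (c : Ψ → Option (Fin N)) (θ : Vec d) : Vec d :=
  ∑ t : Ψ, ∑ i ∈ S t,
    (choiceProb θ (x t) (S t) (some i) - (if c t = some i then 1 else 0)) • x t i

/-- A rule that turns the data of the rounds in `Ψ` into an estimate of the parameter. -/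
abbrev Estimator (N d : ℕ) :=
  (Ψ : Finset ℕ) → (Ψ → Fin N → Vec d) → (Ψ → Finset (Fin N)) → (Ψ → Option (Fin N)) → Vec d

/-- `est` is a (measurable) maximum likelihood estimator: it returns a solution of the likelihood
equation whenever there is one. (For separable data there is none; the value is then arbitrary.) -/
structure IsMLE (est : Estimator N d) : Prop where
  measurable : ∀ (Ψ : Finset ℕ) (S : Ψ → Finset (Fin N)) (c : Ψ → Option (Fin N)),
    Measurable fun x : Ψ → Fin N → Vec d => est Ψ x S c
  score_eq_zero : ∀ (Ψ : Finset ℕ) (x : Ψ → Fin N → Vec d) (S : Ψ → Finset (Fin N))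
    (c : Ψ → Option (Fin N)), (∃ θ, score Ψ x S c θ = 0) → score Ψ x S c (est Ψ x S c) = 0

/-- Gram matrix `V_Ψ = ∑_{t ∈ Ψ} ∑_{i ∈ S_t} x_{ti} x_{ti}ᵀ`. -/
def gram (Ψ : Finset ℕ) (x : ℕ → Fin N → Vec d) (S : ℕ → Finset (Fin N)) :
    Matrix (Fin d) (Fin d) ℝ :=
  ∑ t ∈ Ψ, ∑ i ∈ S t, Matrix.vecMulVec (x t i).ofLp (x t i).ofLp

/-- Weighted norm `‖v‖_A = √(vᵀ A v)`. -/
def weightedNorm (A : Matrix (Fin d) (Fin d) ℝ) (v : Vec d) : ℝ :=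
  √(v.ofLp ⬝ᵥ (A *ᵥ v.ofLp))

/-! ### The algorithm -/

/-- The maximizers of `f` over `A`. -/
def argmaxSet (A : Finset (Finset (Fin N))) (f : Finset (Fin N) → ℝ) : Finset (Finset (Fin N)) :=
  open scoped Classical in A.filter fun S => ∀ S' ∈ A, f S' ≤ f S

/-- Inputs of the algorithm: maximal assortment size `K`, horizon `T`, initialization length `T₀`,
confidence radius `α`, the routine `est` that solves the likelihood equation, and the rule `tie`
that picks one element from a set of maximizers. -/
structure Input (N d : ℕ) where
  K : ℕ
  T : ℕ
  T₀ : ℕ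
  α : ℝ
  est : Estimator N d
  tie : Finset (Finset (Fin N)) → Finset (Fin N)

/-- State after some rounds: `S t` is the assortment offered in round `t` (for past `t`), and
`Ψ ℓ` is the index set of stage `ℓ`; `Ψ 0` collects the exploitation rounds. -/
structure State (N : ℕ) where
  S : ℕ → Finset (Fin N)
  Ψ : ℕ → Finset ℕ

section Round

/- One round `t`, given the input `p`, features `x`, revenues `r`, past responses `c`, and the
state `s` after the previous round. -/

/-- The rounds used in stage `ℓ`: `Ψ_ℓ ∪ [T₀]`. -/
def stageRounds (p : Input N d) (s : State N) (ℓ : ℕ) : Finset ℕ :=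
  s.Ψ ℓ ∪ Finset.Icc 1 p.T₀

/-- The estimate of stage `ℓ`. -/
def stageEst (p : Input N d) (x : ℕ → Fin N → Vec d) (c : ℕ → Option (Fin N)) (s : State N)
    (ℓ : ℕ) : Vec d :=
  p.est (stageRounds p s ℓ) (fun u => x u) (fun u => s.S u) (fun u => c u)

/-- The width `w_{ti} = α ‖x_{ti}‖_{V⁻¹}` of item `i` in stage `ℓ`. -/
def stageWidth (p : Input N d) (x : ℕ → Fin N → Vec d) (s : State N) (t ℓ : ℕ) (i : Fin N) : ℝ :=
  p.α * weightedNorm (gram (stageRounds p s ℓ) x s.S)⁻¹ (x t i)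

/-- The candidate set `A_ℓ` of round `t`: `A_1` is the set of all assortments, and `A_{ℓ+1}` keeps
those members of `A_ℓ` whose estimated revenue is within `2^{-ℓ+1}` of the maximum over `A_ℓ`.
(Stages are numbered from `1`; index `0` is not used.) -/
def stageCand (p : Input N d) (x : ℕ → Fin N → Vec d) (r : ℕ → Fin N → ℝ)
    (c : ℕ → Option (Fin N)) (s : State N) (t : ℕ) : ℕ → Finset (Finset (Fin N))
  | 0 => assortments N p.K
  | 1 => assortments N p.K
  | ℓ + 2 => open scoped Classical in
      (stageCand p x r c s t (ℓ + 1)).filter fun S =>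
        ∀ S' ∈ stageCand p x r c s t (ℓ + 1),
          revenue (stageEst p x c s (ℓ + 1)) (x t) (r t) S' - (2 : ℝ) ^ (-((ℓ + 1 : ℕ) : ℤ) + 1)
            ≤ revenue (stageEst p x c s (ℓ + 1)) (x t) (r t) S

/-- `𝒲 = 2 max_i w_i` over all items that occur in some member of `A` (zero if there is none). -/
def maxWidth (A : Finset (Finset (Fin N))) (w : Fin N → ℝ) : ℝ :=
  if h : (A.biUnion id).Nonempty then 2 * (A.biUnion id).sup' h w else 0

/-- `𝒲_t^{(ℓ)}`. -/
def stageMaxWidth (p : Input N d) (x : ℕ → Fin N → Vec d) (r : ℕ → Fin N → ℝ)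
    (c : ℕ → Option (Fin N)) (s : State N) (t ℓ : ℕ) : ℝ :=
  maxWidth (stageCand p x r c s t ℓ) (stageWidth p x s t ℓ)

/-- The stages at which the loop of round `t` stops, by exploitation or by exploration. -/
def stopStages (p : Input N d) (x : ℕ → Fin N → Vec d) (r : ℕ → Fin N → ℝ)
    (c : ℕ → Option (Fin N)) (s : State N) (t : ℕ) : Set ℕ :=
  {ℓ | 1 ≤ ℓ ∧ (stageMaxWidth p x r c s t ℓ ≤ 1 / √p.T ∨
    (2 : ℝ) ^ (-(ℓ : ℤ)) < stageMaxWidth p x r c s t ℓ)}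

/-- The stage at which the assortment of round `t` is chosen: the first one that stops the loop. -/
def stopStage (p : Input N d) (x : ℕ → Fin N → Vec d) (r : ℕ → Fin N → ℝ)
    (c : ℕ → Option (Fin N)) (s : State N) (t : ℕ) : ℕ :=
  sInf (stopStages p x r c s t)

/-- The loop always stops, at the latest in stage `⌊(1/2) log₂ T⌋ + 1`. -/
lemma mem_stopStages (p : Input N d) (hT : 1 ≤ p.T) (x : ℕ → Fin N → Vec d) (r : ℕ → Fin N → ℝ)
    (c : ℕ → Option (Fin N)) (s : State N) (t : ℕ) :
    ⌊(1 / 2 : ℝ) * Real.logb 2 p.T⌋₊ + 1 ∈ stopStages p x r c s t := by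
  refine ⟨by omega, ?_⟩
  rw [or_iff_not_imp_left, not_le]
  refine fun h => lt_of_le_of_lt ?_ h
  have hT' : (0 : ℝ) < p.T := by exact_mod_cast hT
  have h1 : (√(p.T : ℝ)) ≤ 2 ^ (⌊(1 / 2 : ℝ) * Real.logb 2 p.T⌋₊ + 1) := by
    have h2 := (Nat.lt_floor_add_one ((1 / 2 : ℝ) * Real.logb 2 p.T)).le
    calc √(p.T : ℝ) = (2 : ℝ) ^ ((1 / 2 : ℝ) * Real.logb 2 p.T) := by
          rw [mul_comm, Real.rpow_mul (by norm_num), Real.rpow_logb (by norm_num) (by norm_num) hT',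
            Real.sqrt_eq_rpow]
      _ ≤ (2 : ℝ) ^ ((⌊(1 / 2 : ℝ) * Real.logb 2 p.T⌋₊ + 1 : ℕ) : ℝ) := by
          apply Real.rpow_le_rpow_of_exponent_le (by norm_num)
          push_cast
          exact h2
      _ = _ := Real.rpow_natCast _ _
  rw [zpow_neg, zpow_natCast, ← one_div]
  exact one_div_le_one_div_of_le (Real.sqrt_pos.2 hT') h1

/-- The update in round `t`. In the initialization phase the random assortment `G t` is offered.
Later, at the stage `ℓ` that stops the loop, the algorithm exploits (and puts `t` into `Ψ_0`)
if `𝒲 ≤ 1/√T`, and otherwise explores (and puts `t` into `Ψ_ℓ`). -/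
def step (p : Input N d) (x : ℕ → Fin N → Vec d) (r : ℕ → Fin N → ℝ) (G : ℕ → Finset (Fin N))
    (c : ℕ → Option (Fin N)) (s : State N) (t : ℕ) : State N :=
  if t ≤ p.T₀ then ⟨Function.update s.S t (G t), s.Ψ⟩
  else
    let ℓ := stopStage p x r c s t
    let A := stageCand p x r c s t ℓ
    open scoped Classical in
    if stageMaxWidth p x r c s t ℓ ≤ 1 / √p.T then
      ⟨Function.update s.S t
          (p.tie (argmaxSet A fun S => revenue (stageEst p x c s ℓ) (x t) (r t) S)),
        Function.update s.Ψ 0 (insert t (s.Ψ 0))⟩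
    else
      ⟨Function.update s.S t
          (p.tie (argmaxSet A fun S => ∑ i ∈ S, stageWidth p x s t ℓ i)),
        Function.update s.Ψ ℓ (insert t (s.Ψ ℓ))⟩

end Round

/-- The state after rounds `1, …, t`. -/
def stateAfter (p : Input N d) (x : ℕ → Fin N → Vec d) (r : ℕ → Fin N → ℝ)
    (G : ℕ → Finset (Fin N)) (c : ℕ → Option (Fin N)) : ℕ → State N
  | 0 => ⟨fun _ => ∅, fun _ => ∅⟩
  | t + 1 => step p x r G c (stateAfter p x r G c t) (t + 1)

/-- The assortment `S_t` that the algorithm offers in round `t`, as a function of the features,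
the revenues, the random initial assortments, and the responses in earlier rounds. -/
def offered (p : Input N d) (x : ℕ → Fin N → Vec d) (r : ℕ → Fin N → ℝ)
    (G : ℕ → Finset (Fin N)) (c : ℕ → Option (Fin N)) (t : ℕ) : Finset (Fin N) :=
  (stateAfter p x r G c t).S t

/-- `∑_{t=1}^T (R_t(S_t*, θ*) - R_t(S_t, θ*))`. -/
def cumRegret (p : Input N d) (θ : Vec d) (x : ℕ → Fin N → Vec d) (r : ℕ → Fin N → ℝ)
    (G : ℕ → Finset (Fin N)) (c : ℕ → Option (Fin N)) : ℝ :=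
  ∑ t ∈ Finset.Icc 1 p.T,
    (optRevenue p.K θ (x t) (r t) - revenue θ (x t) (r t) (offered p x r G c t))

/-! ### Probabilistic assumptions -/

section Probability

variable {Ω : Type*}

/-- The feature vectors are i.i.d. over all rounds and items with law `px`, which lives on the unit
ball and has second moment matrix `E[x xᵀ] ≥ σ₀ I`. -/
structure IIDContexts [MeasurableSpace Ω] (P : Measure Ω) (px : Measure (Vec d)) (σ₀ : ℝ)
    (x : ℕ → Fin N → Ω → Vec d) : Prop where
  measurable : ∀ t i, Measurable (x t i)
  indep : iIndepFun (fun ti : ℕ × Fin N => x ti.1 ti.2) P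
  law : ∀ t i, P.map (x t i) = px
  norm_le_one : ∀ᵐ z ∂px, ‖z‖ ≤ 1
  secondMoment :
    ((Matrix.of fun a b : Fin d => ∫ z, z a * z b ∂px) - σ₀ • (1 : Matrix (Fin d) (Fin d) ℝ)).PosSemidef

/-- Almost surely, `p_t(i | S, θ) p_t(0 | S, θ) ≥ κ` for all rounds `t`, all assortments `S`, all
`i ∈ S` and all `θ` with `‖θ - θ*‖ ≤ 1`. -/
def ChoiceProbBound [MeasurableSpace Ω] (P : Measure Ω) (K : ℕ) (κ : ℝ) (θstar : Vec d)
    (x : ℕ → Fin N → Ω → Vec d) : Prop :=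
  ∀ᵐ ω ∂P, ∀ t, ∀ S ∈ assortments N K, ∀ i ∈ S, ∀ θ : Vec d, ‖θ - θstar‖ ≤ 1 →
    κ ≤ choiceProb θ (fun j => x t j ω) S (some i) * choiceProb θ (fun j => x t j ω) S none

/-- The σ-algebra generated by all features and all revenues. -/
abbrev contextSigma (x : ℕ → Fin N → Ω → Vec d) (r : ℕ → Fin N → Ω → ℝ) : MeasurableSpace Ω :=
  (⨆ t, ⨆ i, MeasurableSpace.comap (x t i) inferInstance) ⊔
    (⨆ t, ⨆ i, MeasurableSpace.comap (r t i) inferInstance)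

/-- The σ-algebra generated by the random initial assortments. -/
abbrev initSigma (G : ℕ → Ω → Finset (Fin N)) : MeasurableSpace Ω :=
  ⨆ t, MeasurableSpace.comap (G t) ⊤

/-- The information on which the response in round `t` is conditioned: the features, the revenues,
the random initial assortments, and the responses in rounds `1, …, t - 1`. -/
abbrev history (x : ℕ → Fin N → Ω → Vec d) (r : ℕ → Fin N → Ω → ℝ) (G : ℕ → Ω → Finset (Fin N))
    (c : ℕ → Ω → Option (Fin N)) (t : ℕ) : MeasurableSpace Ω :=
  contextSigma x r ⊔ initSigma G ⊔ ⨆ s ∈ Finset.Ico 1 t, MeasurableSpace.comap (c s) ⊤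

/-- The random initial assortments are independent, uniform over the sets of exactly `K` items, and
independent of features and revenues. -/
structure UniformInit [MeasurableSpace Ω] (P : Measure Ω) (K : ℕ) (x : ℕ → Fin N → Ω → Vec d)
    (r : ℕ → Fin N → Ω → ℝ) (G : ℕ → Ω → Finset (Fin N)) : Prop where
  measurable : ∀ t S, MeasurableSet {ω | G t ω = S}
  indep : iIndep (fun t => MeasurableSpace.comap (G t) ⊤) P
  indep_context : Indep (initSigma G) (contextSigma x r) P
  uniform : ∀ t (S : Finset (Fin N)), S.card = K → P.real {ω | G t ω = S} = 1 / (N.choose K : ℝ)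

/-- The responses when the assortments are chosen by the algorithm with input `p`: in each round
`t ≤ T`, given the information available, `c t` is drawn from the MNL model with parameter `θ*`,
features `x_t` and the offered assortment. -/
structure MNLResponses [mΩ : MeasurableSpace Ω] (P : Measure Ω) (p : Input N d) (θstar : Vec d)
    (x : ℕ → Fin N → Ω → Vec d) (r : ℕ → Fin N → Ω → ℝ) (G : ℕ → Ω → Finset (Fin N))
    (c : ℕ → Ω → Option (Fin N)) : Prop where
  measurable : ∀ t a, MeasurableSet {ω | c t ω = a}
  cond_law : ∀ t ∈ Finset.Icc 1 p.T, ∀ a : Option (Fin N),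
    P[({ω | c t ω = a}.indicator fun _ => (1 : ℝ)) | history x r G c t] =ᵐ[P] fun ω =>
      choiceProb θstar (fun j => x t j ω)
        (offered p (fun s i => x s i ω) (fun s i => r s i ω) (fun s => G s ω) (fun s => c s ω) t) a

end Probability

/-- `log (T N log₂ T)`. -/
def logTerm (T N : ℕ) : ℝ := Real.log (T * N * Real.logb 2 T)

/-- Initialization length, rounded up to an integer. -/
def initLength (C₀ κ σ₀ : ℝ) (d N T : ℕ) : ℕ :=
  ⌈C₀ / κ ^ 4 * max (√(d * T) / σ₀) ((d + 2 * logTerm T N) / σ₀ ^ 2)⌉₊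

/-- Confidence radius. -/
def radius (κ : ℝ) (N T : ℕ) : ℝ := 5 / κ * √(2 * logTerm T N)

/-- The algorithm's input with the prescribed initialization length and confidence radius. -/
def tunedInput (C₀ κ σ₀ : ℝ) (K T : ℕ) (est : Estimator N d)
    (tie : Finset (Finset (Fin N)) → Finset (Fin N)) : Input N d where
  K := K
  T := T
  T₀ := initLength C₀ κ σ₀ d N T
  α := radius κ N T
  est := est
  tie := tie

/-- The regret of the algorithm as a random variable. -/
def regret {Ω : Type*} (p : Input N d) (θstar : Vec d) (x : ℕ → Fin N → Ω → Vec d)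
    (r : ℕ → Fin N → Ω → ℝ) (G : ℕ → Ω → Finset (Fin N)) (c : ℕ → Ω → Option (Fin N)) (ω : Ω) : ℝ :=
  cumRegret p θstar (fun t i => x t i ω) (fun t i => r t i ω) (fun t => G t ω) (fun t => c t ω)

end MNLBandit

end

noncomputable section

namespace MNLBandit

/-! ### Sums over response sequences -/

section Sequences

variable {α : Type*}

/-! The estimate of a stage must be accurate in each feature direction `y` up to `α ‖y‖_{V⁻¹}` with
an `α` free of `√d`. If `H` is the Hessian of the likelihood at `θ*` and `Z` the noise, then `⟨y, θ̂
- θ*⟩` equals `⟨H⁻¹ y, Z⟩` up to a remainder that is quadratic in the error (`mle_error_le`). The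
initialization phase makes the smallest eigenvalue of `V` of order at least `√(dT)`. This forces
every solution of the likelihood equation into the unit ball around `θ*`, where `κ` bounds the
curvature from below, and it makes the remainder negligible. What remains is a tail bound for `⟨H⁻¹
y, Z⟩` in one direction.

That direction depends on all rounds and assortments of the stage, so it is not predictable and a
martingale inequality does not apply directly. However, whether a round joins `Ψ_ℓ`, and what is
offered there, is decided by the estimates of the stages below `ℓ` and by widths, which do not use
the responses of stage `ℓ`. So erasing all responses except those of the initialization and of the
lower stages changes neither the rounds nor the assortments of stage `ℓ` (`label_mask`).
`sum_seqs_decoupling` turns this into an exponential moment bound in which the direction may be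
treated as fixed, and `sum_pathProb_explore_gt_le` is the resulting Hoeffding bound. The argument is
carried out for fixed contexts, as finite sums over response sequences with weights `pathProb`;
`integral_pathEvent` and `measureReal_inter_le_of_pathMeas_le` carry it back to the probability
space.

The initialization rounds belong to the data of every stage, while their responses influence all
later assortments and hence the direction. Their noise is therefore bounded uniformly over
directions by means of a `1/2`-net of the sphere. The size of the net depends on `d` only, and the
trace of the second moment matrix gives `d σ₀ ≤ 1`. For given `σ₀` only finitely many dimensions
occur, so `C₁` can absorb the net; the same inequality absorbs the powers of `d` lost in the
entrywise concentration of the initial Gram matrix (`measureReal_gramFails_le`) and in the quadratic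
remainder.

Once all widths are valid (`pathMeas_widthFails_le`), an optimal assortment survives every
elimination. A round then has regret at most `2/√T` if it exploits, and at most `16` times the total
width of the offered items if it explores (`regret_roundChoice_le`). The elliptical potential
argument and Cauchy-Schwarz sum the widths over rounds and stages (`cumRegret_le`). The assortment
size drops out because `∑ pᵢ p₀ = (1 - p₀) p₀ ≤ 1/4` forces `K κ ≤ 1/4`. The initialization costs at
most `2 T₀`, and the bad events cost `2 T` times their probability (`integral_regret_le`). -/

/-- Two sequences agree in the rounds `1, …, t - 1`. -/
def AgreeBefore (t : ℕ) (γ γ' : ℕ → α) : Prop := ∀ u, 1 ≤ u → u < t → γ u = γ' u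

lemma agreeBefore_update (t : ℕ) (γ : ℕ → α) (a : α) :
    AgreeBefore t (Function.update γ t a) γ :=
  fun u _ hu => Function.update_of_ne (by omega) _ _

variable [Fintype α]

/-- The sequences that take the value `z` outside `{1, …, n}`. -/
def seqs (z : α) : ℕ → Finset (ℕ → α)
  | 0 => {fun _ => z}
  | n + 1 => open scoped Classical in
      ((seqs z n) ×ˢ (Finset.univ : Finset α)).image fun q => Function.update q.1 (n + 1) q.2

lemma mem_seqs {z : α} {n : ℕ} {γ : ℕ → α} :
    γ ∈ seqs z n ↔ ∀ t, t ∉ Finset.Icc 1 n → γ t = z := by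
  induction n generalizing γ with
  | zero => simp [seqs, funext_iff]
  | succ n ih =>
    simp only [seqs, Finset.mem_image, Finset.mem_product, Finset.mem_univ, and_true, Prod.exists]
    constructor
    · rintro ⟨γ', a, h, rfl⟩ t ht
      rw [Finset.mem_Icc] at ht
      rw [Function.update_of_ne (by omega)]
      exact ih.1 h t (by rw [Finset.mem_Icc]; omega)
    · intro h
      refine ⟨Function.update γ (n + 1) z, γ (n + 1), ih.2 fun t ht => ?_, ?_⟩
      · rw [Finset.mem_Icc] at ht
        by_cases htn : t = n + 1
        · simp [htn]
        · rw [Function.update_of_ne htn]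
          exact h t (by rw [Finset.mem_Icc]; omega)
      · simp

lemma sum_seqs_succ (z : α) (n : ℕ) (F : (ℕ → α) → ℝ) :
    ∑ γ ∈ seqs z (n + 1), F γ = ∑ γ ∈ seqs z n, ∑ a, F (Function.update γ (n + 1) a) := by
  classical
  rw [seqs, Finset.sum_image, Finset.sum_product]
  rintro ⟨γ, a⟩ h ⟨γ', a'⟩ h' heq
  simp only [Finset.coe_product, Set.mem_prod, Finset.mem_coe] at h h'
  simp only at heq
  -- The update is injective here: `a` is read off at `n + 1`, and the overwritten entry was `z` for
  -- both sequences.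
  have h1 : a = a' := by simpa using congrFun heq (n + 1)
  refine Prod.ext (funext fun t => ?_) h1
  by_cases ht : t = n + 1
  · subst ht
    rw [show (γ, a).1 (n + 1) = z from mem_seqs.1 h.1 _ (by simp),
      show (γ', a').1 (n + 1) = z from mem_seqs.1 h'.1 _ (by simp)]
  · simpa [Function.update_of_ne ht] using congrFun heq t

/-- A sum over sequences of a product of nonnegative factors, the `t`-th of which depends on the
entries up to `t`, is bounded by the product of the bounds on the one-step sums. -/
lemma sum_seqs_prod_le (z : α) (n : ℕ) (g : ℕ → (ℕ → α) → ℝ) (κ : ℕ → ℝ)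
    (h0 : ∀ t γ, 0 ≤ g t γ) (hκ : ∀ t, 0 ≤ κ t)
    (hg : ∀ t ∈ Finset.Icc 1 n, ∀ γ γ', AgreeBefore (t + 1) γ γ' → g t γ = g t γ')
    (hstep : ∀ t ∈ Finset.Icc 1 n, ∀ γ, (∀ u, 1 ≤ u → u < t → g u γ ≠ 0) →
      ∑ a, g t (Function.update γ t a) ≤ κ t) :
    ∑ γ ∈ seqs z n, ∏ t ∈ Finset.Icc 1 n, g t γ ≤ ∏ t ∈ Finset.Icc 1 n, κ t := by
  induction n with
  | zero => simp [seqs]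
  | succ n ih =>
    have ih' := ih (fun t ht => hg t (Finset.Icc_subset_Icc_right (by omega) ht))
      (fun t ht => hstep t (Finset.Icc_subset_Icc_right (by omega) ht))
    rw [sum_seqs_succ, Finset.prod_Icc_succ_top (by omega)]
    refine le_trans ?_ (mul_le_mul_of_nonneg_right ih' (hκ _))
    rw [Finset.sum_mul]
    refine Finset.sum_le_sum fun γ _ => ?_
    have h1 : ∀ a, ∏ t ∈ Finset.Icc 1 (n + 1), g t (Function.update γ (n + 1) a)
        = (∏ t ∈ Finset.Icc 1 n, g t γ) * g (n + 1) (Function.update γ (n + 1) a) := by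
      intro a
      rw [Finset.prod_Icc_succ_top (by omega)]
      congr 1
      refine Finset.prod_congr rfl fun t ht => ?_
      rw [Finset.mem_Icc] at ht
      refine hg t (by rw [Finset.mem_Icc]; omega) _ _ fun u _ hu' => ?_
      exact Function.update_of_ne (by omega) _ _
    simp only [h1]
    rw [← Finset.mul_sum]
    -- Where the earlier product vanishes nothing has to be shown; elsewhere all earlier factors are
    -- nonzero. This support information is what pins the past in the decoupling argument.
    by_cases hz : ∏ t ∈ Finset.Icc 1 n, g t γ = 0
    · simp [hz]
    · rw [← ne_eq, Finset.prod_ne_zero_iff] at hz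
      refine mul_le_mul_of_nonneg_left ?_ (Finset.prod_nonneg fun t _ => h0 t γ)
      exact hstep _ (by simp) γ fun u h1 h2 => hz u (by rw [Finset.mem_Icc]; omega)

/-- Keep the entries of the rounds in `Lo` and replace the others by `z`. -/
def mask (z : α) (Lo : ℕ → (ℕ → α) → Prop) (γ : ℕ → α) : ℕ → α :=
  open scoped Classical in fun t => if Lo t γ then γ t else z

/-- Decoupling: if the set `U` of rounds and the choice kernels in these rounds are determined by
the responses in the rounds `Lo`, then a product over `U` of factors with conditional mean at most
one, each chosen with knowledge of all responses in `Lo`, has mean at most one. -/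
theorem sum_seqs_decoupling (z : α) (n : ℕ) (p : ℕ → (ℕ → α) → α → ℝ)
    (Lo U : ℕ → (ℕ → α) → Prop) (ξ : ℕ → (ℕ → α) → α → ℝ)
    (hp0 : ∀ t γ a, 0 ≤ p t γ a) (hp1 : ∀ t γ, ∑ a, p t γ a ≤ 1)
    (hp : ∀ t ∈ Finset.Icc 1 n, ∀ γ γ', AgreeBefore t γ γ' → p t γ = p t γ')
    (hLo : ∀ t ∈ Finset.Icc 1 n, ∀ γ γ', AgreeBefore t γ γ' → (Lo t γ ↔ Lo t γ'))
    (hU : ∀ t ∈ Finset.Icc 1 n, ∀ γ γ', AgreeBefore t γ γ' → (U t γ ↔ U t γ'))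
    (hLom : ∀ t ∈ Finset.Icc 1 n, ∀ γ, Lo t γ ↔ Lo t (mask z Lo γ))
    (hUm : ∀ t ∈ Finset.Icc 1 n, ∀ γ, U t γ ↔ U t (mask z Lo γ))
    (hpm : ∀ t ∈ Finset.Icc 1 n, ∀ γ, Lo t γ ∨ U t γ → p t γ = p t (mask z Lo γ))
    (hdisj : ∀ t ∈ Finset.Icc 1 n, ∀ γ, U t γ → ¬ Lo t γ)
    (hξ : ∀ t ∈ Finset.Icc 1 n, ∀ β, U t β → ∑ a, p t β a * Real.exp (ξ t β a) ≤ 1) :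
    ∑ γ ∈ seqs z n, (∏ t ∈ Finset.Icc 1 n, p t γ (γ t)) *
      Real.exp (∑ t ∈ Finset.Icc 1 n,
        open scoped Classical in if U t γ then ξ t (mask z Lo γ) (γ t) else 0) ≤ 1 := by
  classical
  -- Here `β` is a guess of the masked sequence. The factor `q` vanishes unless `γ` agrees with `β`
  -- in the lower rounds and `β` has the default entry elsewhere; it equals one if `β` is the mask
  -- of `γ`.
  set q : ℕ → (ℕ → α) → α → ℝ := fun t β a =>
    if Lo t β then (if a = β t then 1 else 0) else (if β t = z then 1 else 0) with hq
  set e : ℕ → (ℕ → α) → α → ℝ := fun t β a => if U t β then Real.exp (ξ t β a) else 1 with he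
  set f : (ℕ → α) → ℕ → (ℕ → α) → ℝ := fun β t γ => p t γ (γ t) * (q t β (γ t) * e t β (γ t))
    with hf
  set k : ℕ → (ℕ → α) → ℝ := fun t β =>
    if Lo t β then p t β (β t) else (if β t = z then 1 else 0) with hk
  have hq0 : ∀ t β a, 0 ≤ q t β a := by
    intro t β a; simp only [hq]; split_ifs <;> norm_num
  have he0 : ∀ t β a, 0 ≤ e t β a := by
    intro t β a; simp only [he]; split_ifs <;> positivity
  have hf0 : ∀ β t γ, 0 ≤ f β t γ := fun β t γ =>
    mul_nonneg (hp0 _ _ _) (mul_nonneg (hq0 _ _ _) (he0 _ _ _))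
  have hk0 : ∀ t β, 0 ≤ k t β := by
    intro t β; simp only [hk]; split_ifs <;> first | exact hp0 _ _ _ | norm_num
  have hmem : ∀ γ ∈ seqs z n, mask z Lo γ ∈ seqs z n := by
    intro γ hγ
    rw [mem_seqs] at hγ ⊢
    intro t ht
    simp only [mask, hγ t ht, ite_self]
  have step1 : ∀ γ ∈ seqs z n, (∏ t ∈ Finset.Icc 1 n, p t γ (γ t)) *
      Real.exp (∑ t ∈ Finset.Icc 1 n, if U t γ then ξ t (mask z Lo γ) (γ t) else 0)
      = ∏ t ∈ Finset.Icc 1 n, f (mask z Lo γ) t γ := by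
    intro γ _
    rw [Real.exp_sum, ← Finset.prod_mul_distrib]
    refine Finset.prod_congr rfl fun t ht => ?_
    simp only [hf]
    congr 1
    have h1 : q t (mask z Lo γ) (γ t) = 1 := by
      simp only [hq, ← hLom t ht γ]
      by_cases h : Lo t γ <;> simp [mask, h]
    rw [h1, one_mul]
    simp only [he, ← hUm t ht γ]
    split_ifs <;> simp
  rw [Finset.sum_congr rfl step1]
  -- Summing over all `β` instead of the one true mask only adds nonnegative terms. Afterwards `β`
  -- is fixed while `γ` runs, so the factors `ξ t β` no longer look into the future.
  have step2 : ∑ γ ∈ seqs z n, ∏ t ∈ Finset.Icc 1 n, f (mask z Lo γ) t γ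
      ≤ ∑ β ∈ seqs z n, ∑ γ ∈ seqs z n, ∏ t ∈ Finset.Icc 1 n, f β t γ := by
    rw [Finset.sum_comm]
    refine Finset.sum_le_sum fun γ hγ => ?_
    exact Finset.single_le_sum (f := fun β => ∏ t ∈ Finset.Icc 1 n, f β t γ)
      (fun β _ => Finset.prod_nonneg fun t _ => hf0 β t γ) (hmem γ hγ)
  refine step2.trans ?_
  have step3 : ∀ β ∈ seqs z n, ∑ γ ∈ seqs z n, ∏ t ∈ Finset.Icc 1 n, f β t γ
      ≤ ∏ t ∈ Finset.Icc 1 n, k t β := by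
    intro β _
    refine sum_seqs_prod_le z n (f β) (fun t => k t β) (hf0 β) (fun t => hk0 t β) ?_ ?_
    · intro t ht γ γ' h
      have h1 : γ t = γ' t := h t (Finset.mem_Icc.1 ht).1 (by omega)
      simp only [hf, h1, hp t ht γ γ' fun u h1 h2 => h u h1 (by omega)]
    · intro t ht γ hγ
      -- Nonzero earlier factors force the mask of `γ` to coincide with `β` before `t`. Hence `Lo`,
      -- `U`, and the kernel in rounds of `Lo` or `U`, all determined by the mask, may be evaluated
      -- at `β`.
      have hpre : ∀ u, 1 ≤ u → u < t → mask z Lo γ u = β u := by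
        intro u
        induction u using Nat.strong_induction_on with
        | _ u ih =>
          intro h1 h2
          have hu : u ∈ Finset.Icc 1 n := by
            rw [Finset.mem_Icc] at ht ⊢; omega
          have h3 : Lo u γ ↔ Lo u β := by
            rw [hLom u hu γ]
            exact hLo u hu _ _ fun v hv1 hv2 => ih v hv2 hv1 (by omega)
          have h4 : q u β (γ u) ≠ 0 := by
            have := hγ u h1 h2
            simp only [hf] at this
            exact left_ne_zero_of_mul (right_ne_zero_of_mul this)
          simp only [hq] at h4
          by_cases h5 : Lo u β
          · simp only [h5, if_true] at h4
            simp only [mask, h3, h5, if_true]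
            by_contra h6
            simp [h6] at h4
          · simp only [h5, if_false] at h4
            simp only [mask, h3, h5, if_false]
            by_contra h6
            rw [if_neg fun h => h6 h.symm] at h4
            exact h4 rfl
      have hsum : ∀ a, f β t (Function.update γ t a) = p t γ a * (q t β a * e t β a) := by
        intro a
        simp only [hf, Function.update_self, hp t ht _ γ (agreeBefore_update t γ a)]
      simp only [hsum]
      -- Three kinds of rounds: in a lower round the response is pinned and contributes its
      -- probability; in a round of `U` the conditional exponential moment is at most one; in any
      -- other round the probabilities add up to at most one.
      by_cases hL : Lo t β
      · have hL' : Lo t γ := by rw [hLom t ht γ]; exact (hLo t ht _ _ hpre).2 hL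
        have hU' : ¬ U t β := fun h => hdisj t ht β h hL
        have : p t γ = p t β := by
          rw [hpm t ht γ (Or.inl hL')]; exact hp t ht _ _ hpre
        simp [hq, he, hk, hL, hU', this]
      · by_cases hU' : U t β
        · have hU2 : U t γ := by rw [hUm t ht γ]; exact (hU t ht _ _ hpre).2 hU'
          have : p t γ = p t β := by
            rw [hpm t ht γ (Or.inr hU2)]; exact hp t ht _ _ hpre
          by_cases hz : β t = z
          · simp [hq, he, hk, hL, hU', this, hz, hξ t ht β hU']
          · simp [hq, he, hk, hL, hU', hz]
        · by_cases hz : β t = z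
          · simp [hq, he, hk, hL, hU', hz, hp1]
          · simp [hq, he, hk, hL, hU', hz]
  refine (Finset.sum_le_sum step3).trans ?_
  -- What remains is the total mass of the guesses `β`: probabilities in the lower rounds, and the
  -- single admissible entry `z` in all others.
  have step4 := sum_seqs_prod_le z n k (fun _ => 1) hk0 (fun _ => zero_le_one) ?_ ?_
  · simpa using step4
  · intro t ht γ γ' h
    have h1 : γ t = γ' t := h t (Finset.mem_Icc.1 ht).1 (by omega)
    have h2 : AgreeBefore t γ γ' := fun u h1 h2 => h u h1 (by omega)
    simp only [hk, h1, hp t ht γ γ' h2, hLo t ht γ γ' h2]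
  · intro t ht γ _
    have h2 := fun a => agreeBefore_update t γ a
    simp only [hk, fun a => hp t ht _ γ (h2 a), fun a => hLo t ht _ γ (h2 a), Function.update_self]
    by_cases hL : Lo t γ
    · simpa [hL] using hp1 t γ
    · simp [hL]

end Sequences

/-- Hoeffding's lemma for a probability vector on a finite set. -/
lemma sum_mul_exp_centered_le {α : Type*} [Fintype α] (p : α → ℝ) (hp : ∀ a, 0 ≤ p a)
    (hp1 : ∑ a, p a = 1) (f : α → ℝ) (R : ℝ) (hf : ∀ a, |f a| ≤ R) :
    ∑ a, p a * Real.exp (f a - ∑ b, p b * f b - R ^ 2 / 2) ≤ 1 := by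
  classical
  let _ : MeasurableSpace α := ⊤
  let μ : Measure α := ∑ a, ENNReal.ofReal (p a) • Measure.dirac a
  have : IsProbabilityMeasure μ := ⟨by
    simp only [μ, Measure.coe_finsetSum, Finset.sum_apply, Measure.smul_apply, measure_univ,
      smul_eq_mul, mul_one]
    rw [← ENNReal.ofReal_sum_of_nonneg fun a _ => hp a, hp1, ENNReal.ofReal_one]⟩
  have hint : ∀ g : α → ℝ, ∫ a, g a ∂μ = ∑ a, p a * g a := by
    intro g
    rw [integral_finsetSum_measure]
    · refine Finset.sum_congr rfl fun a _ => ?_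
      rw [integral_smul_measure, integral_dirac, ENNReal.toReal_ofReal (hp a), smul_eq_mul]
    · intro a _
      exact (integrable_dirac (by simp)).smul_measure ENNReal.ofReal_ne_top
  -- The values lie in an interval of length `2R`, so the variance proxy is `R ^ 2`.
  have h := (hasSubgaussianMGF_of_mem_Icc (μ := μ) (X := f) (a := -R) (b := R)
    measurable_from_top.aemeasurable (ae_of_all _ fun a => abs_le.1 (hf a))).mgf_le 1
  simp only [mgf, hint, one_mul] at h
  have hR : ((((‖R - -R‖₊ / 2) ^ 2 : NNReal)) : ℝ) * 1 ^ 2 / 2 = R ^ 2 / 2 := by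
    push_cast
    rw [Real.norm_eq_abs, div_pow, sq_abs]; ring
  rw [hR] at h
  calc ∑ a, p a * Real.exp (f a - ∑ b, p b * f b - R ^ 2 / 2)
      = (∑ a, p a * Real.exp (f a - ∑ b, p b * f b)) * Real.exp (-(R ^ 2 / 2)) := by
        rw [Finset.sum_mul]
        refine Finset.sum_congr rfl fun a _ => ?_
        rw [mul_assoc, ← Real.exp_add]; ring_nf
    _ ≤ Real.exp (R ^ 2 / 2) * Real.exp (-(R ^ 2 / 2)) :=
        mul_le_mul_of_nonneg_right h (Real.exp_pos _).le
    _ = 1 := by rw [← Real.exp_add]; simp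

/-! ### The multinomial logit model along a line -/

section Logit

variable {ι : Type*}

/-- Normalizing constant of the logit model with utilities `u`. -/
def logitDen (S : Finset ι) (u : ι → ℝ) : ℝ := 1 + ∑ j ∈ S, Real.exp (u j)

/-- Choice probability of the logit model with utilities `u`. -/
def logit (S : Finset ι) (u : ι → ℝ) (i : ι) : ℝ := Real.exp (u i) / logitDen S u

/-- Mean of `b` under the logit model, where the outside option has value zero. -/
def logitMean (S : Finset ι) (u b : ι → ℝ) : ℝ := ∑ i ∈ S, logit S u i * b i

/-- Covariance of `b` and `z` under the logit model, with value zero at the outside option. -/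
def logitCov (S : Finset ι) (u b z : ι → ℝ) : ℝ :=
  ∑ i ∈ S, logit S u i * (b i * z i) - logitMean S u b * logitMean S u z

lemma logitDen_pos (S : Finset ι) (u : ι → ℝ) : 0 < logitDen S u :=
  add_pos_of_pos_of_nonneg one_pos (Finset.sum_nonneg fun _ _ => (Real.exp_pos _).le)

lemma logit_pos (S : Finset ι) (u : ι → ℝ) (i : ι) : 0 < logit S u i :=
  div_pos (Real.exp_pos _) (logitDen_pos S u)

lemma sum_logit (S : Finset ι) (u : ι → ℝ) : ∑ i ∈ S, logit S u i = 1 - 1 / logitDen S u := by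
  have h := (logitDen_pos S u).ne'
  simp only [logit, ← Finset.sum_div]
  rw [eq_sub_iff_add_eq, ← add_div, div_eq_one_iff_eq h, logitDen, add_comm]

lemma sum_logit_le_one (S : Finset ι) (u : ι → ℝ) : ∑ i ∈ S, logit S u i ≤ 1 := by
  rw [sum_logit]
  have := (one_div_pos.2 (logitDen_pos S u)).le
  linarith

lemma sum_logit_mul_le (S : Finset ι) (u f : ι → ℝ) {c : ℝ} (hc : 0 ≤ c)
    (hf : ∀ i ∈ S, f i ≤ c) : ∑ i ∈ S, logit S u i * f i ≤ c :=
  calc ∑ i ∈ S, logit S u i * f i ≤ ∑ i ∈ S, logit S u i * c :=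
        Finset.sum_le_sum fun i hi => mul_le_mul_of_nonneg_left (hf i hi) (logit_pos S u i).le
    _ = (∑ i ∈ S, logit S u i) * c := by rw [Finset.sum_mul]
    _ ≤ 1 * c := mul_le_mul_of_nonneg_right (sum_logit_le_one S u) hc
    _ = c := one_mul c

lemma abs_logitMean_le (S : Finset ι) (u b : ι → ℝ) {c : ℝ} (hc : 0 ≤ c)
    (hb : ∀ i ∈ S, |b i| ≤ c) : |logitMean S u b| ≤ c := by
  refine (Finset.abs_sum_le_sum_abs _ _).trans ?_
  simp only [abs_mul, abs_of_pos (logit_pos S u _)]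
  exact sum_logit_mul_le S u _ hc hb

/-- The weights have total mass at most one and each entry is at most the `ℓ²` norm. Working with
`ℓ²` norms lets the Taylor remainders be summed to Gram forms without a factor depending on the
assortment size. -/
lemma sum_logit_mul_abs_le_sqrt (S : Finset ι) (u b : ι → ℝ) :
    ∑ i ∈ S, logit S u i * |b i| ≤ √(∑ i ∈ S, b i ^ 2) := by
  refine sum_logit_mul_le S u _ (Real.sqrt_nonneg _) fun i hi => ?_
  rw [← Real.sqrt_sq_eq_abs]
  exact Real.sqrt_le_sqrt
    (Finset.single_le_sum (f := fun i => b i ^ 2) (fun _ _ => sq_nonneg _) hi)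

lemma sum_logit_mul_abs_mul_le_sqrt (S : Finset ι) (u b z : ι → ℝ) :
    ∑ i ∈ S, logit S u i * |b i * z i| ≤ √(∑ i ∈ S, b i ^ 2) * √(∑ i ∈ S, z i ^ 2) := by
  refine sum_logit_mul_le S u _ (by positivity) fun i hi => ?_
  rw [abs_mul, ← Real.sqrt_sq_eq_abs, ← Real.sqrt_sq_eq_abs]
  gcongr
  · exact Finset.single_le_sum (f := fun i => b i ^ 2) (fun _ _ => sq_nonneg _) hi
  · exact Finset.single_le_sum (f := fun i => z i ^ 2) (fun _ _ => sq_nonneg _) hi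

/-- The variance of the logit model dominates `p₀ ∑ pᵢ zᵢ²`. -/
lemma le_logitCov_self (S : Finset ι) (u z : ι → ℝ) :
    1 / logitDen S u * ∑ i ∈ S, logit S u i * z i ^ 2 ≤ logitCov S u z z := by
  -- Cauchy-Schwarz with the weights of the offered items, whose total mass is `1 - p₀`; the missing
  -- mass `p₀` survives in the lower bound.
  have h1 : logitMean S u z ^ 2 ≤ (∑ i ∈ S, logit S u i) * ∑ i ∈ S, logit S u i * z i ^ 2 := by
    refine Finset.sum_sq_le_sum_mul_sum_of_sq_le_mul S (fun i _ => (logit_pos S u i).le)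
      (fun i _ => mul_nonneg (logit_pos S u i).le (sq_nonneg _)) fun i _ => le_of_eq (by ring)
  rw [sum_logit] at h1
  simp only [logitCov, ← pow_two]
  linarith

lemma logitCov_self_nonneg (S : Finset ι) (u z : ι → ℝ) : 0 ≤ logitCov S u z z := by
  refine le_trans ?_ (le_logitCov_self S u z)
  have := logitDen_pos S u
  have := fun i => (logit_pos S u i).le
  exact mul_nonneg (by positivity) (Finset.sum_nonneg fun i _ => mul_nonneg (this i) (sq_nonneg _))

lemma hasDerivAt_logitDen (S : Finset ι) (u z : ι → ℝ) (s : ℝ) :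
    HasDerivAt (fun s => logitDen S fun i => u i + s * z i)
      (∑ i ∈ S, Real.exp (u i + s * z i) * z i) s := by
  unfold logitDen
  refine HasDerivAt.const_add _ (HasDerivAt.fun_sum fun i _ => ?_)
  have h : HasDerivAt (fun s => u i + s * z i) (z i) s := by
    simpa using ((hasDerivAt_id s).mul_const (z i)).const_add (u i)
  exact h.exp

lemma hasDerivAt_log_logitDen (S : Finset ι) (u z : ι → ℝ) (s : ℝ) :
    HasDerivAt (fun s => Real.log (logitDen S fun i => u i + s * z i))
      (logitMean S (fun i => u i + s * z i) z) s := by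
  convert! (hasDerivAt_logitDen S u z s).log (logitDen_pos S _).ne' using 1
  rw [Finset.sum_div, logitMean]
  exact Finset.sum_congr rfl fun i _ => by rw [logit]; ring

lemma hasDerivAt_logit (S : Finset ι) (u z : ι → ℝ) (i : ι) (s : ℝ) :
    HasDerivAt (fun s => logit S (fun i => u i + s * z i) i)
      (logit S (fun i => u i + s * z i) i *
        (z i - logitMean S (fun i => u i + s * z i) z)) s := by
  have h : HasDerivAt (fun s => u i + s * z i) (z i) s := by
    simpa using ((hasDerivAt_id s).mul_const (z i)).const_add (u i)
  have hd := (logitDen_pos S fun i => u i + s * z i).ne'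
  convert! h.exp.div (hasDerivAt_logitDen S u z s) hd using 1
  have h2 : logitMean S (fun i => u i + s * z i) z
      = (∑ i ∈ S, Real.exp (u i + s * z i) * z i) / logitDen S fun i => u i + s * z i := by
    rw [Finset.sum_div, logitMean]
    exact Finset.sum_congr rfl fun i _ => by rw [logit]; ring
  rw [h2, logit]
  field_simp

/-- The logit model is an exponential family: differentiating a mean in the direction `z` of the
utilities gives the covariance with `z`. This identifies the Hessian of the likelihood with a sum of
covariances. -/
lemma hasDerivAt_logitMean (S : Finset ι) (u z b : ι → ℝ) (s : ℝ) :
    HasDerivAt (fun s => logitMean S (fun i => u i + s * z i) b)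
      (logitCov S (fun i => u i + s * z i) b z) s := by
  have h := HasDerivAt.fun_sum fun i (_ : i ∈ S) => (hasDerivAt_logit S u z i s).mul_const (b i)
  convert! h using 1
  rw [logitCov]
  nth_rewrite 1 [logitMean]
  rw [Finset.sum_mul, ← Finset.sum_sub_distrib]
  exact Finset.sum_congr rfl fun i _ => by ring

lemma hasDerivAt_logitCov (S : Finset ι) (u z b : ι → ℝ) (s : ℝ) :
    HasDerivAt (fun s => logitCov S (fun i => u i + s * z i) b z)
      (logitCov S (fun i => u i + s * z i) (fun i => b i * z i) z -
        (logitCov S (fun i => u i + s * z i) b z * logitMean S (fun i => u i + s * z i) z +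
          logitMean S (fun i => u i + s * z i) b * logitCov S (fun i => u i + s * z i) z z)) s :=
  (hasDerivAt_logitMean S u z (fun i => b i * z i) s).sub
    ((hasDerivAt_logitMean S u z b s).mul (hasDerivAt_logitMean S u z z s))

/-- A covariance does not change when `z` is replaced by its deviation from the mean, and this
deviation is at most `2δ`. -/
lemma abs_logitCov_le (S : Finset ι) (u b z : ι → ℝ) {δ : ℝ} (hδ : 0 ≤ δ)
    (hz : ∀ i ∈ S, |z i| ≤ δ) : |logitCov S u b z| ≤ 2 * δ * ∑ i ∈ S, logit S u i * |b i| := by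
  have hm := abs_logitMean_le S u z hδ hz
  have h : logitCov S u b z = ∑ i ∈ S, logit S u i * (b i * (z i - logitMean S u z)) := by
    rw [logitCov]
    nth_rewrite 1 [logitMean]
    rw [Finset.sum_mul, ← Finset.sum_sub_distrib]
    exact Finset.sum_congr rfl fun i _ => by ring
  rw [h, Finset.mul_sum]
  refine (Finset.abs_sum_le_sum_abs _ _).trans (Finset.sum_le_sum fun i hi => ?_)
  rw [abs_mul, abs_mul, abs_of_pos (logit_pos S u i)]
  have h1 : |z i - logitMean S u z| ≤ 2 * δ := (abs_sub _ _).trans (by linarith [hz i hi])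
  calc logit S u i * (|b i| * |z i - logitMean S u z|) ≤ logit S u i * (|b i| * (2 * δ)) := by
        gcongr; exact (logit_pos S u i).le
    _ = 2 * δ * (logit S u i * |b i|) := by ring

/-- The expected revenue is `2`-Lipschitz in the utilities. -/
lemma abs_logitMean_sub_le (S : Finset ι) (u u' r : ι → ℝ) {δ : ℝ} (hδ : 0 ≤ δ)
    (hu : ∀ i ∈ S, |u' i - u i| ≤ δ) (hr : ∀ i ∈ S, |r i| ≤ 1) :
    |logitMean S u' r - logitMean S u r| ≤ 2 * δ := by
  set z : ι → ℝ := fun i => u' i - u i with hz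
  have hd := fun s => hasDerivAt_logitMean S u z r s
  -- Mean value theorem along the segment from `u` to `u'`; the slope is a covariance at an
  -- intermediate point.
  obtain ⟨s, -, hs⟩ := exists_hasDerivAt_eq_slope (fun s => logitMean S (fun i => u i + s * z i) r)
    _ (zero_lt_one' ℝ) (fun s _ => (hd s).continuousAt.continuousWithinAt) fun s _ => hd s
  have h1 : (fun i => u i + 1 * z i) = u' := by funext i; simp [hz]
  have h0 : (fun i => u i + 0 * z i) = u := by funext i; simp
  rw [h1, h0, sub_zero, div_one] at hs
  rw [← hs]
  refine (abs_logitCov_le S _ r z hδ hu).trans ?_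
  have := sum_logit_mul_le S (fun i => u i + s * z i) (fun i => |r i|) zero_le_one hr
  nlinarith

/-- Second order Taylor estimate for the mean of the logit model. -/
lemma abs_logitMean_taylor_le (S : Finset ι) (u z b : ι → ℝ) {δ : ℝ} (hδ : 0 ≤ δ)
    (hz : ∀ i ∈ S, |z i| ≤ δ) :
    |logitMean S (fun i => u i + z i) b - logitMean S u b - logitCov S u b z| ≤
      6 * δ * (√(∑ i ∈ S, b i ^ 2) * √(∑ i ∈ S, z i ^ 2)) := by
  have hd := fun s => hasDerivAt_logitMean S u z b s
  have hd2 := fun s => hasDerivAt_logitCov S u z b s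
  -- The mean value theorem is used twice: the increment of the mean is a covariance at some `s`,
  -- and its difference from the covariance at `0` is `s ≤ 1` times a second derivative at some `v`.
  obtain ⟨s, hs01, hs⟩ := exists_hasDerivAt_eq_slope
    (fun s => logitMean S (fun i => u i + s * z i) b)
    _ (zero_lt_one' ℝ) (fun s _ => (hd s).continuousAt.continuousWithinAt) fun s _ => hd s
  obtain ⟨v, -, hv⟩ := exists_hasDerivAt_eq_slope
    (fun s => logitCov S (fun i => u i + s * z i) b z)
    _ hs01.1 (fun s _ => (hd2 s).continuousAt.continuousWithinAt) fun s _ => hd2 s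
  have h0 : (fun i => u i + 0 * z i) = u := by funext i; simp
  simp only [one_mul, h0, sub_zero, div_one] at hs hv
  rw [← hs]
  set w := fun i => u i + v * z i
  set E := √(∑ i ∈ S, b i ^ 2) * √(∑ i ∈ S, z i ^ 2)
  rw [eq_div_iff hs01.1.ne'] at hv
  rw [← hv, abs_mul, abs_of_pos hs01.1]
  refine (mul_le_of_le_one_right (abs_nonneg _) hs01.2.le).trans ?_
  have hb := sum_logit_mul_abs_le_sqrt S w b
  have hzz := sum_logit_mul_abs_le_sqrt S w z
  have hE : 0 ≤ E := by positivity
  have hmb : |logitMean S w b| ≤ √(∑ i ∈ S, b i ^ 2) := by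
    refine (Finset.abs_sum_le_sum_abs _ _).trans (le_trans (le_of_eq ?_) hb)
    exact Finset.sum_congr rfl fun i _ => by rw [abs_mul, abs_of_pos (logit_pos S w i)]
  have hmz : |logitMean S w z| ≤ √(∑ i ∈ S, z i ^ 2) := by
    refine (Finset.abs_sum_le_sum_abs _ _).trans (le_trans (le_of_eq ?_) hzz)
    exact Finset.sum_congr rfl fun i _ => by rw [abs_mul, abs_of_pos (logit_pos S w i)]
  -- The second derivative has three terms, each at most `2δE`; this is the origin of the constant
  -- `6`.
  have t1 : |logitCov S w (fun i => b i * z i) z| ≤ 2 * δ * E :=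
    (abs_logitCov_le S w _ z hδ hz).trans
      (mul_le_mul_of_nonneg_left (sum_logit_mul_abs_mul_le_sqrt S w b z) (by positivity))
  have t2 : |logitCov S w b z * logitMean S w z| ≤ 2 * δ * E := by
    rw [abs_mul]
    calc _ ≤ (2 * δ * √(∑ i ∈ S, b i ^ 2)) * √(∑ i ∈ S, z i ^ 2) := by
          refine mul_le_mul ?_ hmz (abs_nonneg _) (by positivity)
          exact (abs_logitCov_le S w b z hδ hz).trans (mul_le_mul_of_nonneg_left hb (by positivity))
      _ = _ := by simp only [E]; ring
  have t3 : |logitMean S w b * logitCov S w z z| ≤ 2 * δ * E := by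
    rw [abs_mul]
    calc _ ≤ √(∑ i ∈ S, b i ^ 2) * (2 * δ * √(∑ i ∈ S, z i ^ 2)) := by
          refine mul_le_mul hmb ?_ (abs_nonneg _) (by positivity)
          exact (abs_logitCov_le S w z z hδ hz).trans
            (mul_le_mul_of_nonneg_left hzz (by positivity))
      _ = _ := by simp only [E]; ring
  have := (abs_sub (logitCov S w (fun i => b i * z i) z)
    (logitCov S w b z * logitMean S w z + logitMean S w b * logitCov S w z z))
  have := abs_add_le (logitCov S w b z * logitMean S w z) (logitMean S w b * logitCov S w z z)
  linarith

end Logit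

variable {N d : ℕ}

lemma choiceProb_some (θ : Vec d) (x : Fin N → Vec d) {S : Finset (Fin N)} {i : Fin N}
    (hi : i ∈ S) : choiceProb θ x S (some i) = logit S (fun j => inner ℝ (x j) θ) i := by
  simp [choiceProb, hi, logit, logitDen]

lemma choiceProb_none (θ : Vec d) (x : Fin N → Vec d) (S : Finset (Fin N)) :
    choiceProb θ x S none = 1 / logitDen S fun j => inner ℝ (x j) θ := rfl

lemma choiceProb_nonneg (θ : Vec d) (x : Fin N → Vec d) (S : Finset (Fin N))
    (a : Option (Fin N)) : 0 ≤ choiceProb θ x S a := by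
  rcases a with _ | i
  · exact (one_div_pos.2 (logitDen_pos S _)).le
  · by_cases hi : i ∈ S
    · rw [choiceProb_some θ x hi]; exact (logit_pos _ _ _).le
    · simp [choiceProb, hi]

lemma sum_choiceProb_mul (θ : Vec d) (x : Fin N → Vec d) (S : Finset (Fin N))
    (f : Option (Fin N) → ℝ) (h0 : f none = 0) :
    ∑ a, choiceProb θ x S a * f a
      = logitMean S (fun j => inner ℝ (x j) θ) fun i => f (some i) := by
  rw [Fintype.sum_option, h0, mul_zero, zero_add, logitMean]
  rw [← Finset.sum_subset (Finset.subset_univ S)]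
  · exact Finset.sum_congr rfl fun i hi => by rw [choiceProb_some θ x hi]
  · intro i _ hi; simp [choiceProb, hi]

lemma sum_choiceProb (θ : Vec d) (x : Fin N → Vec d) (S : Finset (Fin N)) :
    ∑ a, choiceProb θ x S a = 1 := by
  rw [Fintype.sum_option, ← Finset.sum_subset (Finset.subset_univ S)]
  · rw [Finset.sum_congr rfl fun i hi => choiceProb_some θ x hi, sum_logit, choiceProb_none]
    ring
  · intro i _ hi; simp [choiceProb, hi]

lemma revenue_eq_logitMean (θ : Vec d) (x : Fin N → Vec d) (r : Fin N → ℝ)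
    (S : Finset (Fin N)) :
    revenue θ x r S = logitMean S (fun j => inner ℝ (x j) θ) r :=
  Finset.sum_congr rfl fun i hi => by rw [choiceProb_some θ x hi]; ring

lemma abs_revenue_le_one (θ : Vec d) (x : Fin N → Vec d) (r : Fin N → ℝ)
    (S : Finset (Fin N)) (hr : ∀ i, |r i| ≤ 1) : |revenue θ x r S| ≤ 1 := by
  rw [revenue_eq_logitMean]
  exact abs_logitMean_le S _ r zero_le_one fun i _ => hr i

/-- Expected revenues of two parameters differ by at most twice the largest utility difference. -/
lemma abs_revenue_sub_le (θ θ' : Vec d) (x : Fin N → Vec d) (r : Fin N → ℝ)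
    (S : Finset (Fin N)) (hr : ∀ i, |r i| ≤ 1) {δ : ℝ} (hδ : 0 ≤ δ)
    (h : ∀ i ∈ S, |inner ℝ (x i) (θ' - θ)| ≤ δ) :
    |revenue θ' x r S - revenue θ x r S| ≤ 2 * δ := by
  simp only [revenue_eq_logitMean]
  refine abs_logitMean_sub_le S _ _ r hδ (fun i hi => ?_) fun i _ => hr i
  rw [← inner_sub_right]
  exact h i hi

/-! ### Analysis of the maximum likelihood estimator -/

section Likelihood

variable {N d : ℕ}

/-- The quadratic form of the Gram matrix. -/
def gramForm (D : Finset ℕ) (x : ℕ → Fin N → Vec d) (S : ℕ → Finset (Fin N)) (v : Vec d) : ℝ :=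
  ∑ t ∈ D, ∑ i ∈ S t, (inner ℝ (x t i) v) ^ 2

lemma gramForm_nonneg (D : Finset ℕ) (x : ℕ → Fin N → Vec d) (S : ℕ → Finset (Fin N))
    (v : Vec d) : 0 ≤ gramForm D x S v :=
  Finset.sum_nonneg fun _ _ => Finset.sum_nonneg fun _ _ => sq_nonneg _

lemma gramForm_smul (D : Finset ℕ) (x : ℕ → Fin N → Vec d) (S : ℕ → Finset (Fin N)) (c : ℝ)
    (v : Vec d) : gramForm D x S (c • v) = c ^ 2 * gramForm D x S v := by
  simp only [gramForm, Finset.mul_sum, inner_smul_right, mul_pow]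

lemma gramForm_mono {D D' : Finset ℕ} (h : D ⊆ D') (x : ℕ → Fin N → Vec d)
    (S : ℕ → Finset (Fin N)) (v : Vec d) : gramForm D x S v ≤ gramForm D' x S v :=
  Finset.sum_le_sum_of_subset_of_nonneg h fun _ _ _ => Finset.sum_nonneg fun _ _ => sq_nonneg _

/-- The noise term `∑ (y_{ti} - p_t(i | S_t, θ)) x_{ti}` of the rounds in `D`. -/
def noise (D : Finset ℕ) (x : ℕ → Fin N → Vec d) (S : ℕ → Finset (Fin N))
    (c : ℕ → Option (Fin N)) (θ : Vec d) : Vec d :=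
  ∑ t ∈ D, ∑ i ∈ S t,
    ((if c t = some i then 1 else 0) - choiceProb θ (x t) (S t) (some i)) • x t i

lemma score_eq_neg_noise (D : Finset ℕ) (x : ℕ → Fin N → Vec d) (S : ℕ → Finset (Fin N))
    (c : ℕ → Option (Fin N)) (θ : Vec d) :
    score D (fun u => x u) (fun u => S u) (fun u => c u) θ = - noise D x S c θ := by
  rw [noise, ← Finset.sum_neg_distrib, score,
    Finset.sum_coe_sort D (fun t => ∑ i ∈ S t,
      (choiceProb θ (x t) (S t) (some i) - (if c t = some i then 1 else 0)) • x t i)]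
  refine Finset.sum_congr rfl fun t _ => ?_
  rw [← Finset.sum_neg_distrib]
  exact Finset.sum_congr rfl fun i _ => by rw [← neg_smul, neg_sub]

/-- Utilities of the items in round `t`. -/
def util (x : ℕ → Fin N → Vec d) (θ : Vec d) (t : ℕ) : Fin N → ℝ := fun i => inner ℝ (x t i) θ

lemma util_add_smul (x : ℕ → Fin N → Vec d) (θ v : Vec d) (s : ℝ) (t : ℕ) :
    util x (θ + s • v) t = fun i => util x θ t i + s * util x v t i := by
  funext i; simp only [util, inner_add_right, inner_smul_right]

lemma inner_noise (D : Finset ℕ) (x : ℕ → Fin N → Vec d) (S : ℕ → Finset (Fin N))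
    (c : ℕ → Option (Fin N)) (θ b : Vec d) :
    inner ℝ b (noise D x S c θ) = ∑ t ∈ D, ((∑ i ∈ S t, (if c t = some i then util x b t i else 0))
      - logitMean (S t) (util x θ t) (util x b t)) := by
  rw [noise, inner_sum]
  refine Finset.sum_congr rfl fun t _ => ?_
  rw [inner_sum, logitMean, ← Finset.sum_sub_distrib]
  refine Finset.sum_congr rfl fun i hi => ?_
  rw [inner_smul_right, choiceProb_some θ (x t) hi, real_inner_comm, sub_mul]
  congr 1
  split_ifs <;> simp [util]

/-- The Hessian of the negative log-likelihood as a linear map. -/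
def hess (D : Finset ℕ) (x : ℕ → Fin N → Vec d) (S : ℕ → Finset (Fin N)) (θ : Vec d) :
    Vec d →ₗ[ℝ] Vec d where
  toFun v := ∑ t ∈ D, ∑ i ∈ S t, (logit (S t) (util x θ t) i *
    (util x v t i - logitMean (S t) (util x θ t) (util x v t))) • x t i
  map_add' v w := by
    simp only [← Finset.sum_add_distrib, ← add_smul]
    refine Finset.sum_congr rfl fun t _ => Finset.sum_congr rfl fun i _ => ?_
    congr 1
    have h : logitMean (S t) (util x θ t) (util x (v + w) t)
        = logitMean (S t) (util x θ t) (util x v t) + logitMean (S t) (util x θ t) (util x w t) := by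
      simp only [logitMean, ← Finset.sum_add_distrib, util, inner_add_right, mul_add]
    rw [h]
    simp only [util, inner_add_right]
    ring
  map_smul' a v := by
    simp only [Finset.smul_sum, smul_smul, RingHom.id_apply]
    refine Finset.sum_congr rfl fun t _ => Finset.sum_congr rfl fun i _ => ?_
    congr 1
    have h : logitMean (S t) (util x θ t) (util x (a • v) t)
        = a * logitMean (S t) (util x θ t) (util x v t) := by
      simp only [logitMean, Finset.mul_sum, util, inner_smul_right]
      exact Finset.sum_congr rfl fun _ _ => by ring
    rw [h]
    simp only [util, inner_smul_right]
    ring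

lemma inner_hess (D : Finset ℕ) (x : ℕ → Fin N → Vec d) (S : ℕ → Finset (Fin N)) (θ b v : Vec d) :
    inner ℝ b (hess D x S θ v)
      = ∑ t ∈ D, logitCov (S t) (util x θ t) (util x b t) (util x v t) := by
  simp only [hess, LinearMap.coe_mk, AddHom.coe_mk, inner_sum]
  refine Finset.sum_congr rfl fun t _ => ?_
  rw [logitCov]
  nth_rewrite 2 [logitMean]
  rw [Finset.sum_mul, ← Finset.sum_sub_distrib]
  refine Finset.sum_congr rfl fun i _ => ?_
  rw [inner_smul_right, real_inner_comm]
  simp only [util]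
  ring

lemma inner_hess_comm (D : Finset ℕ) (x : ℕ → Fin N → Vec d) (S : ℕ → Finset (Fin N))
    (θ b v : Vec d) : inner ℝ b (hess D x S θ v) = inner ℝ v (hess D x S θ b) := by
  simp only [inner_hess, logitCov]
  refine Finset.sum_congr rfl fun t _ => ?_
  rw [mul_comm (logitMean _ _ _)]
  congr 1
  exact Finset.sum_congr rfl fun i _ => by ring

/-- Lower bound on the products `p_t(i | S_t, θ) p_t(0 | S_t, θ)` for the rounds in `D` near `θs`. -/
def CurvatureBound (D : Finset ℕ) (x : ℕ → Fin N → Vec d) (S : ℕ → Finset (Fin N)) (θs : Vec d)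
    (κ : ℝ) : Prop :=
  ∀ t ∈ D, ∀ i ∈ S t, ∀ θ : Vec d, ‖θ - θs‖ ≤ 1 →
    κ ≤ choiceProb θ (x t) (S t) (some i) * choiceProb θ (x t) (S t) none

variable {D : Finset ℕ} {x : ℕ → Fin N → Vec d} {S : ℕ → Finset (Fin N)}
  {c : ℕ → Option (Fin N)} {θs : Vec d} {κ : ℝ}

/-- In each round the variance dominates `p₀ ∑ pᵢ zᵢ²`, and the curvature bound replaces `pᵢ p₀` by
`κ`. This is strong convexity of the negative log-likelihood, in the Gram norm, on the unit ball
around `θs`. -/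
lemma mul_gramForm_le_inner_hess (hκ : CurvatureBound D x S θs κ) {θ : Vec d}
    (hθ : ‖θ - θs‖ ≤ 1) (v : Vec d) :
    κ * gramForm D x S v ≤ inner ℝ v (hess D x S θ v) := by
  rw [inner_hess, gramForm, Finset.mul_sum]
  refine Finset.sum_le_sum fun t ht => ?_
  refine le_trans ?_ (le_logitCov_self (S t) (util x θ t) (util x v t))
  rw [Finset.mul_sum, Finset.mul_sum]
  refine Finset.sum_le_sum fun i hi => ?_
  have h := hκ t ht i hi θ hθ
  rw [choiceProb_some θ (x t) hi, choiceProb_none] at h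
  change κ ≤ logit (S t) (util x θ t) i * (1 / logitDen (S t) (util x θ t)) at h
  calc κ * util x v t i ^ 2
      ≤ (logit (S t) (util x θ t) i * (1 / logitDen (S t) (util x θ t))) * util x v t i ^ 2 :=
        mul_le_mul_of_nonneg_right h (sq_nonneg _)
    _ = _ := by ring

lemma inner_hess_self_nonneg (θ v : Vec d) : 0 ≤ inner ℝ v (hess D x S θ v) := by
  rw [inner_hess]
  exact Finset.sum_nonneg fun t _ => logitCov_self_nonneg _ _ _

lemma hasDerivAt_inner_noise (θ v b : Vec d) (s : ℝ) :
    HasDerivAt (fun s : ℝ => - inner ℝ b (noise D x S c (θ + s • v)))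
      (inner ℝ b (hess D x S (θ + s • v) v)) s := by
  rw [inner_hess]
  simp only [inner_noise, ← Finset.sum_neg_distrib, neg_sub, util_add_smul]
  exact HasDerivAt.fun_sum fun t _ =>
    (hasDerivAt_logitMean (S t) (util x θ t) (util x v t) (util x b t) s).sub_const _

/-- The negative log-likelihood of the rounds in `D`. -/
def nll (D : Finset ℕ) (x : ℕ → Fin N → Vec d) (S : ℕ → Finset (Fin N))
    (c : ℕ → Option (Fin N)) (θ : Vec d) : ℝ :=
  ∑ t ∈ D, (Real.log (logitDen (S t) (util x θ t))
    - ∑ i ∈ S t, (if c t = some i then util x θ t i else 0))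

lemma continuous_nll : Continuous (nll D x S c) := by
  unfold nll
  refine continuous_finsetSum _ fun t _ => Continuous.sub ?_ ?_
  · refine Continuous.log ?_ fun θ => (logitDen_pos _ _).ne'
    unfold logitDen util
    fun_prop
  · refine continuous_finsetSum _ fun i _ => ?_
    unfold util
    split_ifs <;> fun_prop

lemma hasDerivAt_nll (θ v : Vec d) (s : ℝ) :
    HasDerivAt (fun s : ℝ => nll D x S c (θ + s • v))
      (- inner ℝ v (noise D x S c (θ + s • v))) s := by
  rw [inner_noise]
  simp only [nll, ← Finset.sum_neg_distrib, neg_sub, util_add_smul]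
  refine HasDerivAt.fun_sum fun t _ => HasDerivAt.sub
    (hasDerivAt_log_logitDen (S t) (util x θ t) (util x v t) s) (HasDerivAt.fun_sum fun i _ => ?_)
  by_cases h : c t = some i
  · simp only [h, if_true]
    simpa using ((hasDerivAt_id s).mul_const (util x v t i)).const_add (util x θ t i)
  · simp only [h, if_false]
    exact hasDerivAt_const _ _

/-- If the score points outwards on a unit sphere, the likelihood equation has a solution. -/
lemma exists_noise_eq_zero
    (h : ∀ e : Vec d, ‖e‖ = 1 → inner ℝ e (noise D x S c (θs + e)) < 0) :
    ∃ θ, noise D x S c θ = 0 := by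
  -- Minimize the negative log-likelihood over the closed ball. An interior minimizer is a critical
  -- point; a minimizer on the sphere is impossible, since moving towards the centre decreases the
  -- objective.
  obtain ⟨θ, hθ, hmin⟩ := (isCompact_closedBall θs 1).exists_isMinOn
    ⟨θs, by simp⟩ (continuous_nll (D := D) (x := x) (S := S) (c := c)).continuousOn
  rw [mem_closedBall_iff_norm] at hθ
  rcases hθ.lt_or_eq with hlt | heq
  · refine ⟨θ, ?_⟩
    set b := noise D x S c θ with hb
    have hd := hasDerivAt_nll (D := D) (x := x) (S := S) (c := c) θ b 0
    have hloc : IsLocalMin (fun s : ℝ => nll D x S c (θ + s • b)) 0 := by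
      have hc : Filter.Tendsto (fun s : ℝ => θ + s • b) (nhds 0) (nhds θ) := by
        have : Continuous fun s : ℝ => θ + s • b := by fun_prop
        simpa using this.tendsto 0
      have hnhds : Metric.closedBall θs 1 ∈ nhds θ :=
        Filter.mem_of_superset (Metric.isOpen_ball.mem_nhds (mem_ball_iff_norm.2 hlt))
          Metric.ball_subset_closedBall
      filter_upwards [hc hnhds] with s hs
      simpa using hmin hs
    have h0 := hloc.hasDerivAt_eq_zero hd
    simp only [zero_smul, add_zero, neg_eq_zero] at h0
    rw [← hb] at h0
    exact inner_self_eq_zero.1 h0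
  · exfalso
    set e := θ - θs with he
    have hd := hasDerivAt_nll (D := D) (x := x) (S := S) (c := c) θs e 1
    have hpos : 0 < - inner ℝ e (noise D x S c (θs + (1 : ℝ) • e)) := by
      rw [one_smul]; linarith [h e heq]
    have h1 := (hasDerivAt_iff_tendsto_slope.1 hd).eventually (lt_mem_nhds hpos)
    have h2 : ∀ᶠ s in nhdsWithin (1 : ℝ) (Set.Iio 1),
        0 < slope (fun s : ℝ => nll D x S c (θs + s • e)) 1 s :=
      h1.filter_mono (nhdsWithin_mono _ fun s hs => ne_of_lt hs)
    have h3 : ∀ᶠ s in nhdsWithin (1 : ℝ) (Set.Iio 1), s ∈ Set.Ioo (0 : ℝ) 1 :=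
      Ioo_mem_nhdsLT zero_lt_one
    obtain ⟨s, hs, hs0, hs1⟩ := (h2.and h3).exists
    rw [slope_def_field] at hs
    have h4 : nll D x S c θ ≤ nll D x S c (θs + s • e) := by
      refine hmin ?_
      rw [mem_closedBall_iff_norm, add_sub_cancel_left, norm_smul, heq, mul_one,
        Real.norm_of_nonneg hs0.le]
      exact hs1.le
    have h5 : θs + (1 : ℝ) • e = θ := by rw [he]; simp
    rw [h5] at hs
    have : (nll D x S c (θs + s • e) - nll D x S c θ) / (s - 1) ≤ 0 :=
      div_nonpos_of_nonneg_of_nonpos (by linarith) (by linarith)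
    linarith

/-- Any solution of the likelihood equation lies in the ball on whose sphere the score points
outwards. -/
lemma norm_sub_le_one_of_noise_eq_zero
    (h : ∀ e : Vec d, ‖e‖ = 1 → inner ℝ e (noise D x S c (θs + e)) < 0) {θ : Vec d}
    (hθ : noise D x S c θ = 0) : ‖θ - θs‖ ≤ 1 := by
  by_contra! hgt
  set e := (1 / ‖θ - θs‖) • (θ - θs) with he
  have hn : 0 < ‖θ - θs‖ := by linarith
  have hne : ‖e‖ = 1 := by
    rw [he, norm_smul, Real.norm_of_nonneg (by positivity), one_div_mul_cancel hn.ne']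
  -- Along a ray the outward component of the score is nondecreasing even outside the ball, because
  -- the Hessian is positive semidefinite everywhere. Being positive on the sphere, it cannot vanish
  -- further out.
  have hmono : Monotone fun s : ℝ => - inner ℝ e (noise D x S c (θs + s • e)) :=
    monotone_of_hasDerivAt_nonneg (fun s => hasDerivAt_inner_noise θs e e s)
      fun s => inner_hess_self_nonneg _ _
  have h1 := hmono hgt.le
  have h2 : θs + ‖θ - θs‖ • e = θ := by
    rw [he, smul_smul, mul_one_div_cancel hn.ne', one_smul, add_sub_cancel]
  simp only [h2, hθ, inner_zero_right, one_smul, neg_zero] at h1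
  linarith [h e hne]

/-- Strong monotonicity of the score near `θs`. -/
lemma mul_gramForm_le_inner_noise_sub (hκ : CurvatureBound D x S θs κ) {e : Vec d}
    (he : ‖e‖ ≤ 1) : κ * gramForm D x S e ≤
      inner ℝ e (noise D x S c θs) - inner ℝ e (noise D x S c (θs + e)) := by
  have hd := fun s => hasDerivAt_inner_noise (D := D) (x := x) (S := S) (c := c) θs e e s
  obtain ⟨s, hs, hs'⟩ := exists_hasDerivAt_eq_slope _ _ (zero_lt_one' ℝ)
    (fun s _ => (hd s).continuousAt.continuousWithinAt) fun s _ => hd s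
  simp only [one_smul, zero_smul, add_zero, sub_zero, div_one] at hs'
  have h1 : ‖θs + s • e - θs‖ ≤ 1 := by
    rw [add_sub_cancel_left, norm_smul, Real.norm_of_nonneg hs.1.le]
    exact mul_le_one₀ hs.2.le (norm_nonneg _) he
  have := mul_gramForm_le_inner_hess hκ h1 e
  linarith

/-- Linearization of the score at `θs`. -/
lemma abs_inner_noise_sub_hess_le (hx : ∀ t ∈ D, ∀ i ∈ S t, ‖x t i‖ ≤ 1) (e b : Vec d) :
    |inner ℝ b (noise D x S c θs) - inner ℝ b (noise D x S c (θs + e))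
      - inner ℝ b (hess D x S θs e)|
      ≤ 6 * ‖e‖ * (√(gramForm D x S b) * √(gramForm D x S e)) := by
  have h1 : inner ℝ b (noise D x S c θs) - inner ℝ b (noise D x S c (θs + e))
      - inner ℝ b (hess D x S θs e)
      = ∑ t ∈ D, (logitMean (S t) (fun i => util x θs t i + util x e t i) (util x b t)
        - logitMean (S t) (util x θs t) (util x b t)
        - logitCov (S t) (util x θs t) (util x b t) (util x e t)) := by
    have h2 := util_add_smul x θs e 1
    simp only [one_smul, one_mul] at h2
    simp only [inner_noise, inner_hess, ← Finset.sum_sub_distrib, h2]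
    exact Finset.sum_congr rfl fun t _ => by ring
  rw [h1]
  calc _ ≤ ∑ t ∈ D, 6 * ‖e‖ * (√(∑ i ∈ S t, util x b t i ^ 2) * √(∑ i ∈ S t, util x e t i ^ 2)) := by
        refine (Finset.abs_sum_le_sum_abs _ _).trans (Finset.sum_le_sum fun t ht => ?_)
        refine abs_logitMean_taylor_le _ _ _ _ (norm_nonneg _) fun i hi => ?_
        refine (abs_real_inner_le_norm _ _).trans ?_
        exact mul_le_of_le_one_left (norm_nonneg _) (hx t ht i hi)
    _ ≤ _ := by
        rw [← Finset.mul_sum]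
        refine mul_le_mul_of_nonneg_left ?_ (by positivity)
        exact Real.sum_sqrt_mul_sqrt_le D (fun t => Finset.sum_nonneg fun _ _ => sq_nonneg _)
          fun t => Finset.sum_nonneg fun _ _ => sq_nonneg _

/-- The curvature bound makes the Hessian injective, hence surjective in finite dimension. If `H a =
y`, symmetry turns `⟨a, H e⟩` into `⟨y, e⟩`, the quantity to be estimated. -/
lemma exists_hess_eq (hκ : CurvatureBound D x S θs κ) (hκ0 : 0 < κ) {lam : ℝ} (hlam : 0 < lam)
    (hq : ∀ v, lam * ‖v‖ ^ 2 ≤ gramForm D x S v) (y : Vec d) : ∃ a, hess D x S θs a = y := by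
  refine LinearMap.injective_iff_surjective.1 ?_ y
  rw [← LinearMap.ker_eq_bot, LinearMap.ker_eq_bot']
  intro v hv
  have h1 := mul_gramForm_le_inner_hess hκ (θ := θs) (by simp) v
  rw [hv, inner_zero_right] at h1
  have h2 : gramForm D x S v ≤ 0 := by
    by_contra! h
    have := mul_pos hκ0 h
    linarith
  have h3 : lam * ‖v‖ ^ 2 ≤ 0 := (hq v).trans h2
  have h4 : ‖v‖ ^ 2 ≤ 0 := by
    by_contra! h
    have := mul_pos hlam h
    linarith
  simpa using le_antisymm h4 (sq_nonneg _)

/-- Error of the maximum likelihood estimator in a direction `y`, on the event that the noise is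
of size at most `M` in the norm dual to the Gram matrix. -/
theorem mle_error_le {est : Estimator N d} (hest : IsMLE est)
    (hκ : CurvatureBound D x S θs κ) (hκ0 : 0 < κ) {lam : ℝ} (hlam : 0 < lam)
    (hx : ∀ t ∈ D, ∀ i ∈ S t, ‖x t i‖ ≤ 1)
    (hq : ∀ v, lam * ‖v‖ ^ 2 ≤ gramForm D x S v) {M : ℝ} (hM0 : 0 ≤ M)
    (hM : ∀ v, inner ℝ v (noise D x S c θs) ≤ M * √(gramForm D x S v)) (hMκ : M < κ * √lam)
    {a y : Vec d} (ha : hess D x S θs a = y) :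
    |inner ℝ y (est D (fun u => x u) (fun u => S u) (fun u => c u) - θs)| ≤
      |inner ℝ a (noise D x S c θs)| + 6 * M ^ 2 / (κ ^ 2 * √lam) * √(gramForm D x S a) := by
  have hsq : ∀ v : Vec d, √lam * ‖v‖ ≤ √(gramForm D x S v) := fun v => by
    rw [← Real.sqrt_sq (norm_nonneg v), ← Real.sqrt_mul hlam.le]
    exact Real.sqrt_le_sqrt (hq v)
  -- On the unit sphere strong monotonicity gains `κ Q²`, where `Q = √(gramForm e) ≥ √lam`, and this
  -- beats the noise `M Q` because `M < κ √lam`. So a solution of the likelihood equation exists and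
  -- every solution lies in the unit ball.
  have hout : ∀ e : Vec d, ‖e‖ = 1 → inner ℝ e (noise D x S c (θs + e)) < 0 := by
    intro e he
    have h1 := mul_gramForm_le_inner_noise_sub (c := c) hκ he.le
    have h2 := hM e
    have h3 := hsq e
    rw [he, mul_one] at h3
    have h4 := Real.sq_sqrt (gramForm_nonneg D x S e)
    have h5 : 0 < √lam := Real.sqrt_pos.2 hlam
    have h6 : M < κ * √(gramForm D x S e) := hMκ.trans_le (mul_le_mul_of_nonneg_left h3 hκ0.le)
    have h7 : M * √(gramForm D x S e) < κ * √(gramForm D x S e) * √(gramForm D x S e) :=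
      mul_lt_mul_of_pos_right h6 (by linarith)
    nlinarith
  set θ := est D (fun u => x u) (fun u => S u) (fun u => c u) with hθ
  have hz : noise D x S c θ = 0 := by
    obtain ⟨θ₁, h1⟩ := exists_noise_eq_zero hout
    have := hest.score_eq_zero D (fun u => x u) (fun u => S u) (fun u => c u)
      ⟨θ₁, by rw [score_eq_neg_noise, h1, neg_zero]⟩
    rwa [score_eq_neg_noise, neg_eq_zero] at this
  have hball := norm_sub_le_one_of_noise_eq_zero hout hz
  set e := θ - θs with he
  have hθe : θs + e = θ := by rw [he, add_sub_cancel]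
  have hmono := mul_gramForm_le_inner_noise_sub (c := c) hκ hball
  have hlin := abs_inner_noise_sub_hess_le (c := c) (θs := θs) hx e a
  rw [hθe, hz, inner_zero_right, sub_zero] at hmono hlin
  -- Symmetry of the Hessian: `⟨a, H e⟩ = ⟨e, H a⟩ = ⟨y, e⟩`.
  rw [inner_hess_comm, ha, real_inner_comm] at hlin
  set Q := √(gramForm D x S e) with hQ
  have hQ2 : Q ^ 2 = gramForm D x S e := Real.sq_sqrt (gramForm_nonneg D x S e)
  have hQ0 : 0 ≤ Q := Real.sqrt_nonneg _
  have hl0 : 0 < √lam := Real.sqrt_pos.2 hlam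
  -- Consistency in the Gram norm: `κ Q² ≤ ⟨e, noise⟩ ≤ M Q`. Together with the eigenvalue bound
  -- this controls `‖e‖` as well, so the linearization error is quadratic in `M`.
  have hQM : Q ≤ M / κ := by
    rw [le_div_iff₀ hκ0]
    by_contra! h
    have h1 : M * Q < Q * κ * Q := by
      refine mul_lt_mul_of_pos_right h ?_
      by_contra! h'
      have : Q = 0 := le_antisymm h' hQ0
      rw [this] at h
      linarith
    have := hM e
    nlinarith
  have heM : ‖e‖ ≤ M / (κ * √lam) := by
    rw [← div_div, le_div_iff₀ hl0, mul_comm]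
    exact (hsq e).trans hQM
  have hA0 : 0 ≤ √(gramForm D x S a) := Real.sqrt_nonneg _
  have hfin : 6 * ‖e‖ * (√(gramForm D x S a) * Q)
      ≤ 6 * M ^ 2 / (κ ^ 2 * √lam) * √(gramForm D x S a) := by
    calc 6 * ‖e‖ * (√(gramForm D x S a) * Q)
        ≤ 6 * (M / (κ * √lam)) * (√(gramForm D x S a) * (M / κ)) := by gcongr
      _ = _ := by field_simp
  have h8 := abs_sub_abs_le_abs_sub (inner ℝ y e) (inner ℝ a (noise D x S c θs))
  rw [abs_sub_comm, real_inner_comm] at h8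
  rw [real_inner_comm] at hlin
  rw [real_inner_comm]
  linarith

end Likelihood

/-! ### Gram matrices -/

section PosDefMatrix

variable {n : Type*} [Fintype n]

lemma PosSemidef.exists_eq_transpose_mul_self [DecidableEq n] {V : Matrix n n ℝ}
    (hV : V.PosSemidef) : ∃ B : Matrix n n ℝ, V = Bᵀ * B := by
  open scoped MatrixOrder Matrix.Norms.L2Operator in
  obtain ⟨B, hB⟩ := CStarAlgebra.nonneg_iff_eq_star_mul_self.mp hV.nonneg
  exact ⟨B, by rw [hB, Matrix.star_eq_conjTranspose, Matrix.conjTranspose_eq_transpose_of_trivial]⟩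

lemma dotProduct_transpose_mul_self_mulVec (B : Matrix n n ℝ) (a b : n → ℝ) :
    a ⬝ᵥ (Bᵀ * B) *ᵥ b = (B *ᵥ a) ⬝ᵥ (B *ᵥ b) := by
  rw [← Matrix.mulVec_mulVec, Matrix.dotProduct_mulVec, Matrix.vecMul_transpose]

lemma PosSemidef.sq_dotProduct_mulVec_le {V : Matrix n n ℝ} (hV : V.PosSemidef) (a b : n → ℝ) :
    (a ⬝ᵥ V *ᵥ b) ^ 2 ≤ (a ⬝ᵥ V *ᵥ a) * (b ⬝ᵥ V *ᵥ b) := by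
  classical
  obtain ⟨B, rfl⟩ := PosSemidef.exists_eq_transpose_mul_self hV
  simp only [dotProduct_transpose_mul_self_mulVec]
  have := Finset.sum_mul_sq_le_sq_mul_sq Finset.univ (B *ᵥ a) (B *ᵥ b)
  simpa only [dotProduct, ← pow_two] using this

lemma PosSemidef.dotProduct_mulVec_self_nonneg {V : Matrix n n ℝ} (hV : V.PosSemidef)
    (a : n → ℝ) : 0 ≤ a ⬝ᵥ V *ᵥ a := by
  simpa using hV.dotProduct_mulVec_nonneg a

variable [DecidableEq n]

lemma PosDef.mul_inv_mulVec {V : Matrix n n ℝ} (hV : V.PosDef) (y : n → ℝ) :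
    V *ᵥ (V⁻¹ *ᵥ y) = y := by
  rw [Matrix.mulVec_mulVec, Matrix.mul_nonsing_inv _ ((Matrix.isUnit_iff_isUnit_det _).1 hV.isUnit),
    Matrix.one_mulVec]

/-- Cauchy-Schwarz inequality for the norms of `V` and `V⁻¹`. -/
lemma PosDef.sq_dotProduct_le {V : Matrix n n ℝ} (hV : V.PosDef) (a y : n → ℝ) :
    (a ⬝ᵥ y) ^ 2 ≤ (a ⬝ᵥ V *ᵥ a) * (y ⬝ᵥ V⁻¹ *ᵥ y) := by
  have h := PosSemidef.sq_dotProduct_mulVec_le hV.posSemidef a (V⁻¹ *ᵥ y)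
  rwa [PosDef.mul_inv_mulVec hV, dotProduct_comm (V⁻¹ *ᵥ y) y] at h

lemma PosDef.inv_quadratic_nonneg {V : Matrix n n ℝ} (hV : V.PosDef) (y : n → ℝ) :
    0 ≤ y ⬝ᵥ V⁻¹ *ᵥ y :=
  PosSemidef.dotProduct_mulVec_self_nonneg hV.inv.posSemidef y

/-- If `W ≤ c V` then `V⁻¹ ≤ c W⁻¹`. -/
lemma PosDef.inv_quadratic_le {V W : Matrix n n ℝ} (hV : V.PosDef) (hW : W.PosDef) {c : ℝ}
    (h : ∀ a, a ⬝ᵥ W *ᵥ a ≤ c * (a ⬝ᵥ V *ᵥ a)) (y : n → ℝ) :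
    y ⬝ᵥ V⁻¹ *ᵥ y ≤ c * (y ⬝ᵥ W⁻¹ *ᵥ y) := by
  have hq := PosDef.inv_quadratic_nonneg hV y
  have hw := PosDef.inv_quadratic_nonneg hW y
  -- Test with `a = V⁻¹ y`, for which `a ⬝ᵥ y` and `a ⬝ᵥ V a` both equal `q`: Cauchy-Schwarz for `W`
  -- gives `q² ≤ c q w`.
  have h1 := PosDef.sq_dotProduct_le hW (V⁻¹ *ᵥ y) y
  have h2 := h (V⁻¹ *ᵥ y)
  rw [PosDef.mul_inv_mulVec hV] at h2
  rw [dotProduct_comm (V⁻¹ *ᵥ y) y] at h1 h2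
  set q := y ⬝ᵥ V⁻¹ *ᵥ y
  set w := y ⬝ᵥ W⁻¹ *ᵥ y
  rcases hq.eq_or_lt with h0 | h0
  · have h3 := h (V⁻¹ *ᵥ y)
    have h4 := PosSemidef.dotProduct_mulVec_self_nonneg hW.posSemidef (V⁻¹ *ᵥ y)
    by_cases hc : 0 ≤ c
    · rw [← h0]; positivity
    · push Not at hc
      by_cases hy : y = 0
      · simp [q, w, hy]
      · have h5 := hV.inv.dotProduct_mulVec_pos hy
        simp only [star_trivial] at h5
        exact absurd h5 (by simp only [q] at h0; linarith)
  · have h3 : q ^ 2 ≤ c * q * w := h1.trans (mul_le_mul_of_nonneg_right h2 hw)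
    have h4 : q * q ≤ q * (c * w) := by nlinarith
    exact le_of_mul_le_mul_left h4 h0

/-- Matrix determinant lemma for a rank-one update; it converts a squared inverse norm into growth
of the determinant. -/
lemma det_add_vecMulVec {V : Matrix n n ℝ} (hV : V.PosDef) (y : n → ℝ) :
    (V + Matrix.vecMulVec y y).det = V.det * (1 + y ⬝ᵥ V⁻¹ *ᵥ y) := by
  have hu := (Matrix.isUnit_iff_isUnit_det _).1 hV.isUnit
  rw [Matrix.vecMulVec_eq Unit, Matrix.det_add_replicateCol_mul_replicateRow hu]
  congr 1
  rw [Matrix.det_unique, Matrix.add_apply, Matrix.one_apply_eq, Matrix.mul_assoc]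
  congr 1

omit [DecidableEq n] in
lemma dotProduct_vecMulVec_mulVec (y a : n → ℝ) :
    a ⬝ᵥ Matrix.vecMulVec y y *ᵥ a = (y ⬝ᵥ a) ^ 2 := by
  rw [Matrix.vecMulVec_mulVec]
  simp [dotProduct_smul, dotProduct_comm, pow_two]

omit [DecidableEq n] in
lemma dotProduct_sum_mulVec {ι : Type*} (F : Finset ι) (A : ι → Matrix n n ℝ) (a : n → ℝ) :
    a ⬝ᵥ (∑ i ∈ F, A i) *ᵥ a = ∑ i ∈ F, a ⬝ᵥ A i *ᵥ a := by
  rw [Matrix.sum_mulVec, dotProduct_sum]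

omit [DecidableEq n] in
lemma posSemidef_vecMulVec_self (y : n → ℝ) : (Matrix.vecMulVec y y).PosSemidef := by
  simpa using Matrix.posSemidef_vecMulVec_self_star y

/-- One step of the elliptical potential argument. -/
lemma sum_inv_quadratic_le_log_det {ι : Type*} {V : Matrix n n ℝ} (hV : V.PosDef)
    (F : Finset ι) (y : ι → n → ℝ)
    (h : ∀ a, ∑ i ∈ F, (y i ⬝ᵥ a) ^ 2 ≤ a ⬝ᵥ V *ᵥ a) :
    ∑ i ∈ F, y i ⬝ᵥ V⁻¹ *ᵥ y i ≤
      4 * (Real.log (V + ∑ i ∈ F, Matrix.vecMulVec (y i) (y i)).det - Real.log V.det) := by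
  classical
  induction F using Finset.induction_on with
  | empty => simp
  | insert i F hi ih =>
    have hF : ∀ a, ∑ i ∈ F, (y i ⬝ᵥ a) ^ 2 ≤ a ⬝ᵥ V *ᵥ a := fun a =>
      (Finset.sum_le_sum_of_subset_of_nonneg (Finset.subset_insert i F)
        fun _ _ _ => sq_nonneg _).trans (h a)
    have ih' := ih hF
    have hW : (V + ∑ i ∈ F, Matrix.vecMulVec (y i) (y i)).PosDef :=
      hV.add_posSemidef (Matrix.posSemidef_sum F fun i _ => posSemidef_vecMulVec_self (y i))
    -- By hypothesis the whole batch is dominated by `V`, so each partially updated matrix is at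
    -- most `2V`, and the inverse form at `V` is at most twice that at the updated matrix. This
    -- allows all items of one round to be measured with the matrix from before the round.
    have hle := PosDef.inv_quadratic_le hV hW (c := 2) (fun a => by
      rw [Matrix.add_mulVec, dotProduct_add, dotProduct_sum_mulVec]
      simp only [dotProduct_vecMulVec_mulVec]
      linarith [hF a]) (y i)
    rw [Finset.sum_insert hi, Finset.sum_insert hi,
      add_comm (Matrix.vecMulVec (y i) (y i)), ← add_assoc, det_add_vecMulVec hW]
    set w := y i ⬝ᵥ (V + ∑ i ∈ F, Matrix.vecMulVec (y i) (y i))⁻¹ *ᵥ y i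
    set q := y i ⬝ᵥ V⁻¹ *ᵥ y i with hq
    have hq0 : 0 ≤ q := PosDef.inv_quadratic_nonneg hV (y i)
    -- The domination hypothesis tested at `V⁻¹ y i` reads `q² ≤ q`.
    have hq1 : q ≤ 1 := by
      have h1 := (Finset.single_le_sum (f := fun j => (y j ⬝ᵥ (V⁻¹ *ᵥ y i)) ^ 2)
        (fun _ _ => sq_nonneg _) (Finset.mem_insert_self i F)).trans (h (V⁻¹ *ᵥ y i))
      rw [PosDef.mul_inv_mulVec hV, dotProduct_comm (V⁻¹ *ᵥ y i)] at h1
      change q ^ 2 ≤ q at h1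
      nlinarith
    rw [Real.log_mul hW.det_pos.ne' (by linarith)]
    -- `log (1 + w) ≥ log (1 + q/2) ≥ (q/2) / (1 + q/2) ≥ q/4`, the last step because `q ≤ 1`; this
    -- yields the factor `4`.
    have h2 : q / 4 ≤ Real.log (1 + w) := by
      have h3 : Real.log (1 + q / 2) ≤ Real.log (1 + w) :=
        Real.log_le_log (by linarith) (by linarith)
      refine le_trans ?_ h3
      refine le_trans ?_ (Real.one_sub_inv_le_log_of_pos (by linarith))
      have h4 : 1 - (1 + q / 2)⁻¹ = (q / 2) / (1 + q / 2) := by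
        have : 1 + q / 2 ≠ 0 := by linarith
        field_simp
        ring
      rw [h4, le_div_iff₀ (by linarith)]
      nlinarith
    linarith

/-- Each eigenvalue is a Rayleigh quotient at a unit eigenvector, hence at least `lam`, and the
determinant is their product. -/
lemma prod_le_det {V : Matrix n n ℝ} (hV : V.PosDef) {lam : ℝ} (hlam : 0 ≤ lam)
    (h : ∀ a, lam * (a ⬝ᵥ a) ≤ a ⬝ᵥ V *ᵥ a) : lam ^ Fintype.card n ≤ V.det := by
  have hdet := hV.1.det_eq_prod_eigenvalues
  simp only [RCLike.ofReal_real_eq_id, id] at hdet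
  rw [hdet, ← Finset.card_univ, ← Finset.prod_const]
  refine Finset.prod_le_prod (fun _ _ => hlam) fun i _ => ?_
  rw [hV.1.eigenvalues_eq]
  have h1 := h (hV.1.eigenvectorBasis i).ofLp
  have h2 : (hV.1.eigenvectorBasis i).ofLp ⬝ᵥ (hV.1.eigenvectorBasis i).ofLp = 1 := by
    have := hV.1.eigenvectorBasis.orthonormal.1 i
    have h3 := EuclideanSpace.real_norm_sq_eq (hV.1.eigenvectorBasis i)
    rw [this] at h3
    simpa [dotProduct, ← pow_two] using h3.symm
  rw [h2, mul_one] at h1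
  simpa using h1

lemma det_le_prod {V : Matrix n n ℝ} (hV : V.PosDef) {lam : ℝ}
    (h : ∀ a, a ⬝ᵥ V *ᵥ a ≤ lam * (a ⬝ᵥ a)) : V.det ≤ lam ^ Fintype.card n := by
  have hdet := hV.1.det_eq_prod_eigenvalues
  simp only [RCLike.ofReal_real_eq_id, id] at hdet
  rw [hdet, ← Finset.card_univ, ← Finset.prod_const]
  refine Finset.prod_le_prod (fun i _ => (hV.eigenvalues_pos i).le) fun i _ => ?_
  rw [hV.1.eigenvalues_eq]
  have h1 := h (hV.1.eigenvectorBasis i).ofLp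
  have h2 : (hV.1.eigenvectorBasis i).ofLp ⬝ᵥ (hV.1.eigenvectorBasis i).ofLp = 1 := by
    have := hV.1.eigenvectorBasis.orthonormal.1 i
    have h3 := EuclideanSpace.real_norm_sq_eq (hV.1.eigenvectorBasis i)
    rw [this] at h3
    simpa [dotProduct, ← pow_two] using h3.symm
  rw [h2, mul_one] at h1
  simpa using h1

end PosDefMatrix

/-! ### Gram matrices of rounds: dual norms, nets, and log-determinants -/

section Gram

variable {N d : ℕ}

lemma inner_eq_dotProduct (a b : Vec d) : inner ℝ a b = a.ofLp ⬝ᵥ b.ofLp := by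
  rw [EuclideanSpace.inner_eq_star_dotProduct, star_trivial, dotProduct_comm]

variable (D : Finset ℕ) (x : ℕ → Fin N → Vec d) (S : ℕ → Finset (Fin N))

lemma dotProduct_gram_mulVec (v : Fin d → ℝ) :
    v ⬝ᵥ gram D x S *ᵥ v = gramForm D x S (WithLp.toLp 2 v) := by
  rw [gram, gramForm, dotProduct_sum_mulVec]
  refine Finset.sum_congr rfl fun t _ => ?_
  rw [dotProduct_sum_mulVec]
  refine Finset.sum_congr rfl fun i _ => ?_
  rw [dotProduct_vecMulVec_mulVec, inner_eq_dotProduct]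

lemma gram_posSemidef : (gram D x S).PosSemidef :=
  Matrix.posSemidef_sum _ fun _ _ => Matrix.posSemidef_sum _ fun _ _ => posSemidef_vecMulVec_self _

variable {D x S} {lam : ℝ}

lemma gram_posDef (hlam : 0 < lam) (h : ∀ v, lam * ‖v‖ ^ 2 ≤ gramForm D x S v) :
    (gram D x S).PosDef := by
  refine Matrix.PosDef.of_dotProduct_mulVec_pos (gram_posSemidef D x S).1 fun v hv => ?_
  rw [star_trivial, dotProduct_gram_mulVec]
  refine lt_of_lt_of_le ?_ (h _)
  have : WithLp.toLp 2 v ≠ 0 := fun h0 => hv (by simpa using congrArg WithLp.ofLp h0)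
  have := norm_pos_iff.2 this
  positivity

lemma sq_weightedNorm_inv (hV : (gram D x S).PosDef) (y : Vec d) :
    weightedNorm (gram D x S)⁻¹ y ^ 2 = y.ofLp ⬝ᵥ (gram D x S)⁻¹ *ᵥ y.ofLp :=
  Real.sq_sqrt (PosDef.inv_quadratic_nonneg hV _)

lemma inner_le_sqrt_gramForm_mul_weightedNorm (hV : (gram D x S).PosDef) (a y : Vec d) :
    inner ℝ a y ≤ √(gramForm D x S a) * weightedNorm (gram D x S)⁻¹ y := by
  have h := PosDef.sq_dotProduct_le hV a.ofLp y.ofLp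
  rw [dotProduct_gram_mulVec, ← inner_eq_dotProduct, ← sq_weightedNorm_inv hV] at h
  refine le_trans (le_abs_self _) ((Real.abs_le_sqrt h).trans_eq ?_)
  rw [Real.sqrt_mul (gramForm_nonneg _ _ _ _),
    Real.sqrt_sq (show 0 ≤ weightedNorm (gram D x S)⁻¹ y from Real.sqrt_nonneg _)]

/-- A direction solving the Hessian equation is controlled by the inverse Gram norm. -/
lemma sqrt_gramForm_le_of_hess_eq {θs : Vec d} {κ : ℝ} (hκ : CurvatureBound D x S θs κ)
    (hκ0 : 0 < κ) (hV : (gram D x S).PosDef) {a y : Vec d} (ha : hess D x S θs a = y) :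
    √(gramForm D x S a) ≤ weightedNorm (gram D x S)⁻¹ y / κ := by
  have h1 := mul_gramForm_le_inner_hess hκ (θ := θs) (by simp) a
  rw [ha] at h1
  have h2 := h1.trans (inner_le_sqrt_gramForm_mul_weightedNorm hV a y)
  have h3 := Real.sq_sqrt (gramForm_nonneg D x S a)
  have h4 := Real.sqrt_nonneg (gramForm D x S a)
  set g := √(gramForm D x S a)
  have hw : 0 ≤ weightedNorm (gram D x S)⁻¹ y := Real.sqrt_nonneg _
  rw [le_div_iff₀ hκ0]
  rcases h4.eq_or_lt with h0 | h0
  · rw [← h0, zero_mul]; exact hw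
  · refine le_of_mul_le_mul_left ?_ h0
    rw [← h3] at h2
    linarith [h2]

/-- An isometry from the Euclidean norm to the norm of the Gram matrix. -/
lemma exists_gramForm_isometry (hV : (gram D x S).PosDef) :
    ∃ A : Vec d →ₗ[ℝ] Vec d, (∀ w, gramForm D x S (A w) = ‖w‖ ^ 2) ∧ Function.Surjective A := by
  obtain ⟨B, hB⟩ := PosSemidef.exists_eq_transpose_mul_self hV.posSemidef
  have hBu : IsUnit B.det := by
    have := hV.det_pos
    rw [hB, Matrix.det_mul, Matrix.det_transpose] at this
    exact isUnit_iff_ne_zero.2 fun h0 => by simp [h0] at this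
  refine ⟨Matrix.toLpLin 2 2 B⁻¹, fun w => ?_, fun u => ⟨Matrix.toLpLin 2 2 B u, ?_⟩⟩
  · rw [Matrix.toLpLin_apply, ← dotProduct_gram_mulVec, hB, dotProduct_transpose_mul_self_mulVec,
      Matrix.mulVec_mulVec, Matrix.mul_nonsing_inv _ hBu, Matrix.one_mulVec,
      EuclideanSpace.real_norm_sq_eq]
    simp [dotProduct, pow_two]
  · simp [Matrix.toLpLin_apply, Matrix.mulVec_mulVec, Matrix.nonsing_inv_mul _ hBu]

/-- Directions of unit length whose inner products with `Z` control `Z` in the dual norm. -/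
lemma exists_gramForm_basis (hV : (gram D x S).PosDef) :
    ∃ a : Fin d → Vec d, (∀ k, gramForm D x S (a k) = 1) ∧
      ∀ Z u : Vec d, inner ℝ u Z ≤ √(∑ k, (inner ℝ (a k) Z) ^ 2) * √(gramForm D x S u) := by
  obtain ⟨A, hA, hsurj⟩ := exists_gramForm_isometry hV
  refine ⟨fun k => A (EuclideanSpace.single k 1), fun k => by simp [hA], fun Z u => ?_⟩
  obtain ⟨w, rfl⟩ := hsurj u
  rw [hA, Real.sqrt_sq (norm_nonneg w)]
  have hw : w = ∑ k, w k • EuclideanSpace.single k (1 : ℝ) := by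
    ext j; simp [Finset.sum_apply, Pi.single_apply]
  have h1 : inner ℝ (A w) Z = ∑ k, inner ℝ (A (EuclideanSpace.single k 1)) Z * w k := by
    conv_lhs => rw [hw]
    simp only [map_sum, map_smul, sum_inner, inner_smul_left]
    exact Finset.sum_congr rfl fun k _ => by simp [mul_comm]
  rw [h1, EuclideanSpace.norm_eq]
  simp only [Real.norm_eq_abs, sq_abs]
  exact Real.sum_mul_le_sqrt_mul_sqrt _ _ _

/-- A finite `1/2`-net of the unit sphere, by unit vectors. -/
def IsSphereNet (Q : Finset (Vec d)) : Prop :=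
  (∀ q ∈ Q, ‖q‖ = 1) ∧ ∀ w : Vec d, ‖w‖ = 1 → ∃ q ∈ Q, ‖w - q‖ ≤ 1 / 2

/-- Compactness suffices: no bound on the cardinality is needed, because only finitely many
dimensions are compatible with a given `σ₀`. -/
lemma exists_isSphereNet (d : ℕ) : ∃ Q : Finset (Vec d), IsSphereNet Q := by
  obtain ⟨t, ht, htf, hcov⟩ := (isCompact_sphere (0 : Vec d) 1).finite_cover_balls
    (e := 1 / 2) (by norm_num)
  refine ⟨htf.toFinset, fun q hq => ?_, fun w hw => ?_⟩
  · have := ht (htf.mem_toFinset.1 hq); simpa using this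
  · have := hcov (show w ∈ Metric.sphere (0 : Vec d) 1 by simpa using hw)
    simp only [Set.mem_iUnion, Metric.mem_ball] at this
    obtain ⟨q, hq, hwq⟩ := this
    exact ⟨q, htf.mem_toFinset.2 hq, by rw [← dist_eq_norm]; exact hwq.le⟩

/-- The direction of `Z` is within `1/2` of a net point, and that point captures all but half of
`‖Z‖`. -/
lemma norm_le_of_sphereNet {Q : Finset (Vec d)} (hQ : IsSphereNet Q) {Z : Vec d} {s : ℝ}
    (hs : 0 ≤ s) (h : ∀ q ∈ Q, |inner ℝ q Z| ≤ s) : ‖Z‖ ≤ 2 * s := by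
  by_cases hZ : Z = 0
  · simp [hZ, hs]
  have hn : 0 < ‖Z‖ := norm_pos_iff.2 hZ
  set w := (1 / ‖Z‖) • Z with hw
  have hw1 : ‖w‖ = 1 := by
    rw [hw, norm_smul, Real.norm_of_nonneg (by positivity), one_div_mul_cancel hn.ne']
  obtain ⟨q, hq, hwq⟩ := hQ.2 w hw1
  have h1 : inner ℝ w Z = ‖Z‖ := by
    rw [hw, inner_smul_left, real_inner_self_eq_norm_sq]
    simp only [conj_trivial]
    field_simp
  have h2 : inner ℝ w Z = inner ℝ q Z + inner ℝ (w - q) Z := by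
    rw [← inner_add_left, add_sub_cancel]
  have h3 : inner ℝ (w - q) Z ≤ 1 / 2 * ‖Z‖ :=
    (real_inner_le_norm _ _).trans (mul_le_mul_of_nonneg_right hwq hn.le)
  have h4 := (abs_le.1 (h q hq)).2
  linarith

/-- Finitely many directions of unit length, as many as a net of the sphere has points, whose inner
products with `Z` control `Z` in the dual norm up to a factor `2`. -/
lemma exists_gramForm_net (hV : (gram D x S).PosDef) {Q : Finset (Vec d)} (hQ : IsSphereNet Q) :
    ∃ A : Vec d →ₗ[ℝ] Vec d, (∀ q ∈ Q, gramForm D x S (A q) = 1) ∧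
      ∀ (Z : Vec d) (s : ℝ), 0 ≤ s → (∀ q ∈ Q, |inner ℝ (A q) Z| ≤ s) →
        ∀ u, inner ℝ u Z ≤ 2 * s * √(gramForm D x S u) := by
  obtain ⟨A, hA, hsurj⟩ := exists_gramForm_isometry hV
  refine ⟨A, fun q hq => by rw [hA, hQ.1 q hq, one_pow], fun Z s hs h u => ?_⟩
  obtain ⟨w, rfl⟩ := hsurj u
  rw [hA, Real.sqrt_sq (norm_nonneg w), ← LinearMap.adjoint_inner_right]
  have h1 := norm_le_of_sphereNet hQ (Z := LinearMap.adjoint A Z) hs fun q hq => by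
    rw [LinearMap.adjoint_inner_right]; exact h q hq
  calc inner ℝ w (LinearMap.adjoint A Z) ≤ ‖w‖ * ‖LinearMap.adjoint A Z‖ := real_inner_le_norm _ _
    _ ≤ ‖w‖ * (2 * s) := by gcongr
    _ = _ := mul_comm _ _

lemma gram_insert {t : ℕ} (ht : t ∉ D) :
    gram (insert t D) x S = gram D x S
      + ∑ i ∈ S t, Matrix.vecMulVec (x t i).ofLp (x t i).ofLp := by
  rw [gram, Finset.sum_insert ht, add_comm, gram]

/-- A round offers at most `K` features from the unit ball, so their squared inner products with `a`
add up to at most `K ‖a‖² ≤ lam ‖a‖²`, which the Gram form dominates. This is where `K ≤ lam` makes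
the batched potential step applicable. -/
lemma sum_sq_weightedNorm_le_log_det {K : ℕ} {t : ℕ} (ht : t ∉ D)
    (hlam : 0 < lam) (hK : (K : ℝ) ≤ lam) (h : ∀ v, lam * ‖v‖ ^ 2 ≤ gramForm D x S v)
    (hS : (S t).card ≤ K) (hx : ∀ i ∈ S t, ‖x t i‖ ≤ 1) :
    ∑ i ∈ S t, weightedNorm (gram D x S)⁻¹ (x t i) ^ 2 ≤
      4 * (Real.log (gram (insert t D) x S).det - Real.log (gram D x S).det) := by
  have hV := gram_posDef hlam h
  rw [gram_insert ht]
  simp only [sq_weightedNorm_inv hV]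
  refine sum_inv_quadratic_le_log_det hV (S t) (fun i => (x t i).ofLp) fun a => ?_
  rw [dotProduct_gram_mulVec]
  refine le_trans ?_ (h _)
  have h1 : ∀ i ∈ S t, ((x t i).ofLp ⬝ᵥ a) ^ 2 ≤ ‖WithLp.toLp 2 a‖ ^ 2 := by
    intro i hi
    have h2 := abs_real_inner_le_norm (x t i) (WithLp.toLp 2 a)
    rw [inner_eq_dotProduct] at h2
    rw [← sq_abs]
    exact pow_le_pow_left₀ (abs_nonneg _)
      (h2.trans (mul_le_of_le_one_left (norm_nonneg _) (hx i hi))) 2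
  refine (Finset.sum_le_card_nsmul _ _ _ h1).trans ?_
  rw [nsmul_eq_mul]
  refine mul_le_mul_of_nonneg_right ?_ (sq_nonneg _)
  exact le_trans (by exact_mod_cast hS) hK

lemma log_det_gram_sub_le {D' : Finset ℕ} {μ : ℝ} (hlam : 0 < lam)
    (h : ∀ v, lam * ‖v‖ ^ 2 ≤ gramForm D x S v) (h' : ∀ v, lam * ‖v‖ ^ 2 ≤ gramForm D' x S v)
    (hμ : ∀ v, gramForm D' x S v ≤ μ * ‖v‖ ^ 2) (hμ0 : 0 < μ) :
    Real.log (gram D' x S).det - Real.log (gram D x S).det ≤ d * Real.log (μ / lam) := by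
  have hn : ∀ a : Fin d → ℝ, ‖WithLp.toLp 2 a‖ ^ 2 = a ⬝ᵥ a := fun a => by
    rw [EuclideanSpace.real_norm_sq_eq]; simp [dotProduct, pow_two]
  have hV := gram_posDef hlam h
  have hV' := gram_posDef hlam h'
  have h1 := prod_le_det hV hlam.le fun a => by rw [dotProduct_gram_mulVec, ← hn]; exact h _
  have h2 := det_le_prod hV' (lam := μ) fun a => by rw [dotProduct_gram_mulVec, ← hn]; exact hμ _
  rw [Fintype.card_fin] at h1 h2
  have h3 := Real.log_le_log (by positivity) h1
  have h4 := Real.log_le_log hV'.det_pos h2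
  rw [Real.log_pow] at h3 h4
  rw [Real.log_div hμ0.ne' hlam.ne', mul_sub]
  linarith

end Gram

/-! ### Structure of the algorithm -/

section Algorithm

variable {N d : ℕ}

/-- The index set that round `t` is added to: `0` for exploitation, and otherwise the stage. -/
def roundStage (p : Input N d) (x : ℕ → Fin N → Vec d) (r : ℕ → Fin N → ℝ)
    (c : ℕ → Option (Fin N)) (s : State N) (t : ℕ) : ℕ :=
  open scoped Classical in
  if stageMaxWidth p x r c s t (stopStage p x r c s t) ≤ 1 / √p.T then 0
  else stopStage p x r c s t

/-- The assortment chosen in round `t` after the initialization phase. -/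
def roundChoice (p : Input N d) (x : ℕ → Fin N → Vec d) (r : ℕ → Fin N → ℝ)
    (c : ℕ → Option (Fin N)) (s : State N) (t : ℕ) : Finset (Fin N) :=
  open scoped Classical in
  if stageMaxWidth p x r c s t (stopStage p x r c s t) ≤ 1 / √p.T then
    p.tie (argmaxSet (stageCand p x r c s t (stopStage p x r c s t)) fun S =>
      revenue (stageEst p x c s (stopStage p x r c s t)) (x t) (r t) S)
  else p.tie (argmaxSet (stageCand p x r c s t (stopStage p x r c s t)) fun S =>
      ∑ i ∈ S, stageWidth p x s t (stopStage p x r c s t) i)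

variable (p : Input N d) (x : ℕ → Fin N → Vec d) (r : ℕ → Fin N → ℝ) (G : ℕ → Finset (Fin N))
  (c c' : ℕ → Option (Fin N))

lemma step_of_le {s : State N} {t : ℕ} (ht : t ≤ p.T₀) :
    step p x r G c s t = ⟨Function.update s.S t (G t), s.Ψ⟩ := if_pos ht

lemma step_of_lt {s : State N} {t : ℕ} (ht : p.T₀ < t) :
    step p x r G c s t = ⟨Function.update s.S t (roundChoice p x r c s t),
      Function.update s.Ψ (roundStage p x r c s t)
        (insert t (s.Ψ (roundStage p x r c s t)))⟩ := by
  rw [step, if_neg (by omega)]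
  simp only [roundChoice, roundStage]
  split_ifs <;> rfl

/-- The index set that round `t` is added to, as a function of all responses. -/
def label (t : ℕ) : ℕ := roundStage p x r c (stateAfter p x r G c (t - 1)) t

lemma stateAfter_eq_step {t : ℕ} (ht : 1 ≤ t) :
    stateAfter p x r G c t = step p x r G c (stateAfter p x r G c (t - 1)) t := by
  obtain ⟨t, rfl⟩ := Nat.exists_eq_add_of_le' ht
  rfl

lemma stateAfter_S_eq_offered {t u : ℕ} (hu : u ≤ t) :
    (stateAfter p x r G c t).S u = offered p x r G c u := by
  induction t with
  | zero => rw [Nat.le_zero.1 hu]; rfl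
  | succ t ih =>
    by_cases h : u = t + 1
    · rw [h]; rfl
    · rw [← ih (by omega), stateAfter_eq_step p x r G c (by omega), Nat.add_sub_cancel]
      by_cases hT : t + 1 ≤ p.T₀
      · rw [step_of_le p x r G c hT]; exact Function.update_of_ne h _ _
      · rw [step_of_lt p x r G c (by omega)]; exact Function.update_of_ne h _ _

/-- The index sets are level sets of `label`, so the rest of the analysis can speak about labels of
rounds and forget the evolving state. -/
lemma mem_stateAfter_Ψ {t u ℓ : ℕ} :
    u ∈ (stateAfter p x r G c t).Ψ ℓ ↔ p.T₀ < u ∧ u ≤ t ∧ label p x r G c u = ℓ := by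
  induction t with
  | zero => simp [stateAfter]; omega
  | succ t ih =>
    rw [stateAfter_eq_step p x r G c (by omega), Nat.add_sub_cancel]
    by_cases hT : t + 1 ≤ p.T₀
    · rw [step_of_le p x r G c hT]
      simp only [ih]
      omega
    · rw [step_of_lt p x r G c (by omega)]
      have hl : label p x r G c (t + 1)
        = roundStage p x r c (stateAfter p x r G c t) (t + 1) := rfl
      simp only [← hl]
      by_cases hℓ : ℓ = label p x r G c (t + 1)
      · subst hℓ
        rw [Function.update_self, Finset.mem_insert, ih]
        constructor
        · rintro (rfl | ⟨h1, h2, h3⟩)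
          · exact ⟨by omega, le_rfl, rfl⟩
          · exact ⟨h1, by omega, h3⟩
        · rintro ⟨h1, h2, h3⟩
          by_cases hu : u = t + 1
          · exact Or.inl hu
          · exact Or.inr ⟨h1, by omega, h3⟩
      · rw [Function.update_of_ne hℓ, ih]
        constructor
        · rintro ⟨h1, h2, h3⟩
          exact ⟨h1, by omega, h3⟩
        · rintro ⟨h1, h2, h3⟩
          refine ⟨h1, ?_, h3⟩
          by_contra hu
          have : u = t + 1 := by omega
          rw [this] at h3
          exact hℓ h3.symm

lemma offered_of_le {t : ℕ} (h1 : 1 ≤ t) (ht : t ≤ p.T₀) : offered p x r G c t = G t := by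
  rw [offered, stateAfter_eq_step p x r G c h1, step_of_le p x r G c ht]
  exact Function.update_self _ _ _

lemma offered_of_lt {t : ℕ} (ht : p.T₀ < t) :
    offered p x r G c t = roundChoice p x r c (stateAfter p x r G c (t - 1)) t := by
  rw [offered, stateAfter_eq_step p x r G c (by omega), step_of_lt p x r G c ht]
  exact Function.update_self _ _ _

/-- The rounds before `t` that are used in stage `ℓ` of round `t`. -/
def roundsBefore (t ℓ : ℕ) : Finset ℕ := stageRounds p (stateAfter p x r G c (t - 1)) ℓ

/-- The rounds of stage `ℓ` before `t`. -/
def exploreBefore (t ℓ : ℕ) : Finset ℕ := (stateAfter p x r G c (t - 1)).Ψ ℓ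

lemma mem_exploreBefore {t u ℓ : ℕ} (ht : 1 ≤ t) :
    u ∈ exploreBefore p x r G c t ℓ ↔ p.T₀ < u ∧ u < t ∧ label p x r G c u = ℓ := by
  rw [exploreBefore, mem_stateAfter_Ψ]
  constructor <;> rintro ⟨h1, h2, h3⟩ <;> exact ⟨h1, by omega, h3⟩

lemma roundsBefore_eq (t ℓ : ℕ) :
    roundsBefore p x r G c t ℓ = exploreBefore p x r G c t ℓ ∪ Finset.Icc 1 p.T₀ := rfl

lemma disjoint_exploreBefore (t ℓ : ℕ) :
    Disjoint (exploreBefore p x r G c t ℓ) (Finset.Icc 1 p.T₀) := by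
  rw [Finset.disjoint_left]
  intro u hu
  rw [exploreBefore, mem_stateAfter_Ψ] at hu
  rw [Finset.mem_Icc]
  omega

lemma lt_of_mem_roundsBefore {t u ℓ : ℕ} (ht : p.T₀ < t)
    (hu : u ∈ roundsBefore p x r G c t ℓ) : 1 ≤ u ∧ u < t := by
  rw [roundsBefore_eq, Finset.mem_union, mem_exploreBefore p x r G c (by omega),
    Finset.mem_Icc] at hu
  omega

lemma gram_congr {D : Finset ℕ} {S S' : ℕ → Finset (Fin N)} (h : ∀ u ∈ D, S u = S' u) :
    gram D x S = gram D x S' :=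
  Finset.sum_congr rfl fun u hu => by rw [h u hu]

lemma stageRounds_S {t ℓ u : ℕ} (ht : p.T₀ < t)
    (hu : u ∈ stageRounds p (stateAfter p x r G c (t - 1)) ℓ) :
    (stateAfter p x r G c (t - 1)).S u = offered p x r G c u :=
  stateAfter_S_eq_offered p x r G c (by
    have := lt_of_mem_roundsBefore p x r G c ht hu
    omega)

/-- Responses influence the width only through the rounds collected in the stage and the assortments
offered there; the responses given in those rounds do not enter the formula. The decoupling of a
stage from its own noise rests on this. -/
lemma stageWidth_stateAfter {t ℓ : ℕ} (ht : p.T₀ < t) (i : Fin N) :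
    stageWidth p x (stateAfter p x r G c (t - 1)) t ℓ i
      = p.α * weightedNorm (gram (roundsBefore p x r G c t ℓ) x (offered p x r G c))⁻¹ (x t i) := by
  rw [stageWidth, gram_congr x fun u hu => stageRounds_S p x r G c ht hu]
  rfl

lemma stageEst_stateAfter {t ℓ : ℕ} (ht : p.T₀ < t) :
    stageEst p x c (stateAfter p x r G c (t - 1)) ℓ
      = p.est (roundsBefore p x r G c t ℓ) (fun u => x u) (fun u => offered p x r G c u)
        (fun u => c u) := by
  rw [stageEst]
  congr 1
  funext u
  exact stageRounds_S p x r G c ht u.2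

/-! Dependence on the responses -/

variable {p x r G c c'}

/-- The strict inequality matters: the candidate set of stage `ℓ₀` uses only the estimates of the
stages below `ℓ₀`. -/
lemma stageCand_congr {s s' : State N} {t ℓ₀ : ℕ}
    (h : ∀ ℓ, 1 ≤ ℓ → ℓ < ℓ₀ → stageEst p x c s ℓ = stageEst p x c' s' ℓ) :
    ∀ ℓ ≤ ℓ₀, stageCand p x r c s t ℓ = stageCand p x r c' s' t ℓ
  | 0, _ => rfl
  | 1, _ => rfl
  | ℓ + 2, hℓ => by
    rw [stageCand, stageCand, stageCand_congr h (ℓ + 1) (by omega), h (ℓ + 1) (by omega) (by omega)]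

lemma stageMaxWidth_congr {s s' : State N} {t ℓ₀ ℓ : ℕ}
    (h : ∀ ℓ, 1 ≤ ℓ → ℓ < ℓ₀ → stageEst p x c s ℓ = stageEst p x c' s' ℓ)
    (hw : stageWidth p x s t ℓ = stageWidth p x s' t ℓ) (hℓ : ℓ ≤ ℓ₀) :
    stageMaxWidth p x r c s t ℓ = stageMaxWidth p x r c' s' t ℓ := by
  rw [stageMaxWidth, stageMaxWidth, stageCand_congr h ℓ hℓ, hw]

lemma stopStage_mem (hT : 1 ≤ p.T) (s : State N) (t : ℕ) :
    stopStage p x r c s t ∈ stopStages p x r c s t :=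
  Nat.sInf_mem ⟨_, mem_stopStages p hT x r c s t⟩

lemma stopStage_congr_aux {s s' : State N} {t ℓ₀ : ℕ} (hT : 1 ≤ p.T)
    (h : ∀ ℓ, 1 ≤ ℓ → ℓ ≤ ℓ₀ → stageMaxWidth p x r c s t ℓ = stageMaxWidth p x r c' s' t ℓ)
    (hle : stopStage p x r c s t ≤ ℓ₀) : stopStage p x r c' s' t ≤ stopStage p x r c s t := by
  have h1 := stopStage_mem (x := x) (r := r) (c := c) hT s t
  refine Nat.sInf_le ?_
  refine ⟨h1.1, ?_⟩
  rw [← h _ h1.1 hle]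
  exact h1.2

/-- Only stages up to the stopping stage need to be compared: the other run stops there as well, and
by symmetry not earlier. -/
lemma stopStage_congr {s s' : State N} {t ℓ₀ : ℕ} (hT : 1 ≤ p.T)
    (h : ∀ ℓ, 1 ≤ ℓ → ℓ ≤ ℓ₀ → stageMaxWidth p x r c s t ℓ = stageMaxWidth p x r c' s' t ℓ)
    (hle : stopStage p x r c s t ≤ ℓ₀) : stopStage p x r c s t = stopStage p x r c' s' t := by
  have h1 := stopStage_congr_aux hT h hle
  exact le_antisymm (stopStage_congr_aux hT (fun ℓ a b => (h ℓ a b).symm) (h1.trans hle)) h1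

lemma roundStage_eq_or (s : State N) (t : ℕ) :
    roundStage p x r c s t = 0 ∨ roundStage p x r c s t = stopStage p x r c s t := by
  unfold roundStage
  split_ifs <;> simp

/-- If two runs agree in the stages up to `ℓ₀`, they add the next round to the same of the index
sets `1, …, ℓ₀`, if to any of them, and then with the same assortment. -/
lemma roundStage_congr {s s' : State N} {t ℓ₀ : ℕ} (hT : 1 ≤ p.T)
    (he : ∀ ℓ, 1 ≤ ℓ → ℓ < ℓ₀ → stageEst p x c s ℓ = stageEst p x c' s' ℓ)
    (hw : ∀ ℓ, 1 ≤ ℓ → ℓ ≤ ℓ₀ → stageWidth p x s t ℓ = stageWidth p x s' t ℓ)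
    (h1 : 1 ≤ roundStage p x r c s t) (h2 : roundStage p x r c s t ≤ ℓ₀) :
    roundStage p x r c s t = roundStage p x r c' s' t ∧
      roundChoice p x r c s t = roundChoice p x r c' s' t := by
  have hW : ∀ ℓ, 1 ≤ ℓ → ℓ ≤ ℓ₀ →
      stageMaxWidth p x r c s t ℓ = stageMaxWidth p x r c' s' t ℓ :=
    fun ℓ a b => stageMaxWidth_congr he (hw ℓ a b) b
  rcases roundStage_eq_or (p := p) (x := x) (r := r) (c := c) s t with h | h
  · omega
  rw [h] at h1 h2
  have hs := stopStage_congr hT hW h2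
  have hW' := hW _ h1 h2
  -- A positive index means exploration, where the choice maximizes widths. Exploitation, which is
  -- excluded here, would use the estimate of the stopping stage, possibly `ℓ₀` itself.
  have hne : ¬ stageMaxWidth p x r c s t (stopStage p x r c s t) ≤ 1 / √p.T := by
    intro hle
    rw [roundStage, if_pos hle] at h
    omega
  have hne' : ¬ stageMaxWidth p x r c' s' t (stopStage p x r c' s' t) ≤ 1 / √p.T := by
    rwa [← hs, ← hW']
  constructor
  · rw [h, roundStage, if_neg hne', hs]
  · rw [roundChoice, roundChoice, if_neg hne, if_neg hne', ← hs,
      stageCand_congr he _ h2, hw _ h1 h2]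

/-- The algorithm is nonanticipating: the state after round `t` does not involve the responses from
round `t` on. -/
lemma stateAfter_congr {t : ℕ} (h : AgreeBefore t c c') :
    stateAfter p x r G c t = stateAfter p x r G c' t := by
  induction t with
  | zero => rfl
  | succ t ih =>
    have ih' := ih fun u h1 h2 => h u h1 (by omega)
    rw [stateAfter_eq_step p x r G c (by omega), stateAfter_eq_step p x r G c' (by omega),
      Nat.add_sub_cancel, ← ih']
    by_cases hT : t + 1 ≤ p.T₀
    · rw [step_of_le p x r G c hT, step_of_le p x r G c' hT]
    · have he : ∀ ℓ, stageEst p x c (stateAfter p x r G c t) ℓ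
          = stageEst p x c' (stateAfter p x r G c t) ℓ := by
        intro ℓ
        rw [stageEst, stageEst]
        congr 1
        funext u
        have := lt_of_mem_roundsBefore p x r G c (t := t + 1) (by omega) u.2
        exact h u this.1 this.2
      have hc : ∀ ℓ, stageCand p x r c (stateAfter p x r G c t) (t + 1) ℓ
          = stageCand p x r c' (stateAfter p x r G c t) (t + 1) ℓ := fun ℓ =>
        stageCand_congr (fun ℓ _ _ => he ℓ) ℓ le_rfl
      have hW : ∀ ℓ, stageMaxWidth p x r c (stateAfter p x r G c t) (t + 1) ℓ
          = stageMaxWidth p x r c' (stateAfter p x r G c t) (t + 1) ℓ := fun ℓ => by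
        rw [stageMaxWidth, stageMaxWidth, hc]
      have hs : stopStage p x r c (stateAfter p x r G c t) (t + 1)
          = stopStage p x r c' (stateAfter p x r G c t) (t + 1) := by
        simp only [stopStage, stopStages, hW]
      have h1 : roundStage p x r c (stateAfter p x r G c t) (t + 1)
          = roundStage p x r c' (stateAfter p x r G c t) (t + 1) := by
        simp only [roundStage, hs, hW]
      have h2 : roundChoice p x r c (stateAfter p x r G c t) (t + 1)
          = roundChoice p x r c' (stateAfter p x r G c t) (t + 1) := by
        simp only [roundChoice, hs, hW, hc, he]
      rw [step_of_lt p x r G c (by omega), step_of_lt p x r G c' (by omega), h1, h2]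

lemma offered_congr {t : ℕ} (h : AgreeBefore t c c') :
    offered p x r G c t = offered p x r G c' t := by
  rw [offered, offered, stateAfter_congr h]

lemma label_congr {t : ℕ} (ht : p.T₀ < t) (h : AgreeBefore t c c') :
    label p x r G c t = label p x r G c' t := by
  have h1 : t ∈ (stateAfter p x r G c t).Ψ (label p x r G c t) :=
    (mem_stateAfter_Ψ p x r G c).2 ⟨ht, le_rfl, rfl⟩
  rw [stateAfter_congr h] at h1
  exact ((mem_stateAfter_Ψ p x r G c').1 h1).2.2.symm

variable (p x r G) in
/-- The rounds whose responses are used in the stages below `ℓ₀`. -/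
def IsLower (ℓ₀ t : ℕ) (c : ℕ → Option (Fin N)) : Prop :=
  t ≤ p.T₀ ∨ (1 ≤ label p x r G c t ∧ label p x r G c t < ℓ₀)

/-- Responses outside the stages below `ℓ₀` do not influence the stages up to `ℓ₀`. -/
lemma label_mask (hT : 1 ≤ p.T) (ℓ₀ : ℕ) (c : ℕ → Option (Fin N)) (t : ℕ) (ht : 1 ≤ t) :
    (p.T₀ < t → ∀ ℓ, 1 ≤ ℓ → ℓ ≤ ℓ₀ → (label p x r G c t = ℓ ↔
      label p x r G (mask none (IsLower p x r G ℓ₀) c) t = ℓ)) ∧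
    (t ≤ p.T₀ ∨ (1 ≤ label p x r G c t ∧ label p x r G c t ≤ ℓ₀) →
      offered p x r G c t = offered p x r G (mask none (IsLower p x r G ℓ₀) c) t) := by
  set m := mask none (IsLower p x r G ℓ₀) c with hm
  induction t using Nat.strong_induction_on with
  | _ t ih =>
    by_cases hT₀ : t ≤ p.T₀
    · exact ⟨fun h => by omega,
        fun _ => by rw [offered_of_le p x r G c ht hT₀, offered_of_le p x r G m ht hT₀]⟩
    push Not at hT₀
    -- By induction both runs have the same rounds with the same assortments in the stages up to
    -- `ℓ₀`, hence the same widths. Estimates also need the responses, which the mask keeps only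
    -- below `ℓ₀`; `roundStage_congr` asks for no more.
    have hD : ∀ ℓ, 1 ≤ ℓ → ℓ ≤ ℓ₀ → roundsBefore p x r G c t ℓ = roundsBefore p x r G m t ℓ := by
      intro ℓ h1 h2
      rw [roundsBefore_eq, roundsBefore_eq]
      congr 1
      ext u
      rw [mem_exploreBefore p x r G c ht, mem_exploreBefore p x r G m ht]
      constructor
      · rintro ⟨a, b, e⟩; exact ⟨a, b, ((ih u b (by omega)).1 a ℓ h1 h2).1 e⟩
      · rintro ⟨a, b, e⟩; exact ⟨a, b, ((ih u b (by omega)).1 a ℓ h1 h2).2 e⟩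
    have hS : ∀ ℓ, 1 ≤ ℓ → ℓ ≤ ℓ₀ → ∀ u ∈ roundsBefore p x r G c t ℓ,
        offered p x r G c u = offered p x r G m u := by
      intro ℓ h1 h2 u hu
      have hu' := lt_of_mem_roundsBefore p x r G c hT₀ hu
      refine (ih u hu'.2 hu'.1).2 ?_
      rw [roundsBefore_eq, Finset.mem_union, mem_exploreBefore p x r G c ht, Finset.mem_Icc] at hu
      rcases hu with ⟨_, _, e⟩ | hu
      · exact Or.inr ⟨by omega, by omega⟩
      · exact Or.inl hu.2
    have hc : ∀ ℓ, 1 ≤ ℓ → ℓ < ℓ₀ → ∀ u ∈ roundsBefore p x r G c t ℓ, c u = m u := by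
      intro ℓ h1 h2 u hu
      have : IsLower p x r G ℓ₀ u c := by
        rw [roundsBefore_eq, Finset.mem_union, mem_exploreBefore p x r G c ht, Finset.mem_Icc] at hu
        rcases hu with ⟨_, _, e⟩ | hu
        · exact Or.inr ⟨by omega, by omega⟩
        · exact Or.inl hu.2
      simp [hm, mask, this]
    have hw : ∀ ℓ, 1 ≤ ℓ → ℓ ≤ ℓ₀ → stageWidth p x (stateAfter p x r G c (t - 1)) t ℓ
        = stageWidth p x (stateAfter p x r G m (t - 1)) t ℓ := by
      intro ℓ h1 h2
      funext i
      rw [stageWidth_stateAfter p x r G c hT₀, stageWidth_stateAfter p x r G m hT₀,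
        ← hD ℓ h1 h2, gram_congr x (hS ℓ h1 h2)]
    have he : ∀ ℓ, 1 ≤ ℓ → ℓ < ℓ₀ → stageEst p x c (stateAfter p x r G c (t - 1)) ℓ
        = stageEst p x m (stateAfter p x r G m (t - 1)) ℓ := by
      intro ℓ h1 h2
      rw [stageEst_stateAfter p x r G c hT₀, stageEst_stateAfter p x r G m hT₀,
        ← hD ℓ h1 h2.le]
      congr 1
      · funext u; exact hS ℓ h1 h2.le u u.2
      · funext u; exact hc ℓ h1 h2 u u.2
    have key : ∀ ℓ, 1 ≤ ℓ → ℓ ≤ ℓ₀ → (label p x r G c t = ℓ ↔ label p x r G m t = ℓ) := by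
      intro ℓ h1 h2
      constructor
      · intro h
        rw [← h] at h1 h2 ⊢
        exact (roundStage_congr hT he hw h1 h2).1.symm
      · intro h
        rw [← h] at h1 h2 ⊢
        exact (roundStage_congr hT (fun ℓ a b => (he ℓ a b).symm)
          (fun ℓ a b => (hw ℓ a b).symm) h1 h2).1.symm
    refine ⟨fun _ => key, ?_⟩
    rintro (h | ⟨h1, h2⟩)
    · omega
    · rw [offered_of_lt p x r G c hT₀, offered_of_lt p x r G m hT₀]
      exact (roundStage_congr hT he hw h1 h2).2

end Algorithm

/-! ### Concentration of the noise for fixed contexts -/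

section Concentration

variable {N d : ℕ}

variable (p : Input N d) (θs : Vec d) (x : ℕ → Fin N → Vec d) (r : ℕ → Fin N → ℝ)
  (G : ℕ → Finset (Fin N))

/-- Probability of the response `γ t` in round `t` given the responses `γ` in earlier rounds. -/
def stepProb (t : ℕ) (γ : ℕ → Option (Fin N)) (a : Option (Fin N)) : ℝ :=
  choiceProb θs (x t) (offered p x r G γ t) a

/-- Probability of the response sequence `γ` in the rounds `1, …, n`, given the contexts. -/
def pathProb (n : ℕ) (γ : ℕ → Option (Fin N)) : ℝ :=
  ∏ t ∈ Finset.Icc 1 n, stepProb p θs x r G t γ (γ t)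

lemma stepProb_nonneg (t : ℕ) (γ : ℕ → Option (Fin N)) (a : Option (Fin N)) :
    0 ≤ stepProb p θs x r G t γ a := choiceProb_nonneg _ _ _ _

lemma pathProb_nonneg (n : ℕ) (γ : ℕ → Option (Fin N)) : 0 ≤ pathProb p θs x r G n γ :=
  Finset.prod_nonneg fun _ _ => stepProb_nonneg _ _ _ _ _ _ _ _

lemma sum_stepProb (t : ℕ) (γ : ℕ → Option (Fin N)) : ∑ a, stepProb p θs x r G t γ a = 1 :=
  sum_choiceProb _ _ _

lemma stepProb_congr {t : ℕ} {γ γ' : ℕ → Option (Fin N)} (h : AgreeBefore t γ γ') :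
    stepProb p θs x r G t γ = stepProb p θs x r G t γ' := by
  funext a; rw [stepProb, stepProb, offered_congr h]

/-- The value `b i` of a response `i ∈ S`, and zero for all other responses. -/
def respVal (S : Finset (Fin N)) (b : Fin N → ℝ) : Option (Fin N) → ℝ
  | none => 0
  | some i => if i ∈ S then b i else 0

lemma respVal_eq_sum (S : Finset (Fin N)) (b : Fin N → ℝ) (a : Option (Fin N)) :
    respVal S b a = ∑ i ∈ S, if a = some i then b i else 0 := by
  rcases a with _ | j
  · simp [respVal]
  · simp [respVal]

lemma abs_respVal_le (S : Finset (Fin N)) (b : Fin N → ℝ) (a : Option (Fin N)) :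
    |respVal S b a| ≤ √(∑ i ∈ S, b i ^ 2) := by
  rcases a with _ | j
  · simp [respVal]
  · by_cases hj : j ∈ S
    · simp only [respVal, hj, if_true]
      rw [← Real.sqrt_sq_eq_abs]
      exact Real.sqrt_le_sqrt
        (Finset.single_le_sum (f := fun i => b i ^ 2) (fun _ _ => sq_nonneg _) hj)
    · simp [respVal, hj]

lemma sum_stepProb_mul_respVal (t : ℕ) (γ : ℕ → Option (Fin N)) (b : Fin N → ℝ) :
    ∑ a, stepProb p θs x r G t γ a * respVal (offered p x r G γ t) b a
      = logitMean (offered p x r G γ t) (util x θs t) b := by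
  rw [show (∑ a, stepProb p θs x r G t γ a * respVal (offered p x r G γ t) b a)
      = ∑ a, choiceProb θs (x t) (offered p x r G γ t) a * respVal (offered p x r G γ t) b a
      from rfl, sum_choiceProb_mul _ _ _ _ rfl]
  exact Finset.sum_congr rfl fun i hi => by simp only [respVal, hi, if_true]; rfl

/-- Tail bound for the noise in a set `U` of rounds in a direction `a`, when the rounds in `U`, the
assortments offered in them, and the direction are determined by the responses in rounds `Lo`. -/
theorem sum_pathProb_noise_ge_le (n : ℕ) (Lo U : ℕ → (ℕ → Option (Fin N)) → Prop)
    (hLo : ∀ t ∈ Finset.Icc 1 n, ∀ γ γ', AgreeBefore t γ γ' → (Lo t γ ↔ Lo t γ'))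
    (hU : ∀ t ∈ Finset.Icc 1 n, ∀ γ γ', AgreeBefore t γ γ' → (U t γ ↔ U t γ'))
    (hLom : ∀ t ∈ Finset.Icc 1 n, ∀ γ, Lo t γ ↔ Lo t (mask none Lo γ))
    (hUm : ∀ t ∈ Finset.Icc 1 n, ∀ γ, U t γ ↔ U t (mask none Lo γ))
    (hpm : ∀ t ∈ Finset.Icc 1 n, ∀ γ, Lo t γ ∨ U t γ →
      offered p x r G γ t = offered p x r G (mask none Lo γ) t)
    (hdisj : ∀ t ∈ Finset.Icc 1 n, ∀ γ, U t γ → ¬ Lo t γ)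
    (D : (ℕ → Option (Fin N)) → Finset ℕ)
    (hD : ∀ γ t, t ∈ D γ ↔ t ∈ Finset.Icc 1 n ∧ U t γ)
    (a : (ℕ → Option (Fin N)) → Vec d)
    (ha : ∀ β, gramForm (D β) x (offered p x r G β) (a β) ≤ 1) (s : ℝ) (hs : 0 ≤ s) :
    ∑ γ ∈ seqs none n, pathProb p θs x r G n γ *
      (if s ≤ inner ℝ (a (mask none Lo γ)) (noise (D γ) x (offered p x r G γ) γ θs)
        then 1 else 0) ≤ Real.exp (-(s ^ 2 / 2)) := by
  classical
  -- Chernoff exponent of a round: linear term minus its conditional mean minus the Hoeffding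
  -- correction. The corrections sum to `s²/2` times the Gram form of the direction, which is at
  -- most one by normalization.
  set ξ : ℕ → (ℕ → Option (Fin N)) → Option (Fin N) → ℝ := fun t β o =>
    s * respVal (offered p x r G β t) (util x (a β) t) o
      - s * logitMean (offered p x r G β t) (util x θs t) (util x (a β) t)
      - s ^ 2 * (∑ i ∈ offered p x r G β t, util x (a β) t i ^ 2) / 2 with hξ
  have key := sum_seqs_decoupling none n (stepProb p θs x r G) Lo U ξ
    (stepProb_nonneg p θs x r G) (fun t γ => (sum_stepProb p θs x r G t γ).le)
    (fun t _ γ γ' h => stepProb_congr p θs x r G h) hLo hU hLom hUm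
    (fun t ht γ h => by funext o; rw [stepProb, stepProb, hpm t ht γ h]) hdisj ?_
  · have hD' : ∀ γ, D γ = (Finset.Icc 1 n).filter fun t => U t γ := fun γ => by
      ext t; rw [hD, Finset.mem_filter]
    have hpt : ∀ γ, (if s ≤ inner ℝ (a (mask none Lo γ)) (noise (D γ) x (offered p x r G γ) γ θs)
        then (1 : ℝ) else 0) ≤ Real.exp (∑ t ∈ Finset.Icc 1 n,
          if U t γ then ξ t (mask none Lo γ) (γ t) else 0) * Real.exp (-(s ^ 2 / 2)) := by
      intro γ
      split_ifs with h
      · rw [← Real.exp_add]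
        refine Real.one_le_exp ?_
        set m := mask none Lo γ with hm
        have hoff : ∀ t ∈ D γ, offered p x r G γ t = offered p x r G m t := fun t ht =>
          hpm t ((hD γ t).1 ht).1 γ (Or.inr ((hD γ t).1 ht).2)
        have hDm : D m = D γ := by
          ext t
          rw [hD, hD]
          exact and_congr_right fun ht => (hUm t ht γ).symm
        have h1 : (∑ t ∈ Finset.Icc 1 n, if U t γ then ξ t m (γ t) else 0)
            = s * inner ℝ (a m) (noise (D γ) x (offered p x r G γ) γ θs)
              - s ^ 2 * gramForm (D m) x (offered p x r G m) (a m) / 2 := by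
          rw [← Finset.sum_filter, ← hD', inner_noise, hDm, gramForm, Finset.mul_sum,
            Finset.mul_sum, Finset.sum_div, ← Finset.sum_sub_distrib]
          refine Finset.sum_congr rfl fun t ht => ?_
          simp only [hξ]
          rw [respVal_eq_sum, hoff t ht]
          simp only [util]
          ring
        rw [h1]
        have h2 := ha m
        nlinarith [mul_le_mul_of_nonneg_left h hs, mul_le_mul_of_nonneg_left h2 (sq_nonneg s)]
      · positivity
    calc _ ≤ ∑ γ ∈ seqs none n, (pathProb p θs x r G n γ *
          Real.exp (∑ t ∈ Finset.Icc 1 n, if U t γ then ξ t (mask none Lo γ) (γ t) else 0))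
            * Real.exp (-(s ^ 2 / 2)) := by
          refine Finset.sum_le_sum fun γ _ => ?_
          rw [mul_assoc]
          exact mul_le_mul_of_nonneg_left (hpt γ) (pathProb_nonneg p θs x r G n γ)
      _ ≤ 1 * Real.exp (-(s ^ 2 / 2)) := by
          rw [← Finset.sum_mul]
          refine mul_le_mul_of_nonneg_right ?_ (Real.exp_pos _).le
          exact key
      _ = _ := one_mul _
  · intro t _ β _
    -- At most one item is bought, so a response has value at most the largest `|bᵢ|`, which the
    -- `ℓ²` norm bounds. This keeps the correction free of the assortment size.
    have h1 := sum_mul_exp_centered_le (stepProb p θs x r G t β) (stepProb_nonneg p θs x r G t β)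
      (sum_stepProb p θs x r G t β)
      (fun o => s * respVal (offered p x r G β t) (util x (a β) t) o)
      (s * √(∑ i ∈ offered p x r G β t, util x (a β) t i ^ 2)) fun o => by
        rw [abs_mul, abs_of_nonneg hs]
        exact mul_le_mul_of_nonneg_left (abs_respVal_le _ _ _) hs
    refine le_trans (le_of_eq ?_) h1
    have h2 : ∑ o, stepProb p θs x r G t β o *
        (s * respVal (offered p x r G β t) (util x (a β) t) o)
        = s * logitMean (offered p x r G β t) (util x θs t) (util x (a β) t) := by
      rw [← sum_stepProb_mul_respVal, Finset.mul_sum]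
      exact Finset.sum_congr rfl fun o _ => by ring
    refine Finset.sum_congr rfl fun o _ => ?_
    rw [h2, mul_pow, Real.sq_sqrt (Finset.sum_nonneg fun _ _ => sq_nonneg _)]

/-- The one-sided bound is used for the direction and for its negative. -/
lemma sum_pathProb_abs_noise_gt_le (n : ℕ) (Lo U : ℕ → (ℕ → Option (Fin N)) → Prop)
    (hLo : ∀ t ∈ Finset.Icc 1 n, ∀ γ γ', AgreeBefore t γ γ' → (Lo t γ ↔ Lo t γ'))
    (hU : ∀ t ∈ Finset.Icc 1 n, ∀ γ γ', AgreeBefore t γ γ' → (U t γ ↔ U t γ'))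
    (hLom : ∀ t ∈ Finset.Icc 1 n, ∀ γ, Lo t γ ↔ Lo t (mask none Lo γ))
    (hUm : ∀ t ∈ Finset.Icc 1 n, ∀ γ, U t γ ↔ U t (mask none Lo γ))
    (hpm : ∀ t ∈ Finset.Icc 1 n, ∀ γ, Lo t γ ∨ U t γ →
      offered p x r G γ t = offered p x r G (mask none Lo γ) t)
    (hdisj : ∀ t ∈ Finset.Icc 1 n, ∀ γ, U t γ → ¬ Lo t γ)
    (D : (ℕ → Option (Fin N)) → Finset ℕ)
    (hD : ∀ γ t, t ∈ D γ ↔ t ∈ Finset.Icc 1 n ∧ U t γ)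
    (a : (ℕ → Option (Fin N)) → Vec d)
    (ha : ∀ β, gramForm (D β) x (offered p x r G β) (a β) ≤ 1) (s : ℝ) (hs : 0 ≤ s) :
    ∑ γ ∈ seqs none n, pathProb p θs x r G n γ *
      (if s < |inner ℝ (a (mask none Lo γ)) (noise (D γ) x (offered p x r G γ) γ θs)|
        then 1 else 0) ≤ 2 * Real.exp (-(s ^ 2 / 2)) := by
  have h1 := sum_pathProb_noise_ge_le p θs x r G n Lo U hLo hU hLom hUm hpm hdisj D hD a ha s hs
  have h2 := sum_pathProb_noise_ge_le p θs x r G n Lo U hLo hU hLom hUm hpm hdisj D hD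
    (fun β => (-1 : ℝ) • a β) (fun β => by rw [gramForm_smul]; simpa using ha β) s hs
  rw [two_mul]
  refine le_trans ?_ (add_le_add h1 h2)
  rw [← Finset.sum_add_distrib]
  refine Finset.sum_le_sum fun γ _ => ?_
  rw [← mul_add]
  refine mul_le_mul_of_nonneg_left ?_ (pathProb_nonneg p θs x r G n γ)
  simp only [neg_smul, one_smul, inner_neg_left]
  have h0 : ∀ P : Prop, [Decidable P] → (0 : ℝ) ≤ if P then 1 else 0 := fun P _ => by
    split_ifs <;> norm_num
  by_cases h3 : s < |inner ℝ (a (mask none Lo γ)) (noise (D γ) x (offered p x r G γ) γ θs)|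
  · rw [if_pos h3]
    rcases lt_abs.1 h3 with h | h
    · rw [if_pos h.le]; linarith [h0 (s ≤ -inner ℝ (a (mask none Lo γ))
        (noise (D γ) x (offered p x r G γ) γ θs))]
    · rw [if_pos h.le]; linarith [h0 (s ≤ inner ℝ (a (mask none Lo γ))
        (noise (D γ) x (offered p x r G γ) γ θs))]
  · rw [if_neg h3]
    exact add_nonneg (h0 _) (h0 _)

/-- Assortments restricted to the rounds in `D`. -/
def restrictTo (D : Finset ℕ) (S : ℕ → Finset (Fin N)) : ℕ → Finset (Fin N) :=
  fun t => if t ∈ D then S t else ∅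

lemma restrictTo_of_mem {D : Finset ℕ} (S : ℕ → Finset (Fin N)) {t : ℕ} (ht : t ∈ D) :
    restrictTo D S t = S t := if_pos ht

lemma gramForm_congr {D : Finset ℕ} {S S' : ℕ → Finset (Fin N)} (h : ∀ u ∈ D, S u = S' u) :
    gramForm D x S = gramForm D x S' := by
  funext v
  exact Finset.sum_congr rfl fun u hu => by rw [h u hu]

lemma gramForm_restrictTo (D : Finset ℕ) (S : ℕ → Finset (Fin N)) :
    gramForm D x (restrictTo D S) = gramForm D x S :=
  gramForm_congr x fun _ hu => restrictTo_of_mem S hu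

variable {p x r G}

/-- Directions built from the rounds of stage `ℓ` and their assortments are unchanged by masking;
this makes them admissible in the decoupled tail bound. -/
lemma roundsBefore_mask (hT : 1 ≤ p.T) {t ℓ : ℕ} (ht : 1 ≤ t) (hℓ : 1 ≤ ℓ)
    (γ : ℕ → Option (Fin N)) :
    roundsBefore p x r G (mask none (IsLower p x r G ℓ) γ) t ℓ = roundsBefore p x r G γ t ℓ := by
  rw [roundsBefore_eq, roundsBefore_eq]
  congr 1
  ext u
  rw [mem_exploreBefore p x r G _ ht, mem_exploreBefore p x r G _ ht]
  constructor
  · rintro ⟨h1, h2, h3⟩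
    exact ⟨h1, h2, ((label_mask hT ℓ γ u (by omega)).1 h1 ℓ hℓ le_rfl).2 h3⟩
  · rintro ⟨h1, h2, h3⟩
    exact ⟨h1, h2, ((label_mask hT ℓ γ u (by omega)).1 h1 ℓ hℓ le_rfl).1 h3⟩

lemma offered_mask (hT : 1 ≤ p.T) {t ℓ u : ℕ} (ht : p.T₀ < t) (hℓ : 1 ≤ ℓ)
    (γ : ℕ → Option (Fin N)) (hu : u ∈ roundsBefore p x r G γ t ℓ) :
    offered p x r G γ u = offered p x r G (mask none (IsLower p x r G ℓ) γ) u := by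
  have h1 := lt_of_mem_roundsBefore p x r G γ ht hu
  refine (label_mask hT ℓ γ u h1.1).2 ?_
  rw [roundsBefore_eq, Finset.mem_union, mem_exploreBefore p x r G γ (by omega),
    Finset.mem_Icc] at hu
  rcases hu with ⟨_, _, e⟩ | hu
  · exact Or.inr ⟨by omega, by omega⟩
  · exact Or.inl hu.2

lemma restrictTo_mask (hT : 1 ≤ p.T) {t ℓ : ℕ} (ht : p.T₀ < t) (hℓ : 1 ≤ ℓ)
    (γ : ℕ → Option (Fin N)) :
    restrictTo (roundsBefore p x r G γ t ℓ) (offered p x r G (mask none (IsLower p x r G ℓ) γ))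
      = restrictTo (roundsBefore p x r G γ t ℓ) (offered p x r G γ) := by
  funext u
  unfold restrictTo
  split_ifs with hu
  · exact (offered_mask hT ht hℓ γ hu).symm
  · rfl

/-- Tail bound for the noise in the exploration rounds of stage `ℓ` in a direction that is a
function of the rounds used in this stage and the assortments offered in them. -/
theorem sum_pathProb_explore_gt_le {t ℓ : ℕ} (ht : p.T₀ < t) (htT : t ≤ p.T)
    (hℓ : 1 ≤ ℓ) (F : Finset ℕ → (ℕ → Finset (Fin N)) → Vec d)
    (hF : ∀ D S, gramForm D x S (F D S) ≤ 1) (s : ℝ) (hs : 0 ≤ s) :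
    ∑ γ ∈ seqs none p.T, pathProb p θs x r G p.T γ *
      (if s < |inner ℝ (F (roundsBefore p x r G γ t ℓ)
          (restrictTo (roundsBefore p x r G γ t ℓ) (offered p x r G γ)))
          (noise (exploreBefore p x r G γ t ℓ) x (offered p x r G γ) γ θs)|
        then 1 else 0) ≤ 2 * Real.exp (-(s ^ 2 / 2)) := by
  have hT : 1 ≤ p.T := by omega
  -- The lower rounds are the initialization and the stages below `ℓ`. The initialization is
  -- included because its responses enter all lower estimates; its own noise therefore needs a
  -- separate treatment.
  have h := sum_pathProb_abs_noise_gt_le p θs x r G p.T (IsLower p x r G ℓ)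
    (fun u γ => p.T₀ < u ∧ u < t ∧ label p x r G γ u = ℓ) ?_ ?_ ?_ ?_ ?_ ?_
    (fun γ => exploreBefore p x r G γ t ℓ) ?_
    (fun γ => F (roundsBefore p x r G γ t ℓ)
      (restrictTo (roundsBefore p x r G γ t ℓ) (offered p x r G γ))) ?_ s hs
  · refine le_trans (le_of_eq ?_) h
    refine Finset.sum_congr rfl fun γ _ => ?_
    rw [roundsBefore_mask hT (by omega) hℓ, restrictTo_mask hT ht hℓ]
  · intro u hu γ γ' hag
    by_cases hu0 : u ≤ p.T₀
    · simp [IsLower, hu0]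
    · simp only [IsLower, label_congr (p := p) (x := x) (r := r) (G := G) (by omega) hag]
  · intro u hu γ γ' hag
    refine and_congr_right fun hu0 => ?_
    rw [label_congr hu0 hag]
  · intro u hu γ
    rw [Finset.mem_Icc] at hu
    by_cases hu0 : u ≤ p.T₀
    · simp [IsLower, hu0]
    · have h1 := (label_mask (x := x) (r := r) (G := G) hT ℓ γ u hu.1).1 (by omega)
      simp only [IsLower, hu0, false_or]
      constructor
      · rintro ⟨a, b⟩
        rw [(h1 _ a b.le).1 rfl]
        exact ⟨a, b⟩
      · rintro ⟨a, b⟩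
        rw [(h1 _ a b.le).2 rfl]
        exact ⟨a, b⟩
  · intro u hu γ
    rw [Finset.mem_Icc] at hu
    exact and_congr_right fun hu0 => and_congr_right fun _ =>
      (label_mask hT ℓ γ u hu.1).1 hu0 ℓ hℓ le_rfl
  · intro u hu γ hor
    rw [Finset.mem_Icc] at hu
    refine (label_mask hT ℓ γ u hu.1).2 ?_
    rcases hor with (h | h) | h
    · exact Or.inl h
    · exact Or.inr ⟨h.1, h.2.le⟩
    · exact Or.inr ⟨by omega, by omega⟩
  · rintro u hu γ ⟨h1, h2, h3⟩ (h | h) <;> omega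
  · intro γ u
    rw [mem_exploreBefore p x r G γ (by omega), Finset.mem_Icc]
    constructor
    · rintro ⟨h1, h2, h3⟩; exact ⟨by omega, h1, h2, h3⟩
    · rintro ⟨_, h⟩; exact h
  · intro γ
    -- The direction is normalized over all rounds of the stage, including the initialization, so
    -- its Gram form over the exploration rounds alone is at most one.
    refine le_trans ?_ (hF (roundsBefore p x r G γ t ℓ)
      (restrictTo (roundsBefore p x r G γ t ℓ) (offered p x r G γ)))
    rw [gramForm_restrictTo]
    exact gramForm_mono (by rw [roundsBefore_eq]; exact Finset.subset_union_left) _ _ _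

/-- Tail bound for the noise in the initialization phase in a fixed direction. -/
theorem sum_pathProb_init_gt_le (hT : p.T₀ ≤ p.T) (a : Vec d)
    (ha : gramForm (Finset.Icc 1 p.T₀) x G a ≤ 1) (s : ℝ) (hs : 0 ≤ s) :
    ∑ γ ∈ seqs none p.T, pathProb p θs x r G p.T γ *
      (if s < |inner ℝ a (noise (Finset.Icc 1 p.T₀) x (offered p x r G γ) γ θs)|
        then 1 else 0) ≤ 2 * Real.exp (-(s ^ 2 / 2)) := by
  -- No response has to be kept: the initial assortments belong to the fixed contexts.
  refine sum_pathProb_abs_noise_gt_le p θs x r G p.T (fun _ _ => False)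
    (fun u _ => u ≤ p.T₀) (by simp) (by simp) (by simp) (by simp) ?_ (by simp)
    (fun _ => Finset.Icc 1 p.T₀) ?_ (fun _ => a) ?_ s hs
  · rintro u hu γ (h | h)
    · exact h.elim
    · rw [offered_of_le p x r G _ (Finset.mem_Icc.1 hu).1 h,
        offered_of_le p x r G _ (Finset.mem_Icc.1 hu).1 h]
  · intro γ u
    simp only [Finset.mem_Icc]
    omega
  · intro β
    refine le_trans (le_of_eq ?_) ha
    rw [gramForm_congr x fun u hu => offered_of_le p x r G β (Finset.mem_Icc.1 hu).1
      (Finset.mem_Icc.1 hu).2]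

end Concentration

/-! ### Confidence widths -/

section Confidence

variable {N d : ℕ}

lemma argmaxSet_nonempty {A : Finset (Finset (Fin N))} (hA : A.Nonempty)
    (f : Finset (Fin N) → ℝ) : (argmaxSet A f).Nonempty := by
  obtain ⟨S, hS, hmax⟩ := A.exists_max_image f hA
  exact ⟨S, by simpa [argmaxSet] using ⟨hS, hmax⟩⟩

variable {p : Input N d} {x : ℕ → Fin N → Vec d} {r : ℕ → Fin N → ℝ} {G : ℕ → Finset (Fin N)}

lemma stageCand_nonempty (c : ℕ → Option (Fin N)) (s : State N) (t : ℕ) :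
    ∀ ℓ, (stageCand p x r c s t ℓ).Nonempty
  | 0 => assortments_nonempty N p.K
  | 1 => assortments_nonempty N p.K
  | ℓ + 2 => by
    obtain ⟨S, hS, hmax⟩ := (stageCand p x r c s t (ℓ + 1)).exists_max_image
      (revenue (stageEst p x c s (ℓ + 1)) (x t) (r t)) (stageCand_nonempty c s t (ℓ + 1))
    refine ⟨S, ?_⟩
    rw [stageCand, Finset.mem_filter]
    refine ⟨hS, fun S' hS' => ?_⟩
    have : (0 : ℝ) < 2 ^ (-((ℓ + 1 : ℕ) : ℤ) + 1) := by positivity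
    linarith [hmax S' hS']

lemma stageCand_subset (c : ℕ → Option (Fin N)) (s : State N) (t : ℕ) :
    ∀ ℓ, stageCand p x r c s t ℓ ⊆ assortments N p.K
  | 0 => subset_rfl
  | 1 => subset_rfl
  | ℓ + 2 => by
    rw [stageCand]
    exact (Finset.filter_subset _ _).trans (stageCand_subset c s t (ℓ + 1))

/-- The rule `tie` picks an element of every nonempty set. -/
def IsSelector (tie : Finset (Finset (Fin N)) → Finset (Fin N)) : Prop :=
  ∀ M : Finset (Finset (Fin N)), M.Nonempty → tie M ∈ M

lemma roundChoice_mem (htie : IsSelector p.tie) (c : ℕ → Option (Fin N)) (s : State N) (t : ℕ) :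
    roundChoice p x r c s t ∈ stageCand p x r c s t (stopStage p x r c s t) := by
  have h := fun f => htie _ (argmaxSet_nonempty
    (stageCand_nonempty (p := p) (x := x) (r := r) c s t (stopStage p x r c s t)) f)
  unfold roundChoice
  split_ifs <;> exact (Finset.mem_filter.1 (h _)).1

lemma offered_mem_assortments (htie : IsSelector p.tie) (hG : ∀ t, G t ∈ assortments N p.K)
    (c : ℕ → Option (Fin N)) (t : ℕ) : offered p x r G c t ∈ assortments N p.K := by
  rcases Nat.eq_zero_or_pos t with rfl | ht
  · simp [offered, stateAfter, assortments]
  by_cases h : t ≤ p.T₀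
  · rw [offered_of_le p x r G c ht h]; exact hG t
  · rw [offered_of_lt p x r G c (by omega)]
    exact stageCand_subset _ _ _ _ (roundChoice_mem htie _ _ _)

/-- Contexts for which the confidence widths are reliable: bounded features, the curvature bound,
and a well-conditioned Gram matrix of the initialization phase. -/
structure GoodContext (p : Input N d) (x : ℕ → Fin N → Vec d) (G : ℕ → Finset (Fin N))
    (θs : Vec d) (κ lam : ℝ) : Prop where
  norm_le_one : ∀ t i, ‖x t i‖ ≤ 1
  init_mem : ∀ t, G t ∈ assortments N p.K
  curvature : ∀ t, ∀ S ∈ assortments N p.K, ∀ i ∈ S, ∀ θ : Vec d, ‖θ - θs‖ ≤ 1 →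
    κ ≤ choiceProb θ (x t) S (some i) * choiceProb θ (x t) S none
  gram_ge : ∀ v, lam * ‖v‖ ^ 2 ≤ gramForm (Finset.Icc 1 p.T₀) x G v

variable {θs : Vec d} {κ lam : ℝ}

lemma GoodContext.curvatureBound (h : GoodContext p x G θs κ lam) (htie : IsSelector p.tie)
    (D : Finset ℕ) (c : ℕ → Option (Fin N)) : CurvatureBound D x (offered p x r G c) θs κ :=
  fun t _ => h.curvature t _ (offered_mem_assortments htie h.init_mem c t)

lemma gramForm_init (c : ℕ → Option (Fin N)) :
    gramForm (Finset.Icc 1 p.T₀) x (offered p x r G c) = gramForm (Finset.Icc 1 p.T₀) x G :=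
  gramForm_congr x fun _ hu =>
    offered_of_le p x r G c (Finset.mem_Icc.1 hu).1 (Finset.mem_Icc.1 hu).2

lemma GoodContext.gramForm_ge (h : GoodContext p x G θs κ lam) (c : ℕ → Option (Fin N))
    {D : Finset ℕ} (hD : Finset.Icc 1 p.T₀ ⊆ D) (v : Vec d) :
    lam * ‖v‖ ^ 2 ≤ gramForm D x (offered p x r G c) v := by
  refine (h.gram_ge v).trans ?_
  rw [← gramForm_init (r := r) c]
  exact gramForm_mono hD _ _ _

lemma init_subset_roundsBefore (c : ℕ → Option (Fin N)) (t ℓ : ℕ) :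
    Finset.Icc 1 p.T₀ ⊆ roundsBefore p x r G c t ℓ := by
  rw [roundsBefore_eq]; exact Finset.subset_union_right

variable (x θs) in
/-- A solution of the Hessian equation with right hand side `y`, normalized in the Gram norm. -/
def hessDir (y : Vec d) (D : Finset ℕ) (S : ℕ → Finset (Fin N)) : Vec d :=
  open scoped Classical in
  if h : ∃ a, hess D x S θs a = y then (1 / √(gramForm D x S h.choose)) • h.choose else 0

variable (x) in
/-- A basis that is normalized in the Gram norm. -/
def gramDir (k : Fin d) (D : Finset ℕ) (S : ℕ → Finset (Fin N)) : Vec d :=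
  open scoped Classical in
  if h : (gram D x S).PosDef then (exists_gramForm_basis h).choose k else 0

lemma gramForm_zero (D : Finset ℕ) (S : ℕ → Finset (Fin N)) : gramForm D x S 0 = 0 := by
  simp [gramForm]

lemma gramForm_hessDir_le (y : Vec d) (D : Finset ℕ) (S : ℕ → Finset (Fin N)) :
    gramForm D x S (hessDir x θs y D S) ≤ 1 := by
  unfold hessDir
  split_ifs with h
  · rw [gramForm_smul, div_pow, one_pow, Real.sq_sqrt (gramForm_nonneg _ _ _ _),
      one_div_mul_eq_div]
    -- This covers a vanishing Gram form as well, where the quotient is zero by convention.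
    exact div_self_le_one _
  · rw [gramForm_zero]; exact zero_le_one

lemma gramForm_gramDir_le (k : Fin d) (D : Finset ℕ) (S : ℕ → Finset (Fin N)) :
    gramForm D x S (gramDir x k D S) ≤ 1 := by
  unfold gramDir
  split_ifs with h
  · rw [(exists_gramForm_basis h).choose_spec.1 k]
  · rw [gramForm_zero]; exact zero_le_one

lemma gram_restrictTo (D : Finset ℕ) (S : ℕ → Finset (Fin N)) :
    gram D x (restrictTo D S) = gram D x S :=
  gram_congr x fun _ hu => restrictTo_of_mem S hu

lemma hess_restrictTo (D : Finset ℕ) (S : ℕ → Finset (Fin N)) :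
    hess D x (restrictTo D S) θs = hess D x S θs := by
  ext1 v
  exact Finset.sum_congr rfl fun u hu => by rw [restrictTo_of_mem S hu]

/-- The two parts need different bounds: exploration noise can be decoupled from the direction,
whereas initialization noise influences the later assortments and with them the direction. -/
lemma noise_roundsBefore (c : ℕ → Option (Fin N)) (t ℓ : ℕ) (S : ℕ → Finset (Fin N)) :
    noise (roundsBefore p x r G c t ℓ) x S c θs
      = noise (exploreBefore p x r G c t ℓ) x S c θs + noise (Finset.Icc 1 p.T₀) x S c θs := by
  rw [roundsBefore_eq, noise, Finset.sum_union (disjoint_exploreBefore p x r G c t ℓ)]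
  rfl

lemma eq_zero_of_gramForm_eq_zero {D : Finset ℕ} {S : ℕ → Finset (Fin N)} (hlam : 0 < lam)
    (h : ∀ v, lam * ‖v‖ ^ 2 ≤ gramForm D x S v) {a : Vec d} (ha : gramForm D x S a = 0) :
    a = 0 := by
  have h1 := h a
  rw [ha] at h1
  by_contra hne
  have := norm_pos_iff.2 hne
  have : 0 < lam * ‖a‖ ^ 2 := by positivity
  linarith

/-- If the noise is small in the relevant directions, the estimation error of stage `ℓ` is at most
the confidence width. -/
theorem abs_inner_stageEst_sub_le (hest : IsMLE p.est) (htie : IsSelector p.tie)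
    (hg : GoodContext p x G θs κ lam) (hκ0 : 0 < κ) (hlam : 0 < lam) {s M : ℝ} (hs : 0 ≤ s)
    (hM : M = (2 + √d) * s) (hMκ : M < κ * √lam)
    (hα : 3 * s + 6 * M ^ 2 / (κ ^ 2 * √lam) ≤ κ * p.α)
    (γ : ℕ → Option (Fin N)) {t ℓ : ℕ} (ht : p.T₀ < t) (i : Fin N)
    (h0 : ∀ u, inner ℝ u (noise (Finset.Icc 1 p.T₀) x (offered p x r G γ) γ θs) ≤
      2 * s * √(gramForm (Finset.Icc 1 p.T₀) x (offered p x r G γ) u))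
    (h1 : |inner ℝ (hessDir x θs (x t i) (roundsBefore p x r G γ t ℓ)
        (restrictTo (roundsBefore p x r G γ t ℓ) (offered p x r G γ)))
        (noise (exploreBefore p x r G γ t ℓ) x (offered p x r G γ) γ θs)| ≤ s)
    (h2 : ∀ k, |inner ℝ (gramDir x k (roundsBefore p x r G γ t ℓ)
        (restrictTo (roundsBefore p x r G γ t ℓ) (offered p x r G γ)))
        (noise (exploreBefore p x r G γ t ℓ) x (offered p x r G γ) γ θs)| ≤ s) :
    |inner ℝ (x t i) (stageEst p x γ (stateAfter p x r G γ (t - 1)) ℓ - θs)|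
      ≤ stageWidth p x (stateAfter p x r G γ (t - 1)) t ℓ i := by
  rw [stageEst_stateAfter p x r G γ ht, stageWidth_stateAfter p x r G γ ht]
  set D := roundsBefore p x r G γ t ℓ with hD
  set S := offered p x r G γ with hS
  have hinit : Finset.Icc 1 p.T₀ ⊆ D := init_subset_roundsBefore γ t ℓ
  have hq : ∀ v, lam * ‖v‖ ^ 2 ≤ gramForm D x S v := fun v => hg.gramForm_ge γ hinit v
  have hV : (gram D x S).PosDef := gram_posDef hlam hq
  have hcurv : CurvatureBound D x S θs κ := hg.curvatureBound htie D γ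
  set Z₁ := noise (exploreBefore p x r G γ t ℓ) x S γ θs with hZ₁
  set Z₀ := noise (Finset.Icc 1 p.T₀) x S γ θs with hZ₀
  have hZ : noise D x S γ θs = Z₁ + Z₀ := noise_roundsBefore γ t ℓ S
  have h0' : ∀ u, inner ℝ u Z₀ ≤ 2 * s * √(gramForm D x S u) := fun u =>
    (h0 u).trans (mul_le_mul_of_nonneg_left (Real.sqrt_le_sqrt (gramForm_mono hinit _ _ _))
      (by positivity))
  -- Crude dual norm bound from the `d` basis directions. Its factor `√d` enters `M` only, hence
  -- only the quadratic remainder and not the leading term.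
  have h1' : ∀ u, inner ℝ u Z₁ ≤ √d * s * √(gramForm D x S u) := by
    intro u
    have hV' : (gram D x (restrictTo D S)).PosDef := by rw [gram_restrictTo]; exact hV
    have h3 := (exists_gramForm_basis hV').choose_spec.2 Z₁ u
    rw [← gramForm_restrictTo (x := x) D S]
    refine h3.trans (mul_le_mul_of_nonneg_right ?_ (Real.sqrt_nonneg _))
    rw [← Real.sqrt_sq hs, ← Real.sqrt_mul (Nat.cast_nonneg d)]
    refine Real.sqrt_le_sqrt ?_
    have h4 : ∀ k : Fin d, inner ℝ ((exists_gramForm_basis hV').choose k) Z₁ ^ 2 ≤ s ^ 2 := by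
      intro k
      have h5 := h2 k
      rw [gramDir, dif_pos hV'] at h5
      rw [← sq_abs]
      exact pow_le_pow_left₀ (abs_nonneg _) h5 2
    refine (Finset.sum_le_card_nsmul _ _ _ fun k _ => h4 k).trans ?_
    simp
  obtain ⟨a₀, ha₀⟩ := exists_hess_eq hcurv hκ0 hlam hq (x t i)
  -- `hessDir` is evaluated at the restricted assortments, because a direction may depend only on
  -- what happens in the rounds `D`; the Hessian over `D` is unaffected by the restriction.
  have hex : ∃ a, hess D x (restrictTo D S) θs a = x t i := ⟨a₀, by rw [hess_restrictTo, ha₀]⟩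
  rw [hessDir, dif_pos hex, gramForm_restrictTo] at h1
  set a := hex.choose with ha_def
  have ha : hess D x S θs a = x t i := by
    rw [← hess_restrictTo]; exact hex.choose_spec
  have hM0 : 0 ≤ M := by rw [hM]; positivity
  have hmain := mle_error_le (c := γ) (a := a) (y := x t i) hest hcurv hκ0 hlam
    (fun t _ i _ => hg.norm_le_one t i) hq hM0 (fun v => by
      rw [hZ, inner_add_right, hM]
      linarith [h0' v, h1' v]) hMκ ha
  refine hmain.trans ?_
  have hg0 := Real.sqrt_nonneg (gramForm D x S a)
  have hb1 : |inner ℝ a Z₁| ≤ s * √(gramForm D x S a) := by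
    rcases hg0.eq_or_lt with h | h
    · have h3 : gramForm D x S a = 0 := by
        rw [← Real.sq_sqrt (gramForm_nonneg D x S a), ← h]; simp
      rw [eq_zero_of_gramForm_eq_zero hlam hq h3, inner_zero_left, abs_zero]
      positivity
    · rw [inner_smul_left, abs_mul] at h1
      simp only [conj_trivial] at h1
      rw [abs_of_pos (by positivity), one_div_mul_eq_div, div_le_iff₀ h] at h1
      exact h1
  have hb0 : |inner ℝ a Z₀| ≤ 2 * s * √(gramForm D x S a) := by
    refine abs_le.2 ⟨?_, h0' a⟩
    have h3 := h0' ((-1 : ℝ) • a)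
    rw [gramForm_smul] at h3
    simp only [neg_smul, one_smul, inner_neg_left, even_two, Even.neg_pow, one_pow, one_mul] at h3
    linarith
  -- Leading term: `s` from the exploration noise in the single direction `a`, and `2s` from the
  -- bound for the initialization noise that is uniform in the direction.
  have hb : |inner ℝ a (noise D x S γ θs)| ≤ 3 * s * √(gramForm D x S a) := by
    rw [hZ, inner_add_right]
    refine (abs_add_le _ _).trans ?_
    linarith
  have hw := sqrt_gramForm_le_of_hess_eq hcurv hκ0 hV ha
  have hw0 : 0 ≤ weightedNorm (gram D x S)⁻¹ (x t i) := Real.sqrt_nonneg _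
  have hl : 0 < √lam := Real.sqrt_pos.2 hlam
  calc _ ≤ (3 * s + 6 * M ^ 2 / (κ ^ 2 * √lam)) * √(gramForm D x S a) := by linarith
    _ ≤ (3 * s + 6 * M ^ 2 / (κ ^ 2 * √lam)) * (weightedNorm (gram D x S)⁻¹ (x t i) / κ) :=
        mul_le_mul_of_nonneg_left hw (by positivity)
    _ ≤ κ * p.α * (weightedNorm (gram D x S)⁻¹ (x t i) / κ) :=
        mul_le_mul_of_nonneg_right hα (by positivity)
    _ = _ := by field_simp

/-! Probability of response sequences for fixed contexts -/

variable (p θs x r G) in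
/-- Probability of the event `P` about the responses in the rounds `1, …, T`, for fixed contexts. -/
def pathMeas (P : (ℕ → Option (Fin N)) → Prop) : ℝ :=
  open scoped Classical in
  ∑ γ ∈ seqs none p.T, pathProb p θs x r G p.T γ * if P γ then 1 else 0

lemma pathMeas_mono {P Q : (ℕ → Option (Fin N)) → Prop} (h : ∀ γ, P γ → Q γ) :
    pathMeas p x r G θs P ≤ pathMeas p x r G θs Q := by
  refine Finset.sum_le_sum fun γ _ =>
    mul_le_mul_of_nonneg_left ?_ (pathProb_nonneg p θs x r G p.T γ)
  by_cases hP : P γ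
  · rw [if_pos hP, if_pos (h γ hP)]
  · rw [if_neg hP]; split_ifs <;> norm_num

lemma pathMeas_or_le (P Q : (ℕ → Option (Fin N)) → Prop) :
    pathMeas p x r G θs (fun γ => P γ ∨ Q γ)
      ≤ pathMeas p x r G θs P + pathMeas p x r G θs Q := by
  rw [pathMeas, pathMeas, pathMeas, ← Finset.sum_add_distrib]
  refine Finset.sum_le_sum fun γ _ => ?_
  rw [← mul_add]
  refine mul_le_mul_of_nonneg_left ?_ (pathProb_nonneg p θs x r G p.T γ)
  by_cases hP : P γ <;> by_cases hQ : Q γ <;> simp [hP, hQ]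

lemma pathMeas_exists_le {ι : Type*} (J : Finset ι) (P : ι → (ℕ → Option (Fin N)) → Prop) {b : ℝ}
    (hb : ∀ j ∈ J, pathMeas p x r G θs (P j) ≤ b) :
    pathMeas p x r G θs (fun γ => ∃ j ∈ J, P j γ) ≤ J.card * b := by
  classical
  have h : pathMeas p x r G θs (fun γ => ∃ j ∈ J, P j γ)
      ≤ ∑ j ∈ J, pathMeas p x r G θs (P j) := by
    simp only [pathMeas]
    rw [Finset.sum_comm]
    refine Finset.sum_le_sum fun γ _ => ?_
    rw [← Finset.mul_sum]
    refine mul_le_mul_of_nonneg_left ?_ (pathProb_nonneg p θs x r G p.T γ)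
    have h0 : ∀ j ∈ J, (0 : ℝ) ≤ if P j γ then 1 else 0 := fun j _ => by
      split_ifs <;> norm_num
    split_ifs with hex
    · obtain ⟨j, hj, hP⟩ := hex
      refine le_trans ?_ (Finset.single_le_sum h0 hj)
      rw [if_pos hP]
    · exact Finset.sum_nonneg h0
  refine h.trans ((Finset.sum_le_card_nsmul _ _ _ hb).trans_eq ?_)
  rw [nsmul_eq_mul]

variable (p θs x r G) in
/-- Some confidence width of a round after the initialization phase fails in a stage up to `L`. -/
def WidthFails (L : ℕ) (γ : ℕ → Option (Fin N)) : Prop :=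
  ∃ t ∈ Finset.Ioc p.T₀ p.T, ∃ ℓ ∈ Finset.Icc 1 L, ∃ i : Fin N,
    stageWidth p x (stateAfter p x r G γ (t - 1)) t ℓ i <
      |inner ℝ (x t i) (stageEst p x γ (stateAfter p x r G γ (t - 1)) ℓ - θs)|

/-- For good contexts all confidence widths are valid with high probability. -/
theorem pathMeas_widthFails_le (hest : IsMLE p.est) (htie : IsSelector p.tie)
    (hg : GoodContext p x G θs κ lam) (hκ0 : 0 < κ) (hlam : 0 < lam) {s M : ℝ} (hs : 0 ≤ s)
    (hM : M = (2 + √d) * s) (hMκ : M < κ * √lam)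
    (hα : 3 * s + 6 * M ^ 2 / (κ ^ 2 * √lam) ≤ κ * p.α) (hT : p.T₀ ≤ p.T)
    {Q : Finset (Vec d)} (hQ : IsSphereNet Q) (L : ℕ) :
    pathMeas p x r G θs (WidthFails p x r G θs L) ≤
      (Q.card + p.T * (L * (N + d))) * (2 * Real.exp (-(s ^ 2 / 2))) := by
  have hV₀ : (gram (Finset.Icc 1 p.T₀) x G).PosDef := gram_posDef hlam hg.gram_ge
  obtain ⟨A, hA1, hA2⟩ := exists_gramForm_net hV₀ hQ
  set b := 2 * Real.exp (-(s ^ 2 / 2)) with hb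
  have hb0 : 0 ≤ b := by positivity
  set E₀ : Vec d → (ℕ → Option (Fin N)) → Prop := fun q γ =>
    s < |inner ℝ (A q) (noise (Finset.Icc 1 p.T₀) x (offered p x r G γ) γ θs)|
  set E₁ : ℕ → ℕ → Fin N → (ℕ → Option (Fin N)) → Prop := fun t ℓ i γ =>
    s < |inner ℝ (hessDir x θs (x t i) (roundsBefore p x r G γ t ℓ)
        (restrictTo (roundsBefore p x r G γ t ℓ) (offered p x r G γ)))
        (noise (exploreBefore p x r G γ t ℓ) x (offered p x r G γ) γ θs)|
  set E₂ : ℕ → ℕ → Fin d → (ℕ → Option (Fin N)) → Prop := fun t ℓ k γ =>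
    s < |inner ℝ (gramDir x k (roundsBefore p x r G γ t ℓ)
        (restrictTo (roundsBefore p x r G γ t ℓ) (offered p x r G γ)))
        (noise (exploreBefore p x r G γ t ℓ) x (offered p x r G γ) γ θs)|
  have hE₀ : ∀ q ∈ Q, pathMeas p x r G θs (E₀ q) ≤ b := fun q hq => by
    have := sum_pathProb_init_gt_le θs (p := p) (x := x) (r := r) (G := G) hT (A q)
      (hA1 q hq).le s hs
    rw [pathMeas]; convert this
  have hE₁ : ∀ t ∈ Finset.Ioc p.T₀ p.T, ∀ ℓ ∈ Finset.Icc 1 L, ∀ i,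
      pathMeas p x r G θs (E₁ t ℓ i) ≤ b := fun t ht ℓ hℓ i => by
    rw [Finset.mem_Ioc] at ht
    have := sum_pathProb_explore_gt_le θs (p := p) (x := x) (r := r) (G := G) ht.1 ht.2
      (Finset.mem_Icc.1 hℓ).1 (hessDir x θs (x t i)) (gramForm_hessDir_le (x t i)) s hs
    rw [pathMeas]; convert this
  have hE₂ : ∀ t ∈ Finset.Ioc p.T₀ p.T, ∀ ℓ ∈ Finset.Icc 1 L, ∀ k,
      pathMeas p x r G θs (E₂ t ℓ k) ≤ b := fun t ht ℓ hℓ k => by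
    rw [Finset.mem_Ioc] at ht
    have := sum_pathProb_explore_gt_le θs (p := p) (x := x) (r := r) (G := G) ht.1 ht.2
      (Finset.mem_Icc.1 hℓ).1 (gramDir x k) (gramForm_gramDir_le k) s hs
    rw [pathMeas]; convert this
  -- The net points serve all rounds and stages at once, whereas each round and stage needs its own
  -- `N` Hessian directions and `d` basis directions. This gives the counts in the union bound.
  have hsub : ∀ γ, WidthFails p x r G θs L γ → (∃ q ∈ Q, E₀ q γ) ∨
      ∃ t ∈ Finset.Ioc p.T₀ p.T, ∃ ℓ ∈ Finset.Icc 1 L,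
        (∃ i ∈ (Finset.univ : Finset (Fin N)), E₁ t ℓ i γ) ∨
        (∃ k ∈ (Finset.univ : Finset (Fin d)), E₂ t ℓ k γ) := by
    rintro γ ⟨t, ht, ℓ, hℓ, i, hi⟩
    by_contra! hcon
    obtain ⟨hc0, hc⟩ := hcon
    obtain ⟨hc1, hc2⟩ := hc t ht ℓ hℓ
    refine absurd hi (not_lt.2 ?_)
    refine abs_inner_stageEst_sub_le hest htie hg hκ0 hlam hs hM hMκ hα γ (Finset.mem_Ioc.1 ht).1 i
      ?_ (not_lt.1 (hc1 i (Finset.mem_univ i))) fun k => not_lt.1 (hc2 k (Finset.mem_univ k))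
    rw [gramForm_init]
    exact hA2 _ s hs fun q hq => not_lt.1 (hc0 q hq)
  refine (pathMeas_mono hsub).trans ((pathMeas_or_le _ _).trans ?_)
  rw [add_mul]
  refine add_le_add (pathMeas_exists_le Q E₀ hE₀) ?_
  have hinner : ∀ t ∈ Finset.Ioc p.T₀ p.T, pathMeas p x r G θs (fun γ => ∃ ℓ ∈ Finset.Icc 1 L,
        (∃ i ∈ (Finset.univ : Finset (Fin N)), E₁ t ℓ i γ) ∨
        (∃ k ∈ (Finset.univ : Finset (Fin d)), E₂ t ℓ k γ)) ≤ L * ((N + d) * b) := by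
    intro t ht
    refine (pathMeas_exists_le _ _ fun ℓ hℓ => (pathMeas_or_le _ _).trans (add_le_add
      (pathMeas_exists_le _ _ fun i _ => hE₁ t ht ℓ hℓ i)
      (pathMeas_exists_le _ _ fun k _ => hE₂ t ht ℓ hℓ k))).trans_eq ?_
    simp [add_mul]
  refine (pathMeas_exists_le _ _ hinner).trans ?_
  rw [Nat.card_Ioc, mul_assoc, mul_assoc]
  refine mul_le_mul_of_nonneg_right ?_ (by positivity)
  exact_mod_cast Nat.sub_le _ _

end Confidence

/-! ### Regret when all confidence widths are valid -/

section Regret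

variable {N d : ℕ}

lemma two_mul_le_maxWidth {A : Finset (Finset (Fin N))} {w : Fin N → ℝ} {S : Finset (Fin N)}
    (hS : S ∈ A) {i : Fin N} (hi : i ∈ S) : 2 * w i ≤ maxWidth A w := by
  have hmem : i ∈ A.biUnion id := Finset.mem_biUnion.2 ⟨S, hS, hi⟩
  rw [maxWidth, dif_pos ⟨i, hmem⟩]
  exact mul_le_mul_of_nonneg_left (Finset.le_sup' w hmem) (by norm_num)

lemma maxWidth_nonneg {A : Finset (Finset (Fin N))} {w : Fin N → ℝ} (hw : ∀ i, 0 ≤ w i) :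
    0 ≤ maxWidth A w := by
  unfold maxWidth
  split_ifs with h
  · obtain ⟨i, hi⟩ := h
    have := (hw i).trans (Finset.le_sup' w hi)
    positivity
  · exact le_rfl

lemma exists_maxWidth_eq {A : Finset (Finset (Fin N))} {w : Fin N → ℝ}
    (h : 0 < maxWidth A w) : ∃ S ∈ A, ∃ i ∈ S, maxWidth A w = 2 * w i := by
  by_cases hne : (A.biUnion id).Nonempty
  · obtain ⟨i, hi, heq⟩ := Finset.exists_mem_eq_sup' hne w
    obtain ⟨S, hS, hiS⟩ := Finset.mem_biUnion.1 hi
    exact ⟨S, hS, i, hiS, by rw [maxWidth, dif_pos hne, heq]⟩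
  · rw [maxWidth, dif_neg hne] at h
    exact absurd h (lt_irrefl _)

lemma mem_argmaxSet {A : Finset (Finset (Fin N))} {f : Finset (Fin N) → ℝ}
    {S : Finset (Fin N)} : S ∈ argmaxSet A f ↔ S ∈ A ∧ ∀ S' ∈ A, f S' ≤ f S := by
  simp [argmaxSet]

/-- The number of stages. -/
def numStages (T : ℕ) : ℕ := ⌊(1 / 2 : ℝ) * Real.logb 2 T⌋₊ + 1

variable {p : Input N d} {x : ℕ → Fin N → Vec d} {r : ℕ → Fin N → ℝ} {G : ℕ → Finset (Fin N)}
  {θs : Vec d}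

lemma stopStage_le (hT : 1 ≤ p.T) (c : ℕ → Option (Fin N)) (s : State N) (t : ℕ) :
    stopStage p x r c s t ≤ numStages p.T :=
  Nat.sInf_le (mem_stopStages p hT x r c s t)

/-! ### Regret of a single round -/

section OneRound

variable {c : ℕ → Option (Fin N)} {s : State N} {t : ℕ}

/-- Expected revenue is `2`-Lipschitz in the utilities, so the error is at most twice the largest
width; this is the reason for the factor `2` in `𝒲`. -/
lemma abs_revenue_stageEst_sub_le (hr : ∀ i, |r t i| ≤ 1) {ℓ : ℕ}
    (hw : ∀ i, |inner ℝ (x t i) (stageEst p x c s ℓ - θs)| ≤ stageWidth p x s t ℓ i)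
    {S : Finset (Fin N)} (hS : S ∈ stageCand p x r c s t ℓ) :
    |revenue (stageEst p x c s ℓ) (x t) (r t) S - revenue θs (x t) (r t) S|
      ≤ stageMaxWidth p x r c s t ℓ := by
  have h0 : 0 ≤ stageMaxWidth p x r c s t ℓ :=
    maxWidth_nonneg fun i => (abs_nonneg _).trans (hw i)
  have h := abs_revenue_sub_le θs (stageEst p x c s ℓ) (x t) (r t) S hr
    (δ := stageMaxWidth p x r c s t ℓ / 2) (by linarith) fun i hi => by
      have := two_mul_le_maxWidth (w := stageWidth p x s t ℓ) hS hi
      rw [stageMaxWidth]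
      linarith [hw i]
  linarith

lemma stageMaxWidth_le_of_lt_stopStage {ℓ : ℕ} (h1 : 1 ≤ ℓ) (hℓ : ℓ < stopStage p x r c s t) :
    stageMaxWidth p x r c s t ℓ ≤ (2 : ℝ) ^ (-(ℓ : ℤ)) := by
  have h := Nat.notMem_of_lt_sInf hℓ
  simp only [stopStages, Set.mem_ofPred_eq, not_and, not_or, not_lt] at h
  exact (h h1).2

/-- An optimal assortment survives all eliminations. -/
lemma mem_stageCand_of_isMax (hr : ∀ i, |r t i| ≤ 1) {L : ℕ}
    (hw : ∀ ℓ, 1 ≤ ℓ → ℓ ≤ L → ∀ i,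
      |inner ℝ (x t i) (stageEst p x c s ℓ - θs)| ≤ stageWidth p x s t ℓ i)
    (hL : stopStage p x r c s t ≤ L) {S : Finset (Fin N)} (hS : S ∈ assortments N p.K)
    (hmax : ∀ S' ∈ assortments N p.K, revenue θs (x t) (r t) S' ≤ revenue θs (x t) (r t) S) :
    ∀ ℓ ≤ stopStage p x r c s t, S ∈ stageCand p x r c s t ℓ
  | 0, _ => hS
  | 1, _ => hS
  | ℓ + 2, hℓ => by
    have ih := mem_stageCand_of_isMax hr hw hL hS hmax (ℓ + 1) (by omega)
    rw [stageCand, Finset.mem_filter]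
    refine ⟨ih, fun S' hS' => ?_⟩
    have hw' := hw (ℓ + 1) (by omega) (by omega)
    -- The estimation errors of the two assortments add up to at most `2 * 2 ^ (-(ℓ + 1))`, which is
    -- exactly the elimination margin of this stage.
    have h1 := abs_le.1 (abs_revenue_stageEst_sub_le hr hw' ih)
    have h2 := abs_le.1 (abs_revenue_stageEst_sub_le hr hw' hS')
    have h3 := stageMaxWidth_le_of_lt_stopStage (p := p) (x := x) (r := r) (c := c) (s := s)
      (t := t) (ℓ := ℓ + 1) (by omega) (by omega)
    have h4 := hmax S' (stageCand_subset _ _ _ _ hS')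
    have h5 : (2 : ℝ) ^ (-((ℓ + 1 : ℕ) : ℤ) + 1) = 2 * (2 : ℝ) ^ (-((ℓ + 1 : ℕ) : ℤ)) := by
      rw [zpow_add_one₀ (by norm_num), mul_comm]
    rw [h5]
    linarith

/-- Regret of one round in terms of the widths of the offered items. -/
lemma regret_roundChoice_le (htie : IsSelector p.tie) (hT : 1 ≤ p.T) (hr : ∀ i, |r t i| ≤ 1)
    (hw : ∀ ℓ, 1 ≤ ℓ → ℓ ≤ numStages p.T → ∀ i,
      |inner ℝ (x t i) (stageEst p x c s ℓ - θs)| ≤ stageWidth p x s t ℓ i) :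
    (roundStage p x r c s t = 0 ∧ optRevenue p.K θs (x t) (r t)
        - revenue θs (x t) (r t) (roundChoice p x r c s t) ≤ 2 / √p.T) ∨
    (1 ≤ roundStage p x r c s t ∧ roundStage p x r c s t ≤ numStages p.T ∧
      optRevenue p.K θs (x t) (r t) - revenue θs (x t) (r t) (roundChoice p x r c s t)
        ≤ 16 * ∑ i ∈ roundChoice p x r c s t,
          stageWidth p x s t (roundStage p x r c s t) i) := by
  obtain ⟨S, hS, hopt⟩ := Finset.exists_mem_eq_sup' (assortments_nonempty N p.K)
    (revenue θs (x t) (r t))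
  have hopt' : optRevenue p.K θs (x t) (r t) = revenue θs (x t) (r t) S := hopt
  have hmax : ∀ S' ∈ assortments N p.K,
      revenue θs (x t) (r t) S' ≤ revenue θs (x t) (r t) S := fun S' hS' => by
    rw [← hopt]; exact Finset.le_sup' _ hS'
  have hL := stopStage_le (x := x) (r := r) hT c s t
  have hfirst := stopStage_mem (x := x) (r := r) (c := c) hT s t
  have hcand := mem_stageCand_of_isMax hr hw hL hS hmax
  have hchoice := roundChoice_mem (x := x) (r := r) htie c s t
  set ℓ := stopStage p x r c s t with hℓ
  set C := roundChoice p x r c s t with hC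
  rw [hopt']
  by_cases hW : stageMaxWidth p x r c s t ℓ ≤ 1 / √p.T
  · left
    refine ⟨by rw [roundStage, if_pos hW], ?_⟩
    have hCm : C ∈ argmaxSet (stageCand p x r c s t ℓ) fun S =>
        revenue (stageEst p x c s ℓ) (x t) (r t) S := by
      rw [hC, roundChoice, if_pos hW]
      exact htie _ (argmaxSet_nonempty (stageCand_nonempty _ _ _ _) _)
    have h1 := (mem_argmaxSet.1 hCm).2 S (hcand ℓ le_rfl)
    have hw' := hw ℓ hfirst.1 hL
    have h2 := abs_le.1 (abs_revenue_stageEst_sub_le hr hw' hchoice)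
    have h3 := abs_le.1 (abs_revenue_stageEst_sub_le hr hw' (hcand ℓ le_rfl))
    have h4 : 2 / √(p.T : ℝ) = 2 * (1 / √p.T) := by ring
    rw [h4]
    linarith
  · right
    have hstage : roundStage p x r c s t = ℓ := by rw [roundStage, if_neg hW]
    rw [hstage]
    refine ⟨hfirst.1, hL, ?_⟩
    have hW2 : (2 : ℝ) ^ (-(ℓ : ℤ)) < stageMaxWidth p x r c s t ℓ := hfirst.2.resolve_left hW
    have hpos : (0 : ℝ) < 2 ^ (-(ℓ : ℤ)) := by positivity
    have hw' := hw ℓ hfirst.1 hL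
    have hw0 : ∀ i, 0 ≤ stageWidth p x s t ℓ i := fun i => (abs_nonneg _).trans (hw' i)
    have hCm : C ∈ argmaxSet (stageCand p x r c s t ℓ) fun S =>
        ∑ i ∈ S, stageWidth p x s t ℓ i := by
      rw [hC, roundChoice, if_neg hW]
      exact htie _ (argmaxSet_nonempty (stageCand_nonempty _ _ _ _) _)
    obtain ⟨S₁, hS₁, i, hi, heq⟩ := exists_maxWidth_eq (hpos.trans hW2)
    have h1 : stageMaxWidth p x r c s t ℓ ≤ 2 * ∑ i ∈ C, stageWidth p x s t ℓ i := by
      rw [stageMaxWidth, heq]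
      refine mul_le_mul_of_nonneg_left ?_ (by norm_num)
      exact (Finset.single_le_sum (fun j _ => hw0 j) hi).trans ((mem_argmaxSet.1 hCm).2 S₁ hS₁)
    -- The loop stopped with `2 ^ (-ℓ) < 𝒲`, and the explored assortment has total width at least `𝒲
    -- / 2`; so `8 * 2 ^ (-ℓ)` is at most `16` times the sum of the widths.
    suffices h : revenue θs (x t) (r t) S - revenue θs (x t) (r t) C ≤ 8 * (2 : ℝ) ^ (-(ℓ : ℤ)) by
      linarith
    rcases Nat.lt_or_ge ℓ 2 with h2 | h2
    -- In the first stage nothing has been eliminated yet, but the regret never exceeds `2 ≤ 8 * 2 ^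
    -- (-1)`.
    · have h3 : ℓ = 1 := by have := hfirst.1; omega
      rw [h3]
      have h4 := abs_le.1 (abs_revenue_le_one θs (x t) (r t) S hr)
      have h5 := abs_le.1 (abs_revenue_le_one θs (x t) (r t) C hr)
      norm_num
      linarith
    -- Having survived stage `ℓ - 1`, the assortment loses at most the margin `4 * 2 ^ (-ℓ)` plus
    -- two estimation errors of `2 * 2 ^ (-ℓ)` each.
    · obtain ⟨k, hk⟩ := Nat.exists_eq_add_of_le' h2
      have hCk : C ∈ stageCand p x r c s t (k + 2) := by rw [← hk]; exact hchoice
      rw [stageCand, Finset.mem_filter] at hCk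
      have hSk := hcand (k + 1) (by omega)
      have h3 := hCk.2 S hSk
      have hw'' := hw (k + 1) (by omega) (by omega)
      have h4 := abs_le.1 (abs_revenue_stageEst_sub_le hr hw'' hCk.1)
      have h5 := abs_le.1 (abs_revenue_stageEst_sub_le hr hw'' hSk)
      have h6 := stageMaxWidth_le_of_lt_stopStage (p := p) (x := x) (r := r) (c := c) (s := s)
        (t := t) (ℓ := k + 1) (by omega) (by omega)
      have h7 : (2 : ℝ) ^ (-((k + 1 : ℕ) : ℤ) + 1) = 4 * (2 : ℝ) ^ (-(ℓ : ℤ)) := by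
        rw [hk, show (-((k + 1 : ℕ) : ℤ) + 1) = -((k + 2 : ℕ) : ℤ) + 2 by push_cast; ring,
          zpow_add₀ (by norm_num), mul_comm]
        norm_num
      have h8 : (2 : ℝ) ^ (-((k + 1 : ℕ) : ℤ)) = 2 * (2 : ℝ) ^ (-(ℓ : ℤ)) := by
        rw [hk, show (-((k + 1 : ℕ) : ℤ)) = -((k + 2 : ℕ) : ℤ) + 1 by push_cast; ring,
          zpow_add₀ (by norm_num), mul_comm]
        norm_num
      rw [h7] at h3
      rw [h8] at h6
      linarith

end OneRound

/-! Sum of the widths over the exploration rounds -/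

lemma sum_Ioc_le_of_forall_le_sub {a b : ℕ} (hab : a ≤ b) (f g : ℕ → ℝ)
    (h : ∀ t, a < t → t ≤ b → g t ≤ f t - f (t - 1)) :
    ∑ t ∈ Finset.Ioc a b, g t ≤ f b - f a := by
  induction b, hab using Nat.le_induction with
  | base => simp
  | succ b hab ih =>
    rw [Finset.sum_Ioc_succ_top hab]
    have h1 := ih fun t h1 h2 => h t h1 (by omega)
    have h2 := h (b + 1) (by omega) le_rfl
    rw [Nat.add_sub_cancel] at h2
    linarith

lemma roundsBefore_succ (c : ℕ → Option (Fin N)) {t ℓ : ℕ} (ht : p.T₀ < t)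
    (hl : label p x r G c t = ℓ) :
    roundsBefore p x r G c (t + 1) ℓ = insert t (roundsBefore p x r G c t ℓ) := by
  ext u
  rw [Finset.mem_insert, roundsBefore_eq, roundsBefore_eq, Finset.mem_union, Finset.mem_union,
    mem_exploreBefore p x r G c (by omega), mem_exploreBefore p x r G c (by omega)]
  constructor
  · rintro (⟨h1, h2, h3⟩ | h)
    · by_cases hu : u = t
      · exact Or.inl hu
      · exact Or.inr (Or.inl ⟨h1, by omega, h3⟩)
    · exact Or.inr (Or.inr h)
  · rintro (rfl | ⟨h1, h2, h3⟩ | h)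
    · exact Or.inl ⟨ht, by omega, hl⟩
    · exact Or.inl ⟨h1, by omega, h3⟩
    · exact Or.inr h

lemma roundsBefore_succ_of_ne (c : ℕ → Option (Fin N)) {t ℓ : ℕ} (ht : p.T₀ < t)
    (hl : label p x r G c t ≠ ℓ) :
    roundsBefore p x r G c (t + 1) ℓ = roundsBefore p x r G c t ℓ := by
  rw [roundsBefore_eq, roundsBefore_eq]
  congr 1
  ext u
  rw [mem_exploreBefore p x r G c (by omega), mem_exploreBefore p x r G c (by omega)]
  constructor
  · rintro ⟨h1, h2, h3⟩
    refine ⟨h1, ?_, h3⟩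
    by_contra hu
    have : u = t := by omega
    rw [this] at h3
    exact hl h3
  · rintro ⟨h1, h2, h3⟩; exact ⟨h1, by omega, h3⟩

variable {κ lam : ℝ}

lemma gramForm_le_mul_norm_sq {D : Finset ℕ} {S : ℕ → Finset (Fin N)} {K T : ℕ}
    (hx : ∀ t i, ‖x t i‖ ≤ 1) (hS : ∀ t, (S t).card ≤ K) (hD : D.card ≤ T) (v : Vec d) :
    gramForm D x S v ≤ (K * T : ℝ) * ‖v‖ ^ 2 := by
  have h1 : ∀ t ∈ D, ∑ i ∈ S t, (inner ℝ (x t i) v) ^ 2 ≤ K * ‖v‖ ^ 2 := by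
    intro t _
    have h2 : ∀ i ∈ S t, (inner ℝ (x t i) v) ^ 2 ≤ ‖v‖ ^ 2 := fun i _ => by
      rw [← sq_abs]
      exact pow_le_pow_left₀ (abs_nonneg _) ((abs_real_inner_le_norm _ _).trans
        (mul_le_of_le_one_left (norm_nonneg _) (hx t i))) 2
    refine (Finset.sum_le_card_nsmul _ _ _ h2).trans ?_
    rw [nsmul_eq_mul]
    exact mul_le_mul_of_nonneg_right (by exact_mod_cast hS t) (sq_nonneg _)
  refine (Finset.sum_le_card_nsmul _ _ _ h1).trans ?_
  rw [nsmul_eq_mul]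
  calc (D.card : ℝ) * (K * ‖v‖ ^ 2) ≤ T * (K * ‖v‖ ^ 2) := by gcongr
    _ = _ := by ring

/-- Elliptical potential bound for the exploration rounds of one stage. -/
lemma sum_sq_weightedNorm_le (htie : IsSelector p.tie) (hg : GoodContext p x G θs κ lam)
    (hlam : 0 < lam) (hK1 : 1 ≤ p.K) (hK : (p.K : ℝ) ≤ lam) (hT1 : 1 ≤ p.T) (hT : p.T₀ ≤ p.T)
    (c : ℕ → Option (Fin N)) (ℓ : ℕ) :
    ∑ t ∈ (Finset.Ioc p.T₀ p.T).filter (fun t => label p x r G c t = ℓ),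
      ∑ i ∈ offered p x r G c t, weightedNorm
        (gram (roundsBefore p x r G c t ℓ) x (offered p x r G c))⁻¹ (x t i) ^ 2
      ≤ 4 * (d * Real.log (p.K * p.T / lam)) := by
  have hcard : ∀ t, (offered p x r G c t).card ≤ p.K := fun t => by
    have := offered_mem_assortments (x := x) (r := r) htie hg.init_mem c t
    simpa [assortments] using this
  -- The shift `t + 1` makes `f t` the potential after round `t`. The increments telescope, and
  -- rounds with another label contribute zero.
  set f : ℕ → ℝ := fun t =>
    4 * Real.log (gram (roundsBefore p x r G c (t + 1) ℓ) x (offered p x r G c)).det with hf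
  have hq : ∀ t v, lam * ‖v‖ ^ 2 ≤ gramForm (roundsBefore p x r G c t ℓ) x
      (offered p x r G c) v := fun t v => hg.gramForm_ge c (init_subset_roundsBefore c t ℓ) v
  rw [Finset.sum_filter]
  refine (sum_Ioc_le_of_forall_le_sub hT f _ fun t h1 h2 => ?_).trans ?_
  · simp only [hf]
    rw [Nat.sub_add_cancel (by omega)]
    split_ifs with hl
    · rw [roundsBefore_succ c h1 hl, ← mul_sub]
      refine sum_sq_weightedNorm_le_log_det ?_ hlam hK (hq t) (hcard t)
        fun i _ => hg.norm_le_one t i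
      intro hmem
      have := lt_of_mem_roundsBefore p x r G c h1 hmem
      omega
    · rw [roundsBefore_succ_of_ne c h1 hl, sub_self]
  · simp only [hf]
    rw [← mul_sub]
    refine mul_le_mul_of_nonneg_left ?_ (by norm_num)
    refine log_det_gram_sub_le hlam (hq _) (hq _) ?_ (by positivity)
    refine gramForm_le_mul_norm_sq hg.norm_le_one hcard ?_
    have hsub : roundsBefore p x r G c (p.T + 1) ℓ ⊆ Finset.Icc 1 p.T := fun u hu => by
      have := lt_of_mem_roundsBefore p x r G c (by omega) hu
      rw [Finset.mem_Icc]; omega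
    simpa using Finset.card_le_card hsub

/-- Cauchy-Schwarz over all pairs of a round and an offered item; there are at most `K |J|` such
pairs. -/
lemma sum_sum_le_sqrt {ι α : Type*} (J : Finset ι) (S : ι → Finset α) (f : ι → α → ℝ) {K : ℕ}
    (hS : ∀ t ∈ J, (S t).card ≤ K) {P : ℝ} (hP : ∑ t ∈ J, ∑ i ∈ S t, f t i ^ 2 ≤ P) :
    ∑ t ∈ J, ∑ i ∈ S t, f t i ≤ √(K * P) * √J.card := by
  classical
  have hP0 : 0 ≤ P :=
    (Finset.sum_nonneg fun _ _ => Finset.sum_nonneg fun _ _ => sq_nonneg _).trans hP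
  have hcard : ∑ t ∈ J, ((S t).card : ℝ) ≤ J.card * K := by
    refine (Finset.sum_le_card_nsmul _ _ (K : ℝ) fun t ht => by exact_mod_cast hS t ht).trans_eq ?_
    rw [nsmul_eq_mul]
  have h1 : (∑ t ∈ J, ∑ i ∈ S t, f t i) ^ 2 ≤ (J.card * K) * P := by
    rw [Finset.sum_sigma']
    refine sq_sum_le_card_mul_sum_sq.trans ?_
    rw [Finset.card_sigma, ← Finset.sum_sigma' J S fun t i => f t i ^ 2]
    push_cast
    gcongr
  refine (Real.le_sqrt_of_sq_le h1).trans_eq ?_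
  rw [← Real.sqrt_mul (by positivity)]
  ring_nf

/-- Regret bound on the event that all confidence widths are valid. -/
theorem cumRegret_le (htie : IsSelector p.tie) (hg : GoodContext p x G θs κ lam)
    (hlam : 0 < lam) (hK1 : 1 ≤ p.K) (hK : (p.K : ℝ) ≤ lam) (hT1 : 1 ≤ p.T) (hT : p.T₀ ≤ p.T)
    (hα : 0 ≤ p.α) (hr : ∀ t i, |r t i| ≤ 1) (c : ℕ → Option (Fin N))
    (hw : ¬ WidthFails p x r G θs (numStages p.T) c) :
    cumRegret p θs x r G c ≤ 2 * p.T₀ + 2 * √p.T +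
      16 * p.α * √(p.K * (4 * (d * Real.log (p.K * p.T / lam)))) * √(numStages p.T * p.T) := by
  classical
  set P := 4 * (d * Real.log (p.K * p.T / lam)) with hP
  set L := numStages p.T with hL
  set reg : ℕ → ℝ := fun t =>
    optRevenue p.K θs (x t) (r t) - revenue θs (x t) (r t) (offered p x r G c t) with hreg
  have hcard : ∀ t, (offered p x r G c t).card ≤ p.K := fun t => by
    have := offered_mem_assortments (x := x) (r := r) htie hg.init_mem c t
    simpa [assortments] using this
  have hreg2 : ∀ t, reg t ≤ 2 := fun t => by
    have h1 : optRevenue p.K θs (x t) (r t) ≤ 1 :=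
      Finset.sup'_le _ _ fun S _ => (abs_le.1 (abs_revenue_le_one θs (x t) (r t) S (hr t))).2
    have h2 := abs_le.1 (abs_revenue_le_one θs (x t) (r t) (offered p x r G c t) (hr t))
    simp only [hreg]
    linarith
  set wd : ℕ → ℕ → Fin N → ℝ := fun ℓ t i => p.α * weightedNorm
    (gram (roundsBefore p x r G c t ℓ) x (offered p x r G c))⁻¹ (x t i) with hwd
  have hwd0 : ∀ ℓ t i, 0 ≤ wd ℓ t i := fun ℓ t i => mul_nonneg hα (Real.sqrt_nonneg _)
  have hround : ∀ t ∈ Finset.Ioc p.T₀ p.T, reg t ≤ 2 / √p.T + ∑ ℓ ∈ Finset.Icc 1 L,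
      if label p x r G c t = ℓ then 16 * ∑ i ∈ offered p x r G c t, wd ℓ t i else 0 := by
    intro t ht
    rw [Finset.mem_Ioc] at ht
    have hnn : (0 : ℝ) ≤ 2 / √p.T := by positivity
    have h := regret_roundChoice_le (θs := θs) (x := x) (r := r) (c := c)
      (s := stateAfter p x r G c (t - 1)) (t := t) htie hT1 (hr t) fun ℓ h1 h2 i => by
        by_contra! hcon
        exact hw ⟨t, Finset.mem_Ioc.2 ht, ℓ, Finset.mem_Icc.2 ⟨h1, h2⟩, i, hcon⟩
    rw [← offered_of_lt p x r G c ht.1] at h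
    change (label p x r G c t = 0 ∧ reg t ≤ _) ∨ (1 ≤ label p x r G c t ∧
      label p x r G c t ≤ L ∧ reg t ≤ 16 * ∑ i ∈ offered p x r G c t,
        stageWidth p x (stateAfter p x r G c (t - 1)) t (label p x r G c t) i) at h
    simp only [stageWidth_stateAfter p x r G c ht.1] at h
    rcases h with ⟨_, h⟩ | ⟨h1, h2, h⟩
    · refine h.trans (le_add_of_nonneg_right (Finset.sum_nonneg fun ℓ _ => ?_))
      split_ifs
      · exact mul_nonneg (by norm_num) (Finset.sum_nonneg fun i _ => hwd0 _ _ _)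
      · exact le_rfl
    · rw [Finset.sum_ite_eq, if_pos (Finset.mem_Icc.2 ⟨h1, h2⟩)]
      exact h.trans (le_add_of_nonneg_left hnn)
  set J : ℕ → Finset ℕ := fun ℓ =>
    (Finset.Ioc p.T₀ p.T).filter (fun t => label p x r G c t = ℓ) with hJ
  have hstage : ∀ ℓ ∈ Finset.Icc 1 L, ∑ t ∈ J ℓ, ∑ i ∈ offered p x r G c t, wd ℓ t i
      ≤ p.α * √(p.K * P) * √(J ℓ).card := by
    intro ℓ _
    have h1 := sum_sum_le_sqrt (J ℓ) (offered p x r G c) (fun t i => weightedNorm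
      (gram (roundsBefore p x r G c t ℓ) x (offered p x r G c))⁻¹ (x t i))
      (fun t _ => hcard t) (sum_sq_weightedNorm_le htie hg hlam hK1 hK hT1 hT c ℓ)
    simp only [hwd, ← Finset.mul_sum]
    rw [mul_assoc]
    exact mul_le_mul_of_nonneg_left h1 hα
  -- Cauchy-Schwarz across stages: they occupy disjoint sets of rounds, so `L` stages cost `√(L T)`
  -- rather than `L √T`.
  have hsqrt : ∑ ℓ ∈ Finset.Icc 1 L, √((J ℓ).card : ℝ) ≤ √(L * p.T) := by
    have h1 : ∑ ℓ ∈ Finset.Icc 1 L, ((J ℓ).card : ℝ) ≤ p.T := by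
      have h2 : ∑ ℓ ∈ Finset.Icc 1 L, (J ℓ).card ≤ p.T := by
        rw [← Finset.card_biUnion]
        · calc _ ≤ (Finset.Ioc p.T₀ p.T).card := Finset.card_le_card
                (Finset.biUnion_subset.2 fun ℓ _ => Finset.filter_subset _ _)
            _ ≤ p.T := by simp
        · intro ℓ _ ℓ' _ hne
          rw [Function.onFun, Finset.disjoint_left]
          intro t h1 h2
          exact hne ((Finset.mem_filter.1 h1).2.symm.trans (Finset.mem_filter.1 h2).2)
      exact_mod_cast h2
    refine Real.le_sqrt_of_sq_le (sq_sum_le_card_mul_sum_sq.trans ?_)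
    simp only [Real.sq_sqrt (Nat.cast_nonneg _), Nat.card_Icc, Nat.add_sub_cancel]
    exact mul_le_mul_of_nonneg_left h1 (Nat.cast_nonneg _)
  have hsplit : cumRegret p θs x r G c
      = ∑ t ∈ Finset.Icc 1 p.T₀, reg t + ∑ t ∈ Finset.Ioc p.T₀ p.T, reg t := by
    have hI : ∀ n : ℕ, Finset.Icc 1 n = Finset.Ioc 0 n := fun n => rfl
    rw [cumRegret, hI, hI, Finset.sum_Ioc_consecutive _ (Nat.zero_le _) hT]
  have hA : ∑ t ∈ Finset.Icc 1 p.T₀, reg t ≤ 2 * p.T₀ := by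
    refine (Finset.sum_le_card_nsmul _ _ 2 fun t _ => hreg2 t).trans_eq ?_
    rw [Nat.card_Icc, Nat.add_sub_cancel, nsmul_eq_mul, mul_comm]
  have hTpos : (0 : ℝ) < √p.T := Real.sqrt_pos.2 (by exact_mod_cast hT1)
  have hB : ∑ t ∈ Finset.Ioc p.T₀ p.T, reg t ≤ 2 * √p.T +
      16 * p.α * √(p.K * P) * √(L * p.T) := by
    refine (Finset.sum_le_sum hround).trans ?_
    rw [Finset.sum_add_distrib]
    refine add_le_add ?_ ?_
    · rw [Finset.sum_const, Nat.card_Ioc, nsmul_eq_mul]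
      calc ((p.T - p.T₀ : ℕ) : ℝ) * (2 / √p.T) ≤ p.T * (2 / √p.T) := by
            gcongr; exact Nat.sub_le _ _
        _ = 2 * √p.T := by
            rw [mul_div_assoc', div_eq_iff hTpos.ne']
            nlinarith [Real.mul_self_sqrt (Nat.cast_nonneg (α := ℝ) p.T)]
    · rw [Finset.sum_comm]
      simp only [← Finset.sum_filter, ← Finset.mul_sum]
      calc 16 * ∑ ℓ ∈ Finset.Icc 1 L, ∑ t ∈ J ℓ, ∑ i ∈ offered p x r G c t, wd ℓ t i
          ≤ 16 * ∑ ℓ ∈ Finset.Icc 1 L, p.α * √(p.K * P) * √(J ℓ).card := by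
            gcongr with ℓ hℓ; exact hstage ℓ hℓ
        _ = 16 * p.α * √(p.K * P) * ∑ ℓ ∈ Finset.Icc 1 L, √((J ℓ).card : ℝ) := by
            rw [← Finset.mul_sum]; ring
        _ ≤ _ := by gcongr
  rw [hsplit]
  linarith

end Regret

/-! ### Measurability of the algorithm -/

section DiscreteMeasurability

variable {Ω β β' : Type*} {m : MeasurableSpace Ω}

/-- A function with countable range whose fibres are measurable. -/
structure DiscMeas (m : MeasurableSpace Ω) (f : Ω → β) : Prop where
  countable : (Set.range f).Countable
  fibre : ∀ b, MeasurableSet[m] {ω | f ω = b}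

lemma DiscMeas.const (b : β) : DiscMeas m fun _ : Ω => b :=
  ⟨(Set.countable_singleton b).mono (by rintro _ ⟨_, rfl⟩; rfl), fun _ => MeasurableSet.const _⟩

lemma DiscMeas.setOf {f : Ω → β} (hf : DiscMeas m f) {q : β → Ω → Prop}
    (hq : ∀ b, MeasurableSet[m] {ω | q b ω}) : MeasurableSet[m] {ω | q (f ω) ω} := by
  have : {ω | q (f ω) ω} = ⋃ b ∈ Set.range f, ({ω | f ω = b} ∩ {ω | q b ω}) := by
    ext ω
    simp only [Set.mem_iUnion, Set.mem_inter_iff, Set.mem_ofPred_eq]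
    exact ⟨fun h => ⟨f ω, ⟨ω, rfl⟩, rfl, h⟩, fun ⟨_, _, h1, h2⟩ => h1 ▸ h2⟩
  rw [this]
  exact MeasurableSet.biUnion hf.countable fun b _ => (hf.fibre b).inter (hq b)

/-- States carry no σ-algebra, and the algorithm feeds random discrete objects into functions that
themselves depend on the features. Splitting over the countably many values handles such
compositions. -/
lemma DiscMeas.bind {f : Ω → β} (hf : DiscMeas m f) {h : β → Ω → β'}
    (hh : ∀ b, DiscMeas m (h b)) : DiscMeas m fun ω => h (f ω) ω := by
  refine ⟨?_, fun b => hf.setOf (q := fun a ω => h a ω = b) fun a => (hh a).fibre b⟩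
  refine (Set.Countable.biUnion hf.countable fun b _ => (hh b).countable).mono ?_
  rintro _ ⟨ω, rfl⟩
  exact Set.mem_biUnion ⟨ω, rfl⟩ ⟨ω, rfl⟩

lemma DiscMeas.comp {f : Ω → β} (hf : DiscMeas m f) (g : β → β') : DiscMeas m fun ω => g (f ω) :=
  hf.bind fun b => .const (g b)

lemma DiscMeas.measurable_bind [MeasurableSpace β'] {f : Ω → β} (hf : DiscMeas m f)
    {h : β → Ω → β'} (hh : ∀ b, Measurable[m] (h b)) : Measurable[m] fun ω => h (f ω) ω :=
  fun s hs => hf.setOf (q := fun b ω => h b ω ∈ s) fun b => hh b hs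

lemma DiscMeas.prop {q : Ω → Prop} (hq : MeasurableSet[m] {ω | q ω}) : DiscMeas m q := by
  refine ⟨Set.to_countable _, fun b => ?_⟩
  by_cases hb : b
  · simpa [hb] using hq
  · simp only [hb, eq_iff_iff, iff_false]
    exact hq.compl

open scoped Classical in
lemma DiscMeas.ite {q : Ω → Prop} (hq : MeasurableSet[m] {ω | q ω}) {f g : Ω → β}
    (hf : DiscMeas m f) (hg : DiscMeas m g) : DiscMeas m fun ω => if q ω then f ω else g ω :=
  (DiscMeas.prop hq).bind (h := fun b ω => if b then f ω else g ω) fun b => by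
    by_cases hb : b <;> simpa [hb]

lemma DiscMeas.finset [Finite β] {f : Ω → Finset β} (hf : ∀ a, MeasurableSet[m] {ω | a ∈ f ω}) :
    DiscMeas m f := by
  refine ⟨Set.to_countable _, fun b => ?_⟩
  have : {ω | f ω = b} = ⋂ a, {ω | a ∈ f ω ↔ a ∈ b} := by
    ext ω
    simp [Finset.ext_iff]
  rw [this]
  refine MeasurableSet.iInter fun a => ?_
  by_cases ha : a ∈ b
  · simpa [ha] using hf a
  · simp only [ha, iff_false]
    exact (hf a).compl

lemma DiscMeas.nat_sInf {A : Ω → Set ℕ} (hA : ∀ k, MeasurableSet[m] {ω | k ∈ A ω}) :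
    DiscMeas m fun ω => sInf (A ω) := by
  refine ⟨Set.to_countable _, fun k => ?_⟩
  have hE : MeasurableSet[m] {ω | ∀ j, j ∉ A ω} := by
    simp only [Set.ofPred_forall]
    exact MeasurableSet.iInter fun j => (hA j).compl
  have : {ω | sInf (A ω) = k} = ({ω | k ∈ A ω} ∩ ⋂ j ∈ Set.Iio k, {ω | j ∈ A ω}ᶜ) ∪
      ({ω | ∀ j, j ∉ A ω} ∩ {_ω : Ω | k = 0}) := by
    ext ω
    simp only [Set.mem_ofPred_eq, Set.mem_union, Set.mem_inter_iff, Set.mem_iInter, Set.mem_compl_iff,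
      Set.mem_Iio]
    constructor
    · rintro rfl
      by_cases h : (A ω).Nonempty
      · exact Or.inl ⟨Nat.sInf_mem h, fun j hj => Nat.notMem_of_lt_sInf hj⟩
      · rw [Set.not_nonempty_iff_eq_empty] at h
        right
        simp [h]
    · rintro (⟨h1, h2⟩ | ⟨h1, h2⟩)
      · refine le_antisymm (Nat.sInf_le h1) ?_
        by_contra hlt
        push Not at hlt
        exact h2 _ hlt (Nat.sInf_mem ⟨k, h1⟩)
      · have : A ω = ∅ := Set.eq_empty_iff_forall_notMem.2 h1
        simp [this, h2]
  rw [this]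
  exact ((hA k).inter (MeasurableSet.biInter (Set.to_countable _) fun j _ => (hA j).compl)).union
    (hE.inter (MeasurableSet.const _))

end DiscreteMeasurability

/-! ### Determinants and inverses of random matrices -/

section MatrixMeasurability

variable {Ω : Type*} {m : MeasurableSpace Ω} {n : Type*} [Fintype n] [DecidableEq n]

lemma measurable_det {M : Ω → Matrix n n ℝ} (hM : ∀ a b, Measurable[m] fun ω => M ω a b) :
    Measurable[m] fun ω => (M ω).det := by
  simp only [Matrix.det_apply]
  refine Finset.measurable_fun_sum _ fun σ _ => ?_
  simp only [Units.smul_def, zsmul_eq_mul]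
  exact (Finset.measurable_fun_prod _ fun i _ => hM _ _).const_mul _

/-- Cramer's rule: the entries are cofactors divided by the determinant, also in the singular case,
where both sides are zero by convention. -/
lemma measurable_matrix_inv {M : Ω → Matrix n n ℝ} (hM : ∀ a b, Measurable[m] fun ω => M ω a b)
    (a b : n) : Measurable[m] fun ω => (M ω)⁻¹ a b := by
  simp only [Matrix.inv_def, Ring.inverse_eq_inv', Matrix.smul_apply, smul_eq_mul,
    Matrix.adjugate_apply]
  refine (measurable_det hM).inv.mul (measurable_det fun i j => ?_)
  by_cases hi : i = b
  · subst hi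
    simp only [Matrix.updateRow_self]
    exact measurable_const
  · simp only [Matrix.updateRow_ne hi]
    exact hM i j

end MatrixMeasurability

/-! ### The algorithm as a function of the contexts, for a fixed response sequence -/

section AlgorithmMeasurability

variable {N d : ℕ} {Ω : Type*} {m : MeasurableSpace Ω} {p : Input N d}
  {x : ℕ → Fin N → Ω → Vec d} {r : ℕ → Fin N → Ω → ℝ} {G : ℕ → Ω → Finset (Fin N)}

lemma measurable_coord {f : Ω → Vec d} (hf : Measurable[m] f) (k : Fin d) :
    Measurable[m] fun ω => (f ω).ofLp k :=
  (EuclideanSpace.proj (𝕜 := ℝ) k).continuous.measurable.comp hf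

lemma measurable_gram (hx : ∀ t i, Measurable[m] (x t i)) (D : Finset ℕ) (S : ℕ → Finset (Fin N))
    (a b : Fin d) : Measurable[m] fun ω => gram D (fun t i => x t i ω) S a b := by
  simp only [gram, Matrix.sum_apply, Matrix.vecMulVec_apply]
  exact Finset.measurable_fun_sum _ fun t _ => Finset.measurable_fun_sum _ fun i _ =>
    (measurable_coord (hx t i) a).mul (measurable_coord (hx t i) b)

lemma measurable_stageWidth (hx : ∀ t i, Measurable[m] (x t i)) (s : State N) (t ℓ : ℕ)
    (i : Fin N) : Measurable[m] fun ω => stageWidth p (fun t i => x t i ω) s t ℓ i := by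
  simp only [stageWidth, weightedNorm, dotProduct, Matrix.mulVec]
  refine (Real.continuous_sqrt.measurable.comp (Finset.measurable_fun_sum _ fun a _ =>
    (measurable_coord (hx t i) a).mul (Finset.measurable_fun_sum _ fun b _ =>
      (measurable_matrix_inv (measurable_gram hx _ _) a b).mul
        (measurable_coord (hx t i) b)))).const_mul _

lemma measurable_stageEst (hest : IsMLE p.est) (hx : ∀ t i, Measurable[m] (x t i))
    (γ : ℕ → Option (Fin N)) (s : State N) (ℓ : ℕ) :
    Measurable[m] fun ω => stageEst p (fun t i => x t i ω) γ s ℓ := by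
  refine (hest.measurable (stageRounds p s ℓ) (fun u => s.S u) (fun u => γ u)).comp
    (g := fun y : stageRounds p s ℓ → Fin N → Vec d => _) ?_
  exact measurable_pi_lambda _ fun u => measurable_pi_lambda _ fun i => hx u i

lemma measurable_choiceProb {θ : Ω → Vec d} (hθ : Measurable[m] θ)
    (hx : ∀ t i, Measurable[m] (x t i)) (t : ℕ) (S : Finset (Fin N)) (a : Option (Fin N)) :
    Measurable[m] fun ω => choiceProb (θ ω) (fun i => x t i ω) S a := by
  have hi : ∀ i, Measurable[m] fun ω => Real.exp (inner ℝ (x t i ω) (θ ω)) := fun i =>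
    Real.measurable_exp.comp ((hx t i).inner hθ)
  have hs : Measurable[m] fun ω => 1 + ∑ j ∈ S, Real.exp (inner ℝ (x t j ω) (θ ω)) :=
    (Finset.measurable_fun_sum _ fun j _ => hi j).const_add _
  rcases a with _ | i
  · simp only [choiceProb, one_div]
    exact hs.inv
  · simp only [choiceProb]
    split_ifs
    · exact (hi i).div hs
    · exact measurable_const

lemma measurable_revenue {θ : Ω → Vec d} (hθ : Measurable[m] θ)
    (hx : ∀ t i, Measurable[m] (x t i)) (hr : ∀ t i, Measurable[m] (r t i)) (t : ℕ)
    (S : Finset (Fin N)) :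
    Measurable[m] fun ω => revenue (θ ω) (fun i => x t i ω) (fun i => r t i ω) S :=
  Finset.measurable_fun_sum _ fun i _ => (hr t i).mul (measurable_choiceProb hθ hx t S _)

lemma discMeas_argmaxSet {A : Ω → Finset (Finset (Fin N))} (hA : DiscMeas m A)
    {f : Ω → Finset (Fin N) → ℝ} (hf : ∀ S, Measurable[m] fun ω => f ω S) :
    DiscMeas m fun ω => argmaxSet (A ω) (f ω) := by
  refine hA.bind (h := fun A ω => argmaxSet A (f ω)) fun A => .finset fun S => ?_
  simp only [argmaxSet, Finset.mem_filter, Set.ofPred_and, Set.ofPred_forall]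
  exact (MeasurableSet.const _).inter (MeasurableSet.iInter fun S' => MeasurableSet.iInter fun _ =>
    measurableSet_le (hf S') (hf S))

variable (hest : IsMLE p.est) (hx : ∀ t i, Measurable[m] (x t i))
  (hr : ∀ t i, Measurable[m] (r t i))

include hest hx hr

lemma discMeas_stageCand (γ : ℕ → Option (Fin N)) (s : State N) (t : ℕ) : ∀ ℓ,
    DiscMeas m fun ω => stageCand p (fun t i => x t i ω) (fun t i => r t i ω) γ s t ℓ
  | 0 => .const _
  | 1 => .const _
  | ℓ + 2 => by
    simp only [stageCand]
    refine (discMeas_stageCand γ s t (ℓ + 1)).bind (h := fun A ω => open scoped Classical in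
      A.filter fun S => ∀ S' ∈ A,
          revenue (stageEst p (fun t i => x t i ω) γ s (ℓ + 1)) (fun i => x t i ω)
            (fun i => r t i ω) S' - (2 : ℝ) ^ (-((ℓ + 1 : ℕ) : ℤ) + 1)
            ≤ revenue (stageEst p (fun t i => x t i ω) γ s (ℓ + 1)) (fun i => x t i ω)
            (fun i => r t i ω) S) fun A => .finset fun S => ?_
    simp only [Finset.mem_filter, Set.ofPred_and, Set.ofPred_forall]
    have h := fun S => measurable_revenue (measurable_stageEst hest hx γ s (ℓ + 1)) hx hr t S
    exact (MeasurableSet.const _).inter (MeasurableSet.iInter fun S' => MeasurableSet.iInter fun _ =>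
      measurableSet_le ((h S').sub_const _) (h S))

lemma measurable_stageMaxWidth (γ : ℕ → Option (Fin N)) (s : State N) (t ℓ : ℕ) :
    Measurable[m] fun ω =>
      stageMaxWidth p (fun t i => x t i ω) (fun t i => r t i ω) γ s t ℓ := by
  refine (discMeas_stageCand hest hx hr γ s t ℓ).measurable_bind
    (h := fun A ω => maxWidth A (stageWidth p (fun t i => x t i ω) s t ℓ)) fun A => ?_
  unfold maxWidth
  split_ifs with hA
  · refine Measurable.const_mul ?_ _
    have := Finset.measurable_sup' (s := A.biUnion id) hA
      (f := fun i ω => stageWidth p (fun t i => x t i ω) s t ℓ i)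
      fun i _ => measurable_stageWidth (p := p) hx s t ℓ i
    convert this using 2 with ω
    simp
  · exact measurable_const

lemma discMeas_stopStage (γ : ℕ → Option (Fin N)) (s : State N) (t : ℕ) :
    DiscMeas m fun ω => stopStage p (fun t i => x t i ω) (fun t i => r t i ω) γ s t := by
  refine DiscMeas.nat_sInf fun k => ?_
  have h := measurable_stageMaxWidth hest hx hr γ s t k
  simp only [stopStages, Set.ofPred_and, Set.ofPred_or]
  exact (MeasurableSet.const _).inter
    ((measurableSet_le h measurable_const).union (measurableSet_lt measurable_const h))

lemma discMeas_roundStage (γ : ℕ → Option (Fin N)) (s : State N) (t : ℕ) :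
    DiscMeas m fun ω => roundStage p (fun t i => x t i ω) (fun t i => r t i ω) γ s t := by
  unfold roundStage
  refine (discMeas_stopStage hest hx hr γ s t).bind (h := fun k ω => open scoped Classical in
    if stageMaxWidth p (fun t i => x t i ω) (fun t i => r t i ω) γ s t k ≤ 1 / √p.T then 0 else k)
    fun k => ?_
  exact .ite (measurableSet_le (measurable_stageMaxWidth hest hx hr γ s t k) measurable_const)
    (.const _) (.const _)

lemma discMeas_roundChoice (γ : ℕ → Option (Fin N)) (s : State N) (t : ℕ) :
    DiscMeas m fun ω => roundChoice p (fun t i => x t i ω) (fun t i => r t i ω) γ s t := by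
  unfold roundChoice
  refine (discMeas_stopStage hest hx hr γ s t).bind (h := fun k ω => open scoped Classical in
    if stageMaxWidth p (fun t i => x t i ω) (fun t i => r t i ω) γ s t k ≤ 1 / √p.T then
      p.tie (argmaxSet (stageCand p (fun t i => x t i ω) (fun t i => r t i ω) γ s t k) fun S =>
        revenue (stageEst p (fun t i => x t i ω) γ s k) (fun i => x t i ω) (fun i => r t i ω) S)
    else p.tie (argmaxSet (stageCand p (fun t i => x t i ω) (fun t i => r t i ω) γ s t k) fun S =>
        ∑ i ∈ S, stageWidth p (fun t i => x t i ω) s t k i))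
    fun k => ?_
  refine .ite (measurableSet_le (measurable_stageMaxWidth hest hx hr γ s t k) measurable_const)
    ?_ ?_
  · exact (discMeas_argmaxSet (discMeas_stageCand hest hx hr γ s t k) fun S =>
      measurable_revenue (measurable_stageEst hest hx γ s k) hx hr t S).comp p.tie
  · exact (discMeas_argmaxSet (discMeas_stageCand hest hx hr γ s t k) fun S =>
      Finset.measurable_fun_sum _ fun i _ => measurable_stageWidth hx s t k i).comp p.tie

variable (hG : ∀ t S, MeasurableSet[m] {ω | G t ω = S})

include hG

lemma discMeas_stateAfter (γ : ℕ → Option (Fin N)) : ∀ t, DiscMeas m fun ω =>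
    stateAfter p (fun t i => x t i ω) (fun t i => r t i ω) (fun t => G t ω) γ t
  | 0 => .const _
  | t + 1 => by
    simp only [stateAfter]
    refine (discMeas_stateAfter γ t).bind (h := fun s ω => step p (fun t i => x t i ω)
      (fun t i => r t i ω) (fun t => G t ω) γ s (t + 1)) fun s => ?_
    by_cases ht : t + 1 ≤ p.T₀
    · simp only [step_of_le _ _ _ _ _ ht]
      have : DiscMeas m (G (t + 1)) := ⟨Set.to_countable _, hG (t + 1)⟩
      exact this.comp fun S => (⟨Function.update s.S (t + 1) S, s.Ψ⟩ : State N)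
    · simp only [step_of_lt _ _ _ _ _ (not_le.1 ht)]
      refine (discMeas_roundStage hest hx hr γ s (t + 1)).bind (h := fun k ω =>
        (⟨Function.update s.S (t + 1) (roundChoice p (fun t i => x t i ω) (fun t i => r t i ω) γ s
          (t + 1)), Function.update s.Ψ k (insert (t + 1) (s.Ψ k))⟩ : State N)) fun k => ?_
      exact (discMeas_roundChoice hest hx hr γ s (t + 1)).comp fun S =>
        (⟨Function.update s.S (t + 1) S, Function.update s.Ψ k (insert (t + 1) (s.Ψ k))⟩ : State N)

lemma discMeas_offered (γ : ℕ → Option (Fin N)) (t : ℕ) : DiscMeas m fun ω =>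
    offered p (fun t i => x t i ω) (fun t i => r t i ω) (fun t => G t ω) γ t :=
  (discMeas_stateAfter hest hx hr hG γ t).comp fun s => s.S t

lemma measurable_pathProb (θs : Vec d) (n : ℕ) (γ : ℕ → Option (Fin N)) : Measurable[m] fun ω =>
    pathProb p θs (fun t i => x t i ω) (fun t i => r t i ω) (fun t => G t ω) n γ :=
  Finset.measurable_fun_prod _ fun t _ => (discMeas_offered hest hx hr hG γ t).measurable_bind
    (h := fun S ω => choiceProb θs (fun i => x t i ω) S (γ t))
    fun S => measurable_choiceProb measurable_const hx t S _

lemma measurable_cumRegret (θs : Vec d) (γ : ℕ → Option (Fin N)) : Measurable[m] fun ω =>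
    cumRegret p θs (fun t i => x t i ω) (fun t i => r t i ω) (fun t => G t ω) γ := by
  have hrev := fun t S => measurable_revenue (measurable_const (a := θs)) hx hr t S
  refine Finset.measurable_fun_sum _ fun t _ => Measurable.sub ?_ ?_
  · have := Finset.measurable_sup' (s := assortments N p.K) (assortments_nonempty N p.K)
      (f := fun S ω => revenue θs (fun i => x t i ω) (fun i => r t i ω) S) fun S _ => hrev t S
    convert this using 2 with ω
    simp [optRevenue]
  · exact (discMeas_offered hest hx hr hG γ t).measurable_bind
      (h := fun S ω => revenue θs (fun i => x t i ω) (fun i => r t i ω) S) (hrev t)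

end AlgorithmMeasurability

/-! ### The law of the responses given the contexts -/

section WidthFails

variable {N d : ℕ} {p : Input N d}

lemma widthFails_congr {x : ℕ → Fin N → Vec d} {r : ℕ → Fin N → ℝ} {G : ℕ → Finset (Fin N)}
    {θs : Vec d} {L : ℕ} {γ γ' : ℕ → Option (Fin N)} (h : AgreeBefore (p.T + 1) γ γ')
    (hw : WidthFails p x r G θs L γ) : WidthFails p x r G θs L γ' := by
  obtain ⟨t, ht, ℓ, hℓ, i, hlt⟩ := hw
  refine ⟨t, ht, ℓ, hℓ, i, ?_⟩
  rw [Finset.mem_Ioc] at ht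
  have hs : stateAfter p x r G γ (t - 1) = stateAfter p x r G γ' (t - 1) :=
    stateAfter_congr fun u h1 h2 => h u h1 (by omega)
  have he : stageEst p x γ (stateAfter p x r G γ (t - 1)) ℓ
      = stageEst p x γ' (stateAfter p x r G γ (t - 1)) ℓ := by
    rw [stageEst, stageEst]
    congr 1
    funext u
    have := lt_of_mem_roundsBefore p x r G γ ht.1 u.2
    exact h u this.1 (by omega)
  rw [he] at hlt
  rwa [← hs]

lemma measurableSet_widthFails {Ω : Type*} {m : MeasurableSpace Ω}
    {x : ℕ → Fin N → Ω → Vec d} {r : ℕ → Fin N → Ω → ℝ} {G : ℕ → Ω → Finset (Fin N)}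
    (hest : IsMLE p.est) (hx : ∀ t i, Measurable[m] (x t i)) (hr : ∀ t i, Measurable[m] (r t i))
    (hG : ∀ t S, MeasurableSet[m] {ω | G t ω = S}) (θs : Vec d) (L : ℕ) (γ : ℕ → Option (Fin N)) :
    MeasurableSet[m] {ω | WidthFails p (fun t i => x t i ω) (fun t i => r t i ω)
      (fun t => G t ω) θs L γ} := by
  have h1 : ∀ t ℓ i, Measurable[m] fun ω => stageWidth p (fun t i => x t i ω)
      (stateAfter p (fun t i => x t i ω) (fun t i => r t i ω) (fun t => G t ω) γ (t - 1)) t ℓ i :=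
    fun t ℓ i => (discMeas_stateAfter hest hx hr hG γ (t - 1)).measurable_bind
      (h := fun s ω => stageWidth p (fun t i => x t i ω) s t ℓ i)
      fun s => measurable_stageWidth hx s t ℓ i
  have h2 : ∀ t ℓ, Measurable[m] fun ω => stageEst p (fun t i => x t i ω) γ
      (stateAfter p (fun t i => x t i ω) (fun t i => r t i ω) (fun t => G t ω) γ (t - 1)) ℓ :=
    fun t ℓ => (discMeas_stateAfter hest hx hr hG γ (t - 1)).measurable_bind
      (h := fun s ω => stageEst p (fun t i => x t i ω) γ s ℓ)
      fun s => measurable_stageEst hest hx γ s ℓ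
  have h3 : ∀ t ℓ i, MeasurableSet[m] {ω | stageWidth p (fun t i => x t i ω)
      (stateAfter p (fun t i => x t i ω) (fun t i => r t i ω) (fun t => G t ω) γ (t - 1)) t ℓ i <
      |inner ℝ (x t i ω) (stageEst p (fun t i => x t i ω) γ (stateAfter p (fun t i => x t i ω)
        (fun t i => r t i ω) (fun t => G t ω) γ (t - 1)) ℓ - θs)|} := fun t ℓ i =>
    measurableSet_lt (h1 t ℓ i)
      (continuous_abs.measurable.comp ((hx t i).inner ((h2 t ℓ).sub_const θs)))
  have : {ω | WidthFails p (fun t i => x t i ω) (fun t i => r t i ω) (fun t => G t ω) θs L γ}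
      = ⋃ t ∈ Finset.Ioc p.T₀ p.T, ⋃ ℓ ∈ Finset.Icc 1 L, ⋃ i,
        {ω | stageWidth p (fun t i => x t i ω)
      (stateAfter p (fun t i => x t i ω) (fun t i => r t i ω) (fun t => G t ω) γ (t - 1)) t ℓ i <
      |inner ℝ (x t i ω) (stageEst p (fun t i => x t i ω) γ (stateAfter p (fun t i => x t i ω)
        (fun t i => r t i ω) (fun t => G t ω) γ (t - 1)) ℓ - θs)|} := by
    ext ω
    simp only [WidthFails, Set.mem_ofPred_eq, Set.mem_iUnion, exists_prop]
  rw [this]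
  exact Finset.measurableSet_biUnion _ fun t _ => Finset.measurableSet_biUnion _ fun ℓ _ =>
    MeasurableSet.iUnion fun i => h3 t ℓ i

end WidthFails

/-! ### Integration of response probabilities over the contexts -/

section ResponseLaw

variable {N d : ℕ} {Ω : Type*} {x : ℕ → Fin N → Ω → Vec d} {r : ℕ → Fin N → Ω → ℝ}
  {G : ℕ → Ω → Finset (Fin N)} {c : ℕ → Ω → Option (Fin N)}

lemma measurable_feature_contextSigma (t : ℕ) (i : Fin N) :
    Measurable[contextSigma x r] (x t i) :=
  (comap_measurable (x t i)).mono ((le_iSup₂_of_le (f := fun t i =>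
    MeasurableSpace.comap (x t i) inferInstance) t i le_rfl).trans le_sup_left) le_rfl

lemma measurable_revenue_contextSigma (t : ℕ) (i : Fin N) :
    Measurable[contextSigma x r] (r t i) :=
  (comap_measurable (r t i)).mono ((le_iSup₂_of_le (f := fun t i =>
    MeasurableSpace.comap (r t i) inferInstance) t i le_rfl).trans le_sup_right) le_rfl

lemma measurableSet_init_initSigma (t : ℕ) (S : Finset (Fin N)) :
    MeasurableSet[initSigma G] {ω | G t ω = S} :=
  le_iSup (fun t => MeasurableSpace.comap (G t) ⊤) t _ ⟨{S}, trivial, rfl⟩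

lemma contextSigma_le [mΩ : MeasurableSpace Ω] (hx : ∀ t i, Measurable (x t i))
    (hr : ∀ t i, Measurable (r t i)) : contextSigma x r ≤ mΩ :=
  sup_le (iSup₂_le fun t i => (hx t i).comap_le) (iSup₂_le fun t i => (hr t i).comap_le)

lemma comap_top_le_of_fibre {β : Type*} [Countable β] {m : MeasurableSpace Ω} {f : Ω → β}
    (hf : ∀ b, MeasurableSet[m] {ω | f ω = b}) : MeasurableSpace.comap f ⊤ ≤ m := by
  rintro _ ⟨s, -, rfl⟩
  have : f ⁻¹' s = ⋃ b ∈ s, {ω | f ω = b} := by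
    ext ω
    simp
  rw [this]
  exact MeasurableSet.biUnion (Set.to_countable _) fun b _ => hf b

lemma initSigma_le [mΩ : MeasurableSpace Ω] (hG : ∀ t S, MeasurableSet {ω | G t ω = S}) :
    initSigma G ≤ mΩ := iSup_le fun t => comap_top_le_of_fibre (hG t)

lemma history_le [mΩ : MeasurableSpace Ω] (hx : ∀ t i, Measurable (x t i))
    (hr : ∀ t i, Measurable (r t i)) (hG : ∀ t S, MeasurableSet {ω | G t ω = S})
    (hc : ∀ t a, MeasurableSet {ω | c t ω = a}) (t : ℕ) : history x r G c t ≤ mΩ :=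
  sup_le (sup_le (contextSigma_le hx hr) (initSigma_le hG))
    (iSup₂_le fun s _ => comap_top_le_of_fibre (hc s))

lemma measurableSet_response_history {s t : ℕ} (hs : s ∈ Finset.Ico 1 t) (a : Option (Fin N)) :
    MeasurableSet[history x r G c t] {ω | c s ω = a} :=
  le_trans (le_iSup₂_of_le (f := fun s (_ : s ∈ Finset.Ico 1 t) =>
    MeasurableSpace.comap (c s) ⊤) s hs le_rfl) le_sup_right _ ⟨{a}, trivial, rfl⟩

/-- The event that the responses in the rounds `1, …, n` are `γ`. -/
def pathEvent (c : ℕ → Ω → Option (Fin N)) (n : ℕ) (γ : ℕ → Option (Fin N)) : Set Ω :=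
  {ω | ∀ t ∈ Finset.Icc 1 n, c t ω = γ t}

lemma measurableSet_pathEvent_history (n : ℕ) (γ : ℕ → Option (Fin N)) :
    MeasurableSet[history x r G c (n + 1)] (pathEvent c n γ) := by
  have : pathEvent c n γ = ⋂ t ∈ Finset.Icc 1 n, {ω | c t ω = γ t} := by
    ext ω
    simp [pathEvent]
  rw [this]
  refine Finset.measurableSet_biInter _ fun t ht => measurableSet_response_history ?_ _
  rw [Finset.mem_Icc] at ht
  rw [Finset.mem_Ico]
  omega

lemma pathEvent_succ (n : ℕ) (γ : ℕ → Option (Fin N)) :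
    pathEvent c (n + 1) γ = pathEvent c n γ ∩ {ω | c (n + 1) ω = γ (n + 1)} := by
  ext ω
  simp only [pathEvent, Set.mem_inter_iff, Set.mem_ofPred_eq, Finset.mem_Icc]
  constructor
  · exact fun h => ⟨fun t ht => h t ⟨ht.1, by omega⟩, h _ ⟨by omega, le_rfl⟩⟩
  · rintro ⟨h1, h2⟩ t ht
    by_cases h : t = n + 1
    · rw [h, h2]
    · exact h1 t ⟨ht.1, by omega⟩

lemma choiceProb_le_one (θ : Vec d) (x : Fin N → Vec d) (S : Finset (Fin N))
    (a : Option (Fin N)) : choiceProb θ x S a ≤ 1 := by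
  rw [← sum_choiceProb θ x S]
  exact Finset.single_le_sum (fun b _ => choiceProb_nonneg θ x S b) (Finset.mem_univ a)

variable [mΩ : MeasurableSpace Ω] {P : Measure Ω} [IsProbabilityMeasure P] {p : Input N d}
  {θs : Vec d}

lemma integrable_of_mem_Icc {f : Ω → ℝ} (hf : Measurable f) (h : ∀ ω, f ω ∈ Set.Icc 0 1) :
    Integrable f P :=
  Integrable.of_bound hf.aestronglyMeasurable 1 (Filter.Eventually.of_forall fun ω => by
    rw [Real.norm_of_nonneg (h ω).1]
    exact (h ω).2)

/-- The responses in the rounds `1, …, n` are distributed according to `pathProb`, given the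
features, the revenues and the initial assortments. -/
theorem integral_pathEvent (hest : IsMLE p.est) (hx : ∀ t i, Measurable (x t i))
    (hr : ∀ t i, Measurable (r t i)) (hG : ∀ t S, MeasurableSet {ω | G t ω = S})
    (hc : MNLResponses P p θs x r G c) (γ : ℕ → Option (Fin N)) :
    ∀ n ≤ p.T, ∀ g : Ω → ℝ, Measurable[contextSigma x r ⊔ initSigma G] g →
      (∀ ω, g ω ∈ Set.Icc 0 1) → ∫ ω, (pathEvent c n γ).indicator g ω ∂P =
        ∫ ω, pathProb p θs (fun t i => x t i ω) (fun t i => r t i ω) (fun t => G t ω) n γ * g ω ∂P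
  | 0, _, g, _, _ => by simp [pathEvent, pathProb]
  | n + 1, hn, g, hg, hg1 => by
    set q : Ω → ℝ := fun ω => stepProb p θs (fun t i => x t i ω) (fun t i => r t i ω)
      (fun t => G t ω) (n + 1) γ (γ (n + 1)) with hq
    have hq1 : ∀ ω, q ω ∈ Set.Icc 0 1 := fun ω => ⟨choiceProb_nonneg _ _ _ _, choiceProb_le_one _ _ _ _⟩
    have hqm : Measurable[contextSigma x r ⊔ initSigma G] q := by
      have hx' : ∀ t i, Measurable[contextSigma x r ⊔ initSigma G] (x t i) := fun t i =>
        (measurable_feature_contextSigma t i).mono le_sup_left le_rfl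
      have hr' : ∀ t i, Measurable[contextSigma x r ⊔ initSigma G] (r t i) := fun t i =>
        (measurable_revenue_contextSigma t i).mono le_sup_left le_rfl
      have hG' : ∀ t S, MeasurableSet[contextSigma x r ⊔ initSigma G] {ω | G t ω = S} := fun t S =>
        (le_sup_right : initSigma G ≤ contextSigma x r ⊔ initSigma G) _
          (measurableSet_init_initSigma t S)
      exact (discMeas_offered hest hx' hr' hG' γ (n + 1)).measurable_bind
        (h := fun S ω => choiceProb θs (fun i => x (n + 1) i ω) S (γ (n + 1)))
        fun S => measurable_choiceProb measurable_const hx' (n + 1) S _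
    have hH := history_le (c := c) hx hr hG hc.measurable (n + 1)
    set f : Ω → ℝ := (pathEvent c n γ).indicator g with hf
    have hfm : Measurable[history x r G c (n + 1)] f :=
      (hg.mono le_sup_left le_rfl).indicator (measurableSet_pathEvent_history n γ)
    have hf1 : ∀ ω, f ω ∈ Set.Icc 0 1 := fun ω => by
      by_cases h : ω ∈ pathEvent c n γ
      · rw [hf, Set.indicator_of_mem h]; exact hg1 ω
      · rw [hf, Set.indicator_of_notMem h]; simp
    set e : Ω → ℝ := {ω | c (n + 1) ω = γ (n + 1)}.indicator fun _ => (1 : ℝ) with he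
    have hem : Measurable e := measurable_const.indicator (hc.measurable _ _)
    have he1 : ∀ ω, e ω ∈ Set.Icc 0 1 := fun ω => by
      rw [he, Set.indicator_apply]
      split_ifs <;> simp
    have h1 : (pathEvent c (n + 1) γ).indicator g = f * e := by
      funext ω
      rw [pathEvent_succ, Pi.mul_apply, hf, he, ← Set.inter_indicator_mul]
      simp
    -- On the path event the conditional probability of the next response equals `q`, since
    -- `offered` is nonanticipating and may be evaluated at the deterministic sequence `γ`. As `q`
    -- depends on the contexts only, it can be absorbed into the test function; this is why the
    -- induction carries `g`.
    have h2 : P[f * e | history x r G c (n + 1)] =ᵐ[P] fun ω => (pathEvent c n γ).indicator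
        (fun ω => q ω * g ω) ω := by
      have h3 := condExp_stronglyMeasurable_mul_of_bound hH hfm.stronglyMeasurable
        (integrable_of_mem_Icc hem he1 : Integrable e P) 1 (Filter.Eventually.of_forall fun ω => by
          rw [Real.norm_of_nonneg (hf1 ω).1]
          exact (hf1 ω).2)
      have h4 := hc.cond_law (n + 1) (by rw [Finset.mem_Icc]; omega) (γ (n + 1))
      filter_upwards [h3, h4] with ω h3 h4
      rw [h3, Pi.mul_apply, h4]
      by_cases h : ω ∈ pathEvent c n γ
      · rw [hf, Set.indicator_of_mem h, Set.indicator_of_mem h, mul_comm, hq]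
        simp only [stepProb]
        rw [offered_congr (c' := γ)]
        intro u hu1 hu2
        exact h u (by rw [Finset.mem_Icc]; omega)
      · rw [hf, Set.indicator_of_notMem h, Set.indicator_of_notMem h, zero_mul]
    rw [h1, ← integral_condExp hH, integral_congr_ae h2,
      integral_pathEvent hest hx hr hG hc γ n (by omega) (fun ω => q ω * g ω) (hqm.mul hg)
        fun ω => ⟨mul_nonneg (hq1 ω).1 (hg1 ω).1, mul_le_one₀ (hq1 ω).2 (hg1 ω).1 (hg1 ω).2⟩]
    refine integral_congr_ae (Filter.Eventually.of_forall fun ω => ?_)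
    simp only [pathProb]
    rw [Finset.prod_Icc_succ_top (by omega)]
    ring

/-- The response sequence with the rounds outside `{1, …, n}` reset. -/
def truncate (n : ℕ) (γ : ℕ → Option (Fin N)) : ℕ → Option (Fin N) :=
  fun t => if t ∈ Finset.Icc 1 n then γ t else none

lemma truncate_mem_seqs (n : ℕ) (γ : ℕ → Option (Fin N)) : truncate n γ ∈ seqs none n :=
  mem_seqs.2 fun _ ht => if_neg ht

lemma agreeBefore_truncate (n : ℕ) (γ : ℕ → Option (Fin N)) :
    AgreeBefore (n + 1) γ (truncate n γ) :=
  fun t h1 h2 => (if_pos (Finset.mem_Icc.2 ⟨h1, by omega⟩)).symm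

omit mΩ in
lemma truncate_eq_iff {n : ℕ} {γ : ℕ → Option (Fin N)} (hγ : γ ∈ seqs none n) (ω : Ω) :
    truncate n (fun t => c t ω) = γ ↔ ω ∈ pathEvent c n γ := by
  constructor
  · rintro rfl t ht
    exact (if_pos ht).symm
  · intro h
    funext t
    by_cases ht : t ∈ Finset.Icc 1 n
    · exact (if_pos ht).trans (h t ht)
    · exact (if_neg ht).trans (mem_seqs.1 hγ t ht).symm

lemma discMeas_truncate (hc : ∀ t a, MeasurableSet {ω | c t ω = a}) (n : ℕ) :
    DiscMeas mΩ fun ω => truncate n fun t => c t ω := by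
  refine ⟨(Finset.countable_toSet (seqs none n)).mono ?_, fun γ => ?_⟩
  · rintro _ ⟨ω, rfl⟩
    exact truncate_mem_seqs n _
  · by_cases hγ : γ ∈ seqs none n
    · simp only [truncate_eq_iff hγ]
      have : {ω | ω ∈ pathEvent c n γ} = ⋂ t ∈ Finset.Icc 1 n, {ω | c t ω = γ t} := by
        ext ω
        simp [pathEvent]
      rw [this]
      exact Finset.measurableSet_biInter _ fun t _ => hc t (γ t)
    · convert MeasurableSet.empty (α := Ω)
      refine Set.eq_empty_iff_forall_notMem.2 fun ω h => hγ ?_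
      rw [← show _ = γ from h]
      exact truncate_mem_seqs n _

/-- A bound for the conditional probability of an event about the responses, which holds for all
contexts in `A`, is a bound for its probability within `A`. -/
theorem measureReal_inter_le_of_pathMeas_le (hest : IsMLE p.est) (hx : ∀ t i, Measurable (x t i))
    (hr : ∀ t i, Measurable (r t i)) (hG : ∀ t S, MeasurableSet {ω | G t ω = S})
    (hc : MNLResponses P p θs x r G c) {A : Set Ω}
    (hA : MeasurableSet[contextSigma x r ⊔ initSigma G] A)
    {B : Ω → (ℕ → Option (Fin N)) → Prop}
    (hB : ∀ γ, MeasurableSet[contextSigma x r ⊔ initSigma G] {ω | B ω γ})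
    (hcongr : ∀ ω γ γ', AgreeBefore (p.T + 1) γ γ' → B ω γ → B ω γ') {δ : ℝ} (hδ : 0 ≤ δ)
    (h : ∀ᵐ ω ∂P, ω ∈ A → pathMeas p (fun t i => x t i ω) (fun t i => r t i ω)
      (fun t => G t ω) θs (B ω) ≤ δ) :
    P.real {ω | ω ∈ A ∧ B ω fun t => c t ω} ≤ δ := by
  classical
  have hle : contextSigma x r ⊔ initSigma G ≤ mΩ := sup_le (contextSigma_le hx hr) (initSigma_le hG)
  set g : (ℕ → Option (Fin N)) → Ω → ℝ := fun γ => (A ∩ {ω | B ω γ}).indicator 1 with hg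
  have hgm : ∀ γ, Measurable[contextSigma x r ⊔ initSigma G] (g γ) := fun γ =>
    measurable_const.indicator (hA.inter (hB γ))
  have hg1 : ∀ γ ω, g γ ω ∈ Set.Icc (0 : ℝ) 1 := fun γ ω => by
    rw [hg]
    simp only [Set.indicator_apply]
    split_ifs <;> simp
  -- Responses outside the rounds `1, …, T` do not matter for `B`, so finitely many path events
  -- cover the event.
  have hsub : {ω | ω ∈ A ∧ B ω fun t => c t ω} ⊆ ⋃ γ ∈ seqs none p.T,
      (pathEvent c p.T γ ∩ (A ∩ {ω | B ω γ})) := by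
    rintro ω ⟨h1, h2⟩
    refine Set.mem_biUnion (truncate_mem_seqs p.T fun t => c t ω)
      ⟨(truncate_eq_iff (truncate_mem_seqs _ _) ω).1 rfl, h1, ?_⟩
    exact hcongr _ _ _ (agreeBefore_truncate _ _) h2
  have hpm : ∀ γ, MeasurableSet (pathEvent c p.T γ) := fun γ =>
    history_le hx hr hG hc.measurable _ _
      (measurableSet_pathEvent_history (x := x) (r := r) (G := G) p.T γ)
  have hW : ∀ γ ω, pathProb p θs (fun t i => x t i ω) (fun t i => r t i ω) (fun t => G t ω)
      p.T γ ≤ 1 := fun γ ω =>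
    Finset.prod_le_one (fun _ _ => stepProb_nonneg _ _ _ _ _ _ _ _)
      fun _ _ => choiceProb_le_one _ _ _ _
  have hint : ∀ γ, Integrable (fun ω => pathProb p θs (fun t i => x t i ω) (fun t i => r t i ω)
      (fun t => G t ω) p.T γ * g γ ω) P := fun γ =>
    integrable_of_mem_Icc ((measurable_pathProb hest hx hr hG θs p.T γ).mul
      ((hgm γ).mono hle le_rfl)) fun ω =>
      ⟨mul_nonneg (pathProb_nonneg _ _ _ _ _ _ _) (hg1 γ ω).1,
        mul_le_one₀ (hW γ ω) (hg1 γ ω).1 (hg1 γ ω).2⟩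
  calc P.real {ω | ω ∈ A ∧ B ω fun t => c t ω}
      ≤ P.real (⋃ γ ∈ seqs none p.T, (pathEvent c p.T γ ∩ (A ∩ {ω | B ω γ}))) :=
        measureReal_mono hsub (measure_ne_top _ _)
    _ ≤ ∑ γ ∈ seqs none p.T, P.real (pathEvent c p.T γ ∩ (A ∩ {ω | B ω γ})) :=
        measureReal_biUnion_finset_le _ _
    _ = ∑ γ ∈ seqs none p.T, ∫ ω, (pathEvent c p.T γ).indicator (g γ) ω ∂P := by
        refine Finset.sum_congr rfl fun γ _ => ?_
        rw [← integral_indicator_one ((hpm γ).inter (hle _ (hA.inter (hB γ))))]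
        simp only [hg, Set.indicator_indicator]
    _ = ∑ γ ∈ seqs none p.T, ∫ ω, pathProb p θs (fun t i => x t i ω) (fun t i => r t i ω)
          (fun t => G t ω) p.T γ * g γ ω ∂P :=
        Finset.sum_congr rfl fun γ _ =>
          integral_pathEvent hest hx hr hG hc γ p.T le_rfl (g γ) (hgm γ) (hg1 γ)
    _ = ∫ ω, ∑ γ ∈ seqs none p.T, pathProb p θs (fun t i => x t i ω) (fun t i => r t i ω)
          (fun t => G t ω) p.T γ * g γ ω ∂P := by
        rw [integral_finsetSum _ fun γ _ => hint γ]
    _ ≤ ∫ _ω, δ ∂P := by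
        refine integral_mono_ae (integrable_finsetSum _ fun γ _ => hint γ)
          (integrable_const _) ?_
        filter_upwards [h] with ω hω
        by_cases hωA : ω ∈ A
        · refine (le_of_eq ?_).trans (hω hωA)
          refine Finset.sum_congr rfl fun γ _ => ?_
          congr 1
          simp [hg, Set.indicator_apply, hωA]
        · refine (le_of_eq ?_).trans hδ
          exact Finset.sum_eq_zero fun γ _ => by simp [hg, hωA]
    _ = δ := by simp

/-- The regret is a random variable. -/
lemma measurable_regret (hest : IsMLE p.est) (hx : ∀ t i, Measurable (x t i))
    (hr : ∀ t i, Measurable (r t i)) (hG : ∀ t S, MeasurableSet {ω | G t ω = S})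
    (hc : ∀ t a, MeasurableSet {ω | c t ω = a}) : Measurable (regret p θs x r G c) := by
  -- The regret involves finitely many responses, so the response sequence may be truncated and then
  -- takes finitely many values.
  have h : regret p θs x r G c = fun ω => cumRegret p θs (fun t i => x t i ω)
      (fun t i => r t i ω) (fun t => G t ω) (truncate p.T fun t => c t ω) := by
    funext ω
    rw [regret, cumRegret, cumRegret]
    refine Finset.sum_congr rfl fun t ht => ?_
    rw [Finset.mem_Icc] at ht
    rw [offered_congr (c' := truncate p.T fun t => c t ω)]
    exact fun u h1 h2 => agreeBefore_truncate p.T (fun t => c t ω) u h1 (by omega)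
  rw [h]
  exact (discMeas_truncate hc p.T).measurable_bind
    (h := fun γ ω => cumRegret p θs (fun t i => x t i ω) (fun t i => r t i ω) (fun t => G t ω) γ)
    fun γ => measurable_cumRegret hest hx hr hG θs γ

end ResponseLaw

/-! ### Conditioning of the initial Gram matrix -/

section Moments

variable {N d : ℕ}

/-- Entries of the second moment matrix. -/
def secMoment (px : Measure (Vec d)) (a b : Fin d) : ℝ := ∫ z, z a * z b ∂px

/-- Deviation of an entry of the Gram matrix of the rounds `1, …, n` from its mean. -/
def gramDev (px : Measure (Vec d)) (x : ℕ → Fin N → Vec d) (S : ℕ → Finset (Fin N)) (n : ℕ)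
    (a b : Fin d) : ℝ :=
  ∑ t ∈ Finset.Icc 1 n, ∑ i ∈ S t, (x t i a * x t i b - secMoment px a b)

lemma gramDev_congr {px : Measure (Vec d)} {x : ℕ → Fin N → Vec d} {S S' : ℕ → Finset (Fin N)}
    {n : ℕ} (h : ∀ t ∈ Finset.Icc 1 n, S t = S' t) (a b : Fin d) :
    gramDev px x S n a b = gramDev px x S' n a b :=
  Finset.sum_congr rfl fun t ht => by rw [h t ht]

lemma abs_coord_le (v : Vec d) (a : Fin d) : |v a| ≤ ‖v‖ := by
  simpa using PiLp.norm_apply_le v a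

/-- If the entries of the Gram matrix are close to their means, it is well-conditioned. -/
lemma gramForm_ge_of_gramDev {px : Measure (Vec d)} {x : ℕ → Fin N → Vec d}
    {S : ℕ → Finset (Fin N)} {n K : ℕ} {σ₀ ε : ℝ} (hK : ∀ t, (S t).card = K)
    (hm : ((Matrix.of fun a b : Fin d => ∫ z, z a * z b ∂px)
      - σ₀ • (1 : Matrix (Fin d) (Fin d) ℝ)).PosSemidef)
    (hε : ∀ a b, |gramDev px x S n a b| ≤ ε) (v : Vec d) :
    (K * n * σ₀ - d * ε) * ‖v‖ ^ 2 ≤ gramForm (Finset.Icc 1 n) x S v := by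
  have h1 : σ₀ * ‖v‖ ^ 2 ≤ ∑ a, ∑ b, v a * v b * secMoment px a b := by
    have h := hm.dotProduct_mulVec_nonneg v.ofLp
    rw [Matrix.sub_mulVec, Matrix.smul_mulVec, Matrix.one_mulVec, dotProduct_sub,
      dotProduct_smul, sub_nonneg] at h
    rw [EuclideanSpace.real_norm_sq_eq]
    refine le_trans (le_of_eq ?_) (h.trans (le_of_eq ?_))
    · simp [dotProduct, sq]
    · simp only [dotProduct, Matrix.mulVec, Matrix.of_apply, star_trivial, Finset.mul_sum]
      refine Finset.sum_congr rfl fun a _ => Finset.sum_congr rfl fun b _ => ?_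
      rw [secMoment]
      ring
  have h2 : gramForm (Finset.Icc 1 n) x S v
      = ∑ a, ∑ b, v a * v b * (gramDev px x S n a b + K * n * secMoment px a b) := by
    have h3 : ∀ a b, gramDev px x S n a b + K * n * secMoment px a b
        = ∑ t ∈ Finset.Icc 1 n, ∑ i ∈ S t, x t i a * x t i b := by
      intro a b
      simp only [gramDev, Finset.sum_sub_distrib, Finset.sum_const, hK, nsmul_eq_mul,
        Nat.card_Icc]
      rw [Nat.add_sub_cancel]
      ring
    have h10 : ∀ t i, inner ℝ (x t i) v ^ 2
        = ∑ a, ∑ b, v a * v b * (x t i a * x t i b) := by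
      intro t i
      rw [inner_eq_dotProduct, dotProduct, sq, Finset.sum_mul_sum]
      exact Finset.sum_congr rfl fun a _ => Finset.sum_congr rfl fun b _ => by ring
    simp only [h3, gramForm, h10, Finset.mul_sum]
    calc _ = ∑ t ∈ Finset.Icc 1 n, ∑ a, ∑ b, ∑ i ∈ S t, v a * v b * (x t i a * x t i b) :=
          Finset.sum_congr rfl fun t _ => by
            rw [Finset.sum_comm]
            exact Finset.sum_congr rfl fun a _ => Finset.sum_comm
      _ = _ := by
          rw [Finset.sum_comm]
          exact Finset.sum_congr rfl fun a _ => Finset.sum_comm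
  -- An entrywise error `ε` perturbs the quadratic form by at most `ε (∑ |v a|)² ≤ d ε ‖v‖²`. The
  -- factor `d` is affordable because later `d ≤ 1 / σ₀`.
  have h4 : -(d * ε * ‖v‖ ^ 2) ≤ ∑ a, ∑ b, v a * v b * gramDev px x S n a b := by
    have h5 : |∑ a, ∑ b, v a * v b * gramDev px x S n a b| ≤ ∑ a, ∑ b, |v a| * |v b| * ε := by
      refine (Finset.abs_sum_le_sum_abs _ _).trans (Finset.sum_le_sum fun a _ =>
        (Finset.abs_sum_le_sum_abs _ _).trans (Finset.sum_le_sum fun b _ => ?_))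
      rw [abs_mul, abs_mul]
      exact mul_le_mul_of_nonneg_left (hε a b) (by positivity)
    have h6 : ∑ a, ∑ b, |v a| * |v b| * ε = (∑ a, |v a|) ^ 2 * ε := by
      rw [sq, Finset.sum_mul_sum, Finset.sum_mul]
      exact Finset.sum_congr rfl fun a _ => (Finset.sum_mul _ _ _).symm
    have h7 : (∑ a, |v a|) ^ 2 ≤ d * ‖v‖ ^ 2 := by
      rw [EuclideanSpace.real_norm_sq_eq]
      simpa using sq_sum_le_card_mul_sum_sq (s := (Finset.univ : Finset (Fin d)))
        (f := fun a => |v a|)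
    rcases isEmpty_or_nonempty (Fin d) with hd | ⟨⟨a⟩⟩
    · have : d = 0 := by
        by_contra h
        exact hd.false ⟨0, Nat.pos_of_ne_zero h⟩
      simp [this]
    have hε0 : 0 ≤ ε := (abs_nonneg _).trans (hε a a)
    have := (abs_le.1 h5).1
    rw [h6] at this
    nlinarith [mul_le_mul_of_nonneg_right h7 hε0]
  have h8 : gramForm (Finset.Icc 1 n) x S v = ∑ a, ∑ b, v a * v b * gramDev px x S n a b
      + K * n * ∑ a, ∑ b, v a * v b * secMoment px a b := by
    rw [h2, Finset.mul_sum, ← Finset.sum_add_distrib]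
    refine Finset.sum_congr rfl fun a _ => ?_
    rw [Finset.mul_sum, ← Finset.sum_add_distrib]
    exact Finset.sum_congr rfl fun b _ => by ring
  have h9 : (K * n : ℝ) * (σ₀ * ‖v‖ ^ 2)
      ≤ K * n * ∑ a, ∑ b, v a * v b * secMoment px a b :=
    mul_le_mul_of_nonneg_left h1 (by positivity)
  rw [h8]
  linarith

variable {Ω : Type*} [mΩ : MeasurableSpace Ω] {P : Measure Ω} [IsProbabilityMeasure P]
  {px : Measure (Vec d)} {σ₀ : ℝ} {x : ℕ → Fin N → Ω → Vec d} {r : ℕ → Fin N → Ω → ℝ}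
  {G : ℕ → Ω → Finset (Fin N)}

omit [IsProbabilityMeasure P] in
lemma IIDContexts.norm_feature_le_one (hx : IIDContexts P px σ₀ x) :
    ∀ᵐ ω ∂P, ∀ t i, ‖x t i ω‖ ≤ 1 := by
  refine ae_all_iff.2 fun t => ae_all_iff.2 fun i => ?_
  have := hx.norm_le_one
  rw [← hx.law t i] at this
  exact ae_of_ae_map (hx.measurable t i).aemeasurable this

lemma IIDContexts.isProbabilityMeasure (hx : IIDContexts P px σ₀ x) (hN : 1 ≤ N) :
    IsProbabilityMeasure px := by
  rw [← hx.law 0 ⟨0, hN⟩]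
  exact Measure.isProbabilityMeasure_map (hx.measurable _ _).aemeasurable

lemma measurable_coord_mul (a b : Fin d) : Measurable fun z : Vec d => z a * z b :=
  (measurable_coord measurable_id a).mul (measurable_coord measurable_id b)

/-- The second moment of a distribution on the unit ball has trace at most one. -/
lemma IIDContexts.dim_mul_le_one (hx : IIDContexts P px σ₀ x) (hN : 1 ≤ N) : d * σ₀ ≤ 1 := by
  have := hx.isProbabilityMeasure hN
  have h1 : ∀ a : Fin d, σ₀ ≤ ∫ z, z a * z a ∂px := fun a => by
    have := hx.secondMoment.diag_nonneg (i := a)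
    simp only [Matrix.sub_apply, Matrix.of_apply, Matrix.smul_apply, Matrix.one_apply_eq,
      smul_eq_mul, mul_one] at this
    linarith
  have hi : ∀ a : Fin d, Integrable (fun z : Vec d => z a * z a) px := fun a =>
    Integrable.of_bound (measurable_coord_mul a a).aestronglyMeasurable 1 (by
      filter_upwards [hx.norm_le_one] with z hz
      have := abs_coord_le z a
      rw [Real.norm_eq_abs, abs_mul]
      nlinarith [abs_nonneg (z a)])
  calc d * σ₀ = ∑ _a : Fin d, σ₀ := by simp
    _ ≤ ∑ a, ∫ z, z a * z a ∂px := Finset.sum_le_sum fun a _ => h1 a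
    _ = ∫ z, ∑ a, z a * z a ∂px := by rw [integral_finsetSum _ fun a _ => hi a]
    _ ≤ ∫ _z, 1 ∂px := by
        refine integral_mono_ae (integrable_finsetSum _ fun a _ => hi a) (integrable_const _) ?_
        filter_upwards [hx.norm_le_one] with z hz
        have h2 := EuclideanSpace.real_norm_sq_eq z
        have h3 : ‖z‖ ^ 2 ≤ 1 := by nlinarith [norm_nonneg z]
        rw [h2] at h3
        simpa only [sq] using h3
    _ = 1 := by simp

/-- Deviation of an entry of the Gram matrix for fixed assortments. -/
lemma measureReal_gramDev_ge_le (hx : IIDContexts P px σ₀ x) (S : ℕ → Finset (Fin N)) {n K : ℕ}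
    (hK : ∀ t ∈ Finset.Icc 1 n, (S t).card = K) {ε : ℝ} (hε : 0 ≤ ε) (a b : Fin d) :
    P.real {ω | ε ≤ |gramDev px (fun t i => x t i ω) S n a b|}
      ≤ 2 * Real.exp (-ε ^ 2 / (2 * (K * n))) := by
  set X : ℕ × Fin N → Ω → ℝ := fun q ω => x q.1 q.2 ω a * x q.1 q.2 ω b - secMoment px a b with hX
  set F : Finset (ℕ × Fin N) := (Finset.Icc 1 n ×ˢ Finset.univ).filter fun q => q.2 ∈ S q.1 with hF
  have hsum : ∀ f : ℕ × Fin N → ℝ, ∑ q ∈ F, f q = ∑ t ∈ Finset.Icc 1 n, ∑ i ∈ S t, f (t, i) := by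
    intro f
    rw [hF, Finset.sum_filter, Finset.sum_product]
    refine Finset.sum_congr rfl fun t _ => ?_
    simp [Finset.sum_ite_mem]
  have hi : iIndepFun X P :=
    hx.indep.comp (fun _ z => z a * z b - secMoment px a b)
      fun _ => (measurable_coord_mul a b).sub_const _
  have hsg : ∀ q, HasSubgaussianMGF (X q) 1 P := by
    intro q
    have hm : Measurable fun ω => x q.1 q.2 ω a * x q.1 q.2 ω b :=
      (measurable_coord_mul a b).comp (hx.measurable q.1 q.2)
    -- Products of two coordinates of a vector in the unit ball lie in `[-1, 1]`, which gives
    -- variance proxy `1`.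
    have h := hasSubgaussianMGF_of_mem_Icc (μ := P) (a := -1) (b := 1) hm.aemeasurable (by
      filter_upwards [hx.norm_feature_le_one] with ω hω
      have h1 := (abs_coord_le (x q.1 q.2 ω) a).trans (hω _ _)
      have h2 := (abs_coord_le (x q.1 q.2 ω) b).trans (hω _ _)
      rw [Set.mem_Icc, ← abs_le, abs_mul]
      exact mul_le_one₀ h1 (abs_nonneg _) h2)
    have hmean : P[fun ω => x q.1 q.2 ω a * x q.1 q.2 ω b] = secMoment px a b := by
      rw [secMoment, ← hx.law q.1 q.2, integral_map (hx.measurable _ _).aemeasurable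
        (measurable_coord_mul a b).aestronglyMeasurable]
    rw [hmean] at h
    have h1 : (‖(1 : ℝ) - -1‖₊ / 2) ^ 2 = 1 := by
      have : ‖(1 : ℝ) - -1‖₊ = 2 := by
        ext
        norm_num
      rw [this]
      norm_num
    rwa [h1] at h
  have hc : ((∑ _q ∈ F, (1 : NNReal) : NNReal) : ℝ) = K * n := by
    push_cast
    rw [hsum fun _ => (1 : ℝ), Finset.sum_congr rfl fun t ht => by
      rw [Finset.sum_const, hK t ht]]
    simp
    ring
  have hup := HasSubgaussianMGF.measure_sum_ge_le_of_iIndepFun hi (c := fun _ => 1) (s := F)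
    (fun q _ => hsg q) hε
  have hlo := HasSubgaussianMGF.measure_sum_ge_le_of_iIndepFun (X := fun q => -X q)
    (hi.comp (fun _ z => -z) fun _ => measurable_neg) (c := fun _ => 1) (s := F)
    (fun q _ => (hsg q).neg) hε
  rw [hc] at hup hlo
  have hsub : {ω | ε ≤ |gramDev px (fun t i => x t i ω) S n a b|} ⊆
      {ω | ε ≤ ∑ q ∈ F, X q ω} ∪ {ω | ε ≤ ∑ q ∈ F, (-X q) ω} := by
    intro ω hω
    have h1 : ∑ q ∈ F, X q ω = gramDev px (fun t i => x t i ω) S n a b := hsum fun q => X q ω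
    have h2 : ∑ q ∈ F, (-X q) ω = -gramDev px (fun t i => x t i ω) S n a b := by
      rw [← h1]
      simp
    rw [Set.mem_union, Set.mem_ofPred_eq, Set.mem_ofPred_eq, h1, h2]
    exact le_abs.1 hω
  calc _ ≤ _ := measureReal_mono hsub (measure_ne_top _ _)
    _ ≤ _ := measureReal_union_le _ _
    _ ≤ _ := by linarith

/-- Almost surely the initial assortments have exactly `K` items. -/
lemma UniformInit.card_eq {K : ℕ} (hG : UniformInit P K x r G) (hK : K ≤ N) :
    ∀ᵐ ω ∂P, ∀ t, (G t ω).card = K := by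
  classical
  refine ae_all_iff.2 fun t => ?_
  have hm : ∀ S, MeasurableSet (G t ⁻¹' {S}) := hG.measurable t
  have h := sum_measureReal_preimage_singleton (μ := P)
    (Finset.univ.filter fun S : Finset (Fin N) => S.card = K) (fun S _ => hm S)
  have h1 : ∑ S ∈ Finset.univ.filter fun S : Finset (Fin N) => S.card = K,
      P.real (G t ⁻¹' {S}) = 1 := by
    calc _ = ∑ S ∈ Finset.univ.filter fun S : Finset (Fin N) => S.card = K,
          1 / (N.choose K : ℝ) :=
          Finset.sum_congr rfl fun S hS => hG.uniform t S (Finset.mem_filter.1 hS).2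
      _ = 1 := by
          rw [Finset.sum_const, nsmul_eq_mul, Finset.univ_filter_card_eq, Finset.card_powersetCard,
            Finset.card_univ, Fintype.card_fin]
          have : (N.choose K : ℝ) ≠ 0 := by exact_mod_cast (Nat.choose_pos hK).ne'
          field_simp
  rw [h1] at h
  have h2 : P (G t ⁻¹' ↑(Finset.univ.filter fun S : Finset (Fin N) => S.card = K)) = 1 := by
    rw [measureReal_def, eq_comm, ENNReal.toReal_eq_one_iff] at h
    exact h
  have h3 : MeasurableSet (G t ⁻¹' ↑(Finset.univ.filter fun S : Finset (Fin N) => S.card = K)) := by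
    rw [show G t ⁻¹' ↑(Finset.univ.filter fun S : Finset (Fin N) => S.card = K)
      = ⋃ S ∈ (Finset.univ.filter fun S : Finset (Fin N) => S.card = K), G t ⁻¹' {S} by
        ext; simp]
    exact Finset.measurableSet_biUnion _ fun S _ => hm S
  have h4 := (prob_compl_eq_zero_iff h3).2 h2
  filter_upwards [compl_mem_ae_iff.2 h4] with ω hω
  simpa using hω

/-- Some entry of the Gram matrix of the rounds `1, …, n` is far from its mean. -/
def GramFails (px : Measure (Vec d)) (x : ℕ → Fin N → Vec d) (S : ℕ → Finset (Fin N)) (n : ℕ)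
    (ε : ℝ) : Prop :=
  ∃ a b, ε ≤ |gramDev px x S n a b|

omit mΩ in
lemma measurableSet_gramFails {m : MeasurableSpace Ω} (hx : ∀ t i, Measurable[m] (x t i))
    (S : ℕ → Finset (Fin N)) (n : ℕ) (ε : ℝ) :
    MeasurableSet[m] {ω | GramFails px (fun t i => x t i ω) S n ε} := by
  have : {ω | GramFails px (fun t i => x t i ω) S n ε}
      = ⋃ a, ⋃ b, {ω | ε ≤ |gramDev px (fun t i => x t i ω) S n a b|} := by
    ext ω
    simp [GramFails]
  rw [this]
  refine MeasurableSet.iUnion fun a => MeasurableSet.iUnion fun b => measurableSet_le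
    measurable_const (continuous_abs.measurable.comp ?_)
  exact Finset.measurable_fun_sum _ fun t _ => Finset.measurable_fun_sum _ fun i _ =>
    ((measurable_coord (hx t i) a).mul (measurable_coord (hx t i) b)).sub_const _

/-- The assortments in the rounds `1, …, n`, as a function on these rounds. -/
def initPattern (S : ℕ → Finset (Fin N)) (n : ℕ) : Finset.Icc 1 n → Finset (Fin N) := fun t => S t

/-- The sequence of assortments with the given pattern. -/
def ofPattern {n : ℕ} (g : Finset.Icc 1 n → Finset (Fin N)) (t : ℕ) : Finset (Fin N) :=
  if h : t ∈ Finset.Icc 1 n then g ⟨t, h⟩ else ∅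

lemma gramFails_iff {x : ℕ → Fin N → Vec d} {S : ℕ → Finset (Fin N)} {n : ℕ} {ε : ℝ} :
    GramFails px x S n ε ↔ GramFails px x (ofPattern (initPattern S n)) n ε := by
  have : ∀ t ∈ Finset.Icc 1 n, S t = ofPattern (initPattern S n) t := fun t ht => by
    rw [ofPattern, dif_pos ht]
    rfl
  simp only [GramFails, gramDev_congr this]

omit mΩ in
lemma measurableSet_initPattern {m : MeasurableSpace Ω} (hG : ∀ t S, MeasurableSet[m] {ω | G t ω = S})
    (n : ℕ) (g : Finset.Icc 1 n → Finset (Fin N)) :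
    MeasurableSet[m] ((fun ω => initPattern (fun t => G t ω) n) ⁻¹' {g}) := by
  have : (fun ω => initPattern (fun t => G t ω) n) ⁻¹' {g}
      = ⋂ t : Finset.Icc 1 n, {ω | G t ω = g t} := by
    ext ω
    simp only [Set.mem_preimage, Set.mem_singleton_iff, Set.mem_iInter, Set.mem_ofPred_eq]
    exact funext_iff
  rw [this]
  exact MeasurableSet.iInter fun t => hG t (g t)

omit mΩ in
lemma measurableSet_gramFails_init {m : MeasurableSpace Ω} (hx : ∀ t i, Measurable[m] (x t i))
    (hG : ∀ t S, MeasurableSet[m] {ω | G t ω = S}) (n : ℕ) (ε : ℝ) :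
    MeasurableSet[m] {ω | GramFails px (fun t i => x t i ω) (fun t => G t ω) n ε} := by
  have h : DiscMeas m fun ω => initPattern (fun t => G t ω) n :=
    ⟨Set.to_countable _, measurableSet_initPattern hG n⟩
  simp only [gramFails_iff (S := fun t => G t _)]
  exact h.setOf (q := fun g ω => GramFails px (fun t i => x t i ω) (ofPattern g) n ε)
    fun g => measurableSet_gramFails hx (ofPattern g) n ε

/-- The Gram matrix of the initialization phase concentrates around its mean. -/
theorem measureReal_gramFails_le (hx : IIDContexts P px σ₀ x) {K : ℕ} (hG : UniformInit P K x r G) (hK : K ≤ N) (n : ℕ) {ε : ℝ} (hε : 0 ≤ ε) :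
    P.real {ω | GramFails px (fun t i => x t i ω) (fun t => G t ω) n ε}
      ≤ 2 * d ^ 2 * Real.exp (-ε ^ 2 / (2 * (K * n))) := by
  classical
  set δ := 2 * d ^ 2 * Real.exp (-ε ^ 2 / (2 * (K * n))) with hδ
  have hδ0 : 0 ≤ δ := by positivity
  set J : Finset (Finset.Icc 1 n → Finset (Fin N)) :=
    Finset.univ.filter fun g => ∀ t, (g t).card = K with hJ
  set π : Ω → Finset.Icc 1 n → Finset (Fin N) := fun ω => initPattern (fun t => G t ω) n with hπ
  have hfix : ∀ g ∈ J, P.real {ω | GramFails px (fun t i => x t i ω) (ofPattern g) n ε} ≤ δ := by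
    intro g hg
    have hg' := (Finset.mem_filter.1 hg).2
    have hsub : {ω | GramFails px (fun t i => x t i ω) (ofPattern g) n ε}
        = ⋃ a : Fin d, ⋃ b : Fin d,
          {ω | ε ≤ |gramDev px (fun t i => x t i ω) (ofPattern g) n a b|} := by
      ext ω
      simp [GramFails]
    rw [hsub]
    refine (measureReal_iUnion_fintype_le _).trans ?_
    refine (Finset.sum_le_sum fun a _ => (measureReal_iUnion_fintype_le _).trans
      (Finset.sum_le_sum fun b _ => measureReal_gramDev_ge_le hx (ofPattern g) (K := K)
        (fun t ht => by rw [ofPattern, dif_pos ht]; exact hg' _) hε a b)).trans (le_of_eq ?_)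
    simp [hδ]
    ring
  -- Split according to the pattern of the initial assortments. It is independent of the features,
  -- so the bound for fixed assortments applies to each pattern and the pattern probabilities sum to
  -- at most one.
  have hsub : {ω | GramFails px (fun t i => x t i ω) (fun t => G t ω) n ε} ≤ᵐ[P]
      ⋃ g ∈ J, (π ⁻¹' {g} ∩ {ω | GramFails px (fun t i => x t i ω) (ofPattern g) n ε}) := by
    filter_upwards [hG.card_eq hK] with ω hω hf
    refine Set.mem_biUnion (x := π ω) ?_ ⟨rfl, gramFails_iff.1 hf⟩
    exact Finset.mem_filter.2 ⟨Finset.mem_univ _, fun t => hω t⟩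
  have hind : ∀ g, P.real (π ⁻¹' {g} ∩ {ω | GramFails px (fun t i => x t i ω) (ofPattern g) n ε})
      = P.real (π ⁻¹' {g}) * P.real {ω | GramFails px (fun t i => x t i ω) (ofPattern g) n ε} := by
    intro g
    have := (Indep_iff _ _ _).1 hG.indep_context (π ⁻¹' {g})
      {ω | GramFails px (fun t i => x t i ω) (ofPattern g) n ε}
      (measurableSet_initPattern (fun t S => measurableSet_init_initSigma t S) n g)
      (measurableSet_gramFails (fun t i => measurable_feature_contextSigma t i) _ n ε)
    simp only [measureReal_def, this, ENNReal.toReal_mul]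
  calc _ ≤ _ := ENNReal.toReal_mono (measure_ne_top _ _) (measure_mono_ae hsub)
    _ ≤ ∑ g ∈ J, P.real
        (π ⁻¹' {g} ∩ {ω | GramFails px (fun t i => x t i ω) (ofPattern g) n ε}) :=
        measureReal_biUnion_finset_le _ _
    _ ≤ ∑ g ∈ J, P.real (π ⁻¹' {g}) * δ := Finset.sum_le_sum fun g hg => by
        rw [hind]
        exact mul_le_mul_of_nonneg_left (hfix g hg) measureReal_nonneg
    _ = P.real (π ⁻¹' ↑J) * δ := by
        rw [← Finset.sum_mul, sum_measureReal_preimage_singleton J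
          fun g _ => measurableSet_initPattern hG.measurable n g]
    _ ≤ 1 * δ := mul_le_mul_of_nonneg_right measureReal_le_one hδ0
    _ = δ := one_mul δ

end Moments

/-! ### The curvature bound limits the assortment size -/

section Curvature

variable {N d : ℕ}

/-- A lower bound for the products `p(i|S) p(0|S)` is at most `1 / (4 |S|)`. -/
lemma card_mul_le_quarter {θ : Vec d} {x : Fin N → Vec d} {S : Finset (Fin N)} {κ : ℝ}
    (h : ∀ i ∈ S, κ ≤ choiceProb θ x S (some i) * choiceProb θ x S none) :
    S.card * κ ≤ 1 / 4 := by
  have h1 : S.card * κ ≤ ∑ i ∈ S, choiceProb θ x S (some i) * choiceProb θ x S none := by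
    rw [← nsmul_eq_mul]
    exact Finset.card_nsmul_le_sum _ _ _ h
  have h2 := sum_choiceProb θ x S
  rw [Fintype.sum_option] at h2
  have h3 : ∑ i ∈ S, choiceProb θ x S (some i) ≤ ∑ i, choiceProb θ x S (some i) :=
    Finset.sum_le_sum_of_subset_of_nonneg (Finset.subset_univ _)
      fun i _ _ => choiceProb_nonneg θ x S _
  rw [← Finset.sum_mul] at h1
  have h4 := choiceProb_nonneg θ x S none
  -- With `p₀` the probability of the outside option, the sum is at most `(1 - p₀) p₀ ≤ 1/4`.
  nlinarith [mul_le_mul_of_nonneg_right h3 h4, sq_nonneg (choiceProb θ x S none - 1 / 2)]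

end Curvature

/-! ### Expected regret -/

section ExpectedRegret

variable {N d : ℕ} {p : Input N d} {θs : Vec d}

lemma abs_cumRegret_le {x : ℕ → Fin N → Vec d} {r : ℕ → Fin N → ℝ} {G : ℕ → Finset (Fin N)}
    (hr : ∀ t i, |r t i| ≤ 1) (c : ℕ → Option (Fin N)) : |cumRegret p θs x r G c| ≤ 2 * p.T := by
  have h1 : ∀ t, |optRevenue p.K θs (x t) (r t)| ≤ 1 := fun t => by
    obtain ⟨S, -, hS⟩ := Finset.exists_mem_eq_sup' (assortments_nonempty N p.K)
      (revenue θs (x t) (r t))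
    rw [optRevenue, hS]
    exact abs_revenue_le_one _ _ _ _ (hr t)
  calc |cumRegret p θs x r G c|
      ≤ ∑ t ∈ Finset.Icc 1 p.T, |optRevenue p.K θs (x t) (r t)
          - revenue θs (x t) (r t) (offered p x r G c t)| := Finset.abs_sum_le_sum_abs _ _
    _ ≤ ∑ _t ∈ Finset.Icc 1 p.T, (2 : ℝ) := Finset.sum_le_sum fun t _ => by
        have := abs_revenue_le_one θs (x t) (r t) (offered p x r G c t) (hr t)
        have := abs_sub (optRevenue p.K θs (x t) (r t))
          (revenue θs (x t) (r t) (offered p x r G c t))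
        linarith [h1 t]
    _ = 2 * p.T := by simp [mul_comm]

variable {Ω : Type*} [mΩ : MeasurableSpace Ω] {P : Measure Ω} [IsProbabilityMeasure P]
  {px : Measure (Vec d)} {κ σ₀ : ℝ} {x : ℕ → Fin N → Ω → Vec d} {r : ℕ → Fin N → Ω → ℝ}
  {G : ℕ → Ω → Finset (Fin N)} {c : ℕ → Ω → Option (Fin N)}

lemma integrable_regret (hest : IsMLE p.est) (hx : IIDContexts P px σ₀ x)
    (hrm : ∀ t i, Measurable (r t i)) (hr : ∀ t i ω, |r t i ω| ≤ 1)
    (hG : UniformInit P p.K x r G) (hc : MNLResponses P p θs x r G c) :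
    Integrable (regret p θs x r G c) P :=
  Integrable.of_bound
    (measurable_regret hest hx.measurable hrm hG.measurable hc.measurable).aestronglyMeasurable
    (2 * p.T) (Filter.Eventually.of_forall fun ω => abs_cumRegret_le (fun t i => hr t i ω) _)

/-- The tolerance `K T₀ σ₀ / (2 d)` costs `d` times itself, that is, half of the lower bound `K T₀
σ₀` for the mean of the Gram matrix. -/
lemma goodContext_of_not_gramFails (hd : 1 ≤ d) (hx : IIDContexts P px σ₀ x)
    (hκ : ChoiceProbBound P p.K κ θs x) (hG : UniformInit P p.K x r G) (hK : p.K ≤ N) :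
    ∀ᵐ ω ∂P, ω ∈ {ω | ¬ GramFails px (fun t i => x t i ω) (fun t => G t ω) p.T₀
      (p.K * p.T₀ * σ₀ / (2 * d))} → GoodContext p (fun t i => x t i ω) (fun t => G t ω) θs κ
        (p.K * p.T₀ * σ₀ / 2) := by
  filter_upwards [hx.norm_feature_le_one, hκ, hG.card_eq hK] with ω h1 h2 h3 h4
  refine ⟨h1, fun t => Finset.mem_filter.2 ⟨Finset.mem_univ _, (h3 t).le⟩, h2, fun v => ?_⟩
  have h5 := gramForm_ge_of_gramDev h3 hx.secondMoment
    (fun a b => le_of_not_ge fun h => h4 ⟨a, b, h⟩) v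
  refine le_trans (le_of_eq ?_) h5
  have : (d : ℝ) ≠ 0 := by positivity
  field_simp
  ring

/-- Outside two bad events, an ill-conditioned initial Gram matrix and an invalid width, the
pathwise bound `cumRegret_le` holds; on them the trivial bound `2 T` is paid. The second event is
controlled only for contexts outside the first one. -/
theorem integral_regret_le (hest : IsMLE p.est) (htie : IsSelector p.tie) (hd : 1 ≤ d)
    (hx : IIDContexts P px σ₀ x) (hκ : ChoiceProbBound P p.K κ θs x)
    (hrm : ∀ t i, Measurable (r t i)) (hr : ∀ t i ω, |r t i ω| ≤ 1)
    (hG : UniformInit P p.K x r G) (hc : MNLResponses P p θs x r G c)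
    (hκ0 : 0 < κ) (hσ : 0 < σ₀) (hK1 : 1 ≤ p.K) (hKN : p.K ≤ N) (hT1 : 1 ≤ p.T)
    (hT : p.T₀ ≤ p.T) (hα0 : 0 ≤ p.α) {lam s M : ℝ} (hlam : lam = p.K * p.T₀ * σ₀ / 2)
    (hK : (p.K : ℝ) ≤ lam) (hs : 0 ≤ s) (hM : M = (2 + √d) * s) (hMκ : M < κ * √lam)
    (hα : 3 * s + 6 * M ^ 2 / (κ ^ 2 * √lam) ≤ κ * p.α)
    {Q : Finset (Vec d)} (hQ : IsSphereNet Q) :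
    ∫ ω, regret p θs x r G c ω ∂P ≤
      (2 * p.T₀ + 2 * √p.T + 16 * p.α * √(p.K * (4 * (d * Real.log (p.K * p.T / lam))))
        * √(numStages p.T * p.T)) + 2 * p.T * (2 * d ^ 2 * Real.exp (-(p.K * p.T₀ * σ₀ ^ 2
        / (8 * d ^ 2))) + (Q.card + p.T * (numStages p.T * (N + d))) *
          (2 * Real.exp (-(s ^ 2 / 2)))) := by
  have hlam0 : 0 < lam := lt_of_lt_of_le (by exact_mod_cast hK1) hK
  have hd0 : (0 : ℝ) < d := by exact_mod_cast hd
  have hK0 : (0 : ℝ) < p.K := by exact_mod_cast hK1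
  have hT₀ : (0 : ℝ) < p.T₀ := by
    by_contra h
    have : (p.T₀ : ℝ) = 0 := le_antisymm (not_lt.1 h) (Nat.cast_nonneg _)
    rw [hlam, this] at hlam0
    simp at hlam0
  set B := 2 * p.T₀ + 2 * √p.T + 16 * p.α * √(p.K * (4 * (d * Real.log (p.K * p.T / lam))))
        * √(numStages p.T * p.T) with hB
  have hB0 : 0 ≤ B := by positivity
  set ε := p.K * p.T₀ * σ₀ / (2 * d) with hε
  set E₁ := {ω | GramFails px (fun t i => x t i ω) (fun t => G t ω) p.T₀ ε} with hE₁
  set E₂ := {ω | ω ∈ {ω | ¬ GramFails px (fun t i => x t i ω) (fun t => G t ω) p.T₀ ε} ∧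
    WidthFails p (fun t i => x t i ω) (fun t i => r t i ω) (fun t => G t ω) θs (numStages p.T)
      fun t => c t ω} with hE₂
  have hctx : ∀ t i, Measurable[contextSigma x r ⊔ initSigma G] (x t i) := fun t i =>
    (measurable_feature_contextSigma t i).mono le_sup_left le_rfl
  have hctr : ∀ t i, Measurable[contextSigma x r ⊔ initSigma G] (r t i) := fun t i =>
    (measurable_revenue_contextSigma t i).mono le_sup_left le_rfl
  have hctG : ∀ t S, MeasurableSet[contextSigma x r ⊔ initSigma G] {ω | G t ω = S} := fun t S =>
    (le_sup_right : initSigma G ≤ contextSigma x r ⊔ initSigma G) _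
      (measurableSet_init_initSigma t S)
  have hgood := goodContext_of_not_gramFails (p := p) (θs := θs) (κ := κ) hd hx hκ hG hKN
  rw [← hlam] at hgood
  have h1 : P.real E₁ ≤ 2 * d ^ 2 * Real.exp (-(p.K * p.T₀ * σ₀ ^ 2 / (8 * d ^ 2))) := by
    refine (measureReal_gramFails_le hx hG hKN p.T₀ (by positivity)).trans (le_of_eq ?_)
    congr 2
    rw [hε]
    field_simp
    norm_num
  have h2 : P.real E₂ ≤ (Q.card + p.T * (numStages p.T * (N + d))) *
      (2 * Real.exp (-(s ^ 2 / 2))) := by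
    refine measureReal_inter_le_of_pathMeas_le hest hx.measurable hrm hG.measurable hc
      (A := {ω | ¬ GramFails px (fun t i => x t i ω) (fun t => G t ω) p.T₀ ε})
      (B := fun ω γ => WidthFails p (fun t i => x t i ω) (fun t i => r t i ω) (fun t => G t ω) θs
        (numStages p.T) γ)
      (measurableSet_gramFails_init hctx hctG p.T₀ ε).compl
      (fun γ => measurableSet_widthFails hest hctx hctr hctG θs _ γ)
      (fun ω γ γ' h hw => widthFails_congr h hw) (by positivity) ?_
    filter_upwards [hgood] with ω hω hA
    exact pathMeas_widthFails_le hest htie (hω hA) hκ0 hlam0 hs hM hMκ hα hT hQ _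
  have hint := integrable_regret hest hx hrm hr hG hc
  have hm : NullMeasurableSet (toMeasurable P (E₁ ∪ E₂)) P :=
    (measurableSet_toMeasurable _ _).nullMeasurableSet
  -- A measurable hull of the bad events has the same probability and spares a proof that they are
  -- measurable.
  calc ∫ ω, regret p θs x r G c ω ∂P
      ≤ ∫ ω, B + (toMeasurable P (E₁ ∪ E₂)).indicator (fun _ => (2 * p.T : ℝ)) ω ∂P := by
        refine integral_mono_ae hint ((integrable_const _).add
          ((integrable_const _).indicator (measurableSet_toMeasurable _ _))) ?_
        filter_upwards [hgood] with ω hω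
        by_cases hE : ω ∈ E₁ ∪ E₂
        · rw [Set.indicator_of_mem (subset_toMeasurable _ _ hE)]
          have := (abs_le.1 (abs_cumRegret_le (p := p) (θs := θs) (x := fun t i => x t i ω)
            (G := fun t => G t ω) (fun t i => hr t i ω) fun t => c t ω)).2
          exact this.trans (by linarith)
        · have hA : ω ∉ E₁ := fun h => hE (Or.inl h)
          have hW := fun h => hE (Or.inr ⟨hA, h⟩)
          have := cumRegret_le htie (hω hA) hlam0 hK1 hK hT1 hT hα0 (fun t i => hr t i ω)
            (fun t => c t ω) hW
          refine this.trans (le_add_of_nonneg_right (Set.indicator_nonneg (fun _ _ => ?_) _))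
          positivity
    _ = B + 2 * p.T * P.real (E₁ ∪ E₂) := by
        rw [integral_add (integrable_const _)
          ((integrable_const _).indicator (measurableSet_toMeasurable _ _)),
          integral_indicator_const _ (measurableSet_toMeasurable _ _)]
        simp [measureReal_def, measure_toMeasurable, mul_comm]
    _ ≤ _ := by
        have := (measureReal_union_le (μ := P) E₁ E₂).trans (add_le_add h1 h2)
        have hT0 : (0 : ℝ) ≤ 2 * p.T := by positivity
        linarith [mul_le_mul_of_nonneg_left this hT0]

end ExpectedRegret

/-! ### Choice of the parameters -/

section Tuning

variable {κ σ₀ C : ℝ} {d N K T : ℕ}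

/-- Consequences of the lower bound for the horizon. -/
structure LongHorizon (C : ℝ) (d N T : ℕ) : Prop where
  three_le : 3 ≤ C
  le_T : C ≤ T
  two_le_logb : 2 ≤ Real.logb 2 T
  log_le : Real.log T ≤ logTerm T N
  one_le_log : 1 ≤ Real.log T
  one_le_log_div : 1 ≤ Real.log (T / d)
  logTerm_le : C * logTerm T N ≤ √(d * T)
  dim_le : C * (d : ℝ) ^ 2 ≤ √(d * T)
  sqrt_le : C * √(d * T) ≤ T

lemma one_le_log_of_three_le {y : ℝ} (hy : 3 ≤ y) : 1 ≤ Real.log y := by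
  rw [Real.le_log_iff_exp_le (by linarith)]
  linarith [Real.exp_one_lt_d9]

/-- Multiplying the two lower bounds for `T` by `d` and taking roots compares `C Λ` and `C d²` with
`√(dT)`, where `Λ` is `logTerm`. Hence `C` appears squared in the hypothesis. -/
lemma longHorizon (hC : 3 ≤ C) (hd : 1 ≤ d) (hN : 1 ≤ N)
    (hT : C ^ 2 * max (logTerm T N ^ 2 / d) ((d : ℝ) ^ 3) ≤ T) : LongHorizon C d N T := by
  have hd1 : (1 : ℝ) ≤ d := by exact_mod_cast hd
  have hN1 : (1 : ℝ) ≤ N := by exact_mod_cast hN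
  have h1 : C ^ 2 * (logTerm T N ^ 2 / d) ≤ T :=
    (mul_le_mul_of_nonneg_left (le_max_left _ _) (sq_nonneg C)).trans hT
  have h2 : C ^ 2 * (d : ℝ) ^ 3 ≤ T :=
    (mul_le_mul_of_nonneg_left (le_max_right _ _) (sq_nonneg C)).trans hT
  have h3 : C ^ 2 ≤ T := by nlinarith [one_le_pow₀ hd1 (n := 3), sq_nonneg C]
  have h4 : C ^ 2 * d ≤ T := by
    refine le_trans (mul_le_mul_of_nonneg_left ?_ (sq_nonneg C)) h2
    exact le_self_pow₀ hd1 (by norm_num)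
  have hCT : C ≤ T := by nlinarith
  have hT9 : (9 : ℝ) ≤ T := by nlinarith
  have hT0 : (0 : ℝ) < T := by linarith
  have hlogb : 2 ≤ Real.logb 2 T := by
    rw [Real.le_logb_iff_rpow_le (by norm_num) hT0]
    have : (4 : ℝ) ≤ T := by linarith
    norm_num
    exact_mod_cast this
  refine ⟨hC, hCT, hlogb, ?_, one_le_log_of_three_le (by linarith), ?_, ?_, ?_, ?_⟩
  · refine Real.log_le_log hT0 ?_
    have : 1 ≤ (N : ℝ) * Real.logb 2 T := by nlinarith
    rw [mul_assoc]
    exact le_mul_of_one_le_right hT0.le this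
  · refine one_le_log_of_three_le ?_
    rw [le_div_iff₀ (by linarith)]
    have hC9 : 3 ≤ C ^ 2 := by nlinarith
    linarith [mul_le_mul_of_nonneg_right hC9 (by linarith : (0 : ℝ) ≤ d)]
  · refine Real.le_sqrt_of_sq_le ?_
    have hd0 : (0 : ℝ) < d := by linarith
    rw [← mul_div_assoc, div_le_iff₀ hd0] at h1
    linarith [mul_pow C (logTerm T N) 2]
  · refine Real.le_sqrt_of_sq_le ?_
    calc (C * (d : ℝ) ^ 2) ^ 2 = (d * (C ^ 2 * (d : ℝ) ^ 3) : ℝ) := by ring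
      _ ≤ (d * T : ℝ) := mul_le_mul_of_nonneg_left h2 (by linarith)
  · refine le_of_sq_le_sq ?_ hT0.le
    rw [mul_pow, Real.sq_sqrt (by positivity)]
    nlinarith

lemma LongHorizon.one_le_logTerm (h : LongHorizon C d N T) : 1 ≤ logTerm T N :=
  h.one_le_log.trans h.log_le

lemma LongHorizon.one_le_sqrt (h : LongHorizon C d N T) : 1 ≤ √(d * T) := by
  nlinarith [h.logTerm_le, h.one_le_logTerm, h.three_le]

lemma LongHorizon.dim_le_sqrt (h : LongHorizon C d N T) : (d : ℝ) ^ 2 ≤ √(d * T) := by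
  nlinarith [h.dim_le, h.three_le, sq_nonneg (d : ℝ)]

lemma LongHorizon.numStages_le (h : LongHorizon C d N T) : (numStages T : ℝ) ≤ Real.logb 2 T := by
  have h2 := h.two_le_logb
  have := Nat.floor_le (a := (1 / 2 : ℝ) * Real.logb 2 T) (by linarith)
  rw [numStages]
  push_cast
  linarith

/-- The constants that the horizon has to dominate. -/
structure LargeConstant (C κ σ₀ : ℝ) : Prop where
  three_le : 3 ≤ C
  init : 3 / σ₀ ≤ C
  horizon : 2 / (κ ^ 4 * σ₀) ≤ C
  width : 93312 / σ₀ ^ 2 ≤ C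
  gram : 8 / σ₀ ^ 3 ≤ C

/-- Here `J` will be the set of dimensions compatible with `σ₀` and `f` the cardinality of the nets;
a finite sum dominates them all. -/
lemma exists_largeConstant (hκ : 0 < κ) (hσ : 0 < σ₀) (J : Finset ℕ) (f : ℕ → ℕ) :
    ∃ C, LargeConstant C κ σ₀ ∧ ∀ k ∈ J, (f k : ℝ) ≤ C := by
  have p1 : 0 ≤ 3 / σ₀ := by positivity
  have p2 : 0 ≤ 2 / (κ ^ 4 * σ₀) := by positivity
  have p3 : 0 ≤ 93312 / σ₀ ^ 2 := by positivity
  have p4 : 0 ≤ 8 / σ₀ ^ 3 := by positivity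
  have p5 : 0 ≤ ∑ k ∈ J, (f k : ℝ) := Finset.sum_nonneg fun _ _ => Nat.cast_nonneg _
  refine ⟨3 + 3 / σ₀ + 2 / (κ ^ 4 * σ₀) + 93312 / σ₀ ^ 2 + 8 / σ₀ ^ 3 + ∑ k ∈ J, (f k : ℝ),
    ⟨by linarith, by linarith, by linarith, by linarith, by linarith⟩, fun k hk => ?_⟩
  have := Finset.single_le_sum (f := fun k => (f k : ℝ)) (fun _ _ => Nat.cast_nonneg _) hk
  linarith

/-- For a long horizon the first term of the maximum wins, since `C (d + 2 Λ) ≤ 3 √(dT)` and `3 / σ₀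
≤ C`. So already with `C₀ = 1` the initialization has the length that the eigenvalue bound needs,
and rounding up adds at most one. -/
lemma LongHorizon.initLength_bounds (h : LongHorizon C d N T) (hC : LargeConstant C κ σ₀)
    (hκ : 0 < κ) (hσ : 0 < σ₀) (hd : 1 ≤ d) :
    √(d * T) / (κ ^ 4 * σ₀) ≤ initLength 1 κ σ₀ d N T ∧
      (initLength 1 κ σ₀ d N T : ℝ) ≤ √(d * T) / (κ ^ 4 * σ₀) + 1 := by
  have hd1 : (1 : ℝ) ≤ d := by exact_mod_cast hd
  set u := √(d * T : ℝ) with hu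
  have h1 : (d + 2 * logTerm T N) / σ₀ ^ 2 ≤ u / σ₀ := by
    have h2 := hC.init
    rw [div_le_iff₀ hσ] at h2
    have h3 : 3 * (d + 2 * logTerm T N) ≤ C * σ₀ * (d + 2 * logTerm T N) :=
      mul_le_mul_of_nonneg_right h2 (by linarith [h.one_le_logTerm])
    have h4 : C * (d + 2 * logTerm T N) ≤ 3 * u := by
      have h5 : C * d ≤ C * (d : ℝ) ^ 2 :=
        mul_le_mul_of_nonneg_left (by nlinarith) (by linarith [h.three_le])
      linarith [h.dim_le, h.logTerm_le]
    rw [div_le_div_iff₀ (by positivity) hσ]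
    nlinarith
  have h5 : initLength 1 κ σ₀ d N T = ⌈u / (κ ^ 4 * σ₀)⌉₊ := by
    rw [initLength, max_eq_left h1]
    congr 1
    field_simp
  rw [h5]
  exact ⟨Nat.le_ceil _, (Nat.ceil_lt_add_one (by positivity)).le⟩

lemma LongHorizon.initLength_le (h : LongHorizon C d N T) (hC : LargeConstant C κ σ₀)
    (hκ : 0 < κ) (hσ : 0 < σ₀) (hd : 1 ≤ d) : initLength 1 κ σ₀ d N T ≤ T := by
  have h1 := (h.initLength_bounds hC hκ hσ hd).2
  set u := √(d * T : ℝ) with hu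
  have h2 : 2 / (κ ^ 4 * σ₀) * u ≤ T :=
    (mul_le_mul_of_nonneg_right hC.horizon (by positivity)).trans h.sqrt_le
  have h3 : u / (κ ^ 4 * σ₀) = 2 / (κ ^ 4 * σ₀) * u / 2 := by ring
  have h4 : (3 : ℝ) ≤ T := h.three_le.trans h.le_T
  have : (initLength 1 κ σ₀ d N T : ℝ) ≤ T := by linarith
  exact_mod_cast this

lemma LongHorizon.half_sqrt_le (h : LongHorizon C d N T) (hC : LargeConstant C κ σ₀)
    (hκ : 0 < κ) (hσ : 0 < σ₀) (hd : 1 ≤ d) :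
    √(d * T) / 2 ≤ κ ^ 4 * (initLength 1 κ σ₀ d N T * σ₀ / 2) := by
  have h1 := (h.initLength_bounds hC hκ hσ hd).1
  rw [div_le_iff₀ (by positivity)] at h1
  nlinarith

/-- The tuned parameters satisfy the requirements on the confidence radius. -/
lemma LongHorizon.radius_bounds (h : LongHorizon C d N T) (hC : LargeConstant C κ σ₀)
    (hκ : 0 < κ) (hκ1 : κ ≤ 1 / 4) (hσ : 0 < σ₀) (hd : 1 ≤ d) (hdσ : d * σ₀ ≤ 1) {lam : ℝ}
    (hlam : √(d * T) / 2 ≤ κ ^ 4 * lam) :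
    (2 + √d) * (2 * √(logTerm T N)) < κ * √lam ∧
      3 * (2 * √(logTerm T N)) + 6 * ((2 + √d) * (2 * √(logTerm T N))) ^ 2 / (κ ^ 2 * √lam)
        ≤ κ * radius κ N T := by
  have hd1 : (1 : ℝ) ≤ d := by exact_mod_cast hd
  set v := √(logTerm T N) with hv
  set u := √(d * T : ℝ) with hu
  have hΛ := h.one_le_logTerm
  have hv2 : v ^ 2 = logTerm T N := Real.sq_sqrt (by linarith)
  have hv0 : 0 < v := Real.sqrt_pos.2 (by linarith)
  have hlam0 : 0 < lam := by
    by_contra hneg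
    have h0 : 0 ≤ κ ^ 4 := by positivity
    nlinarith [h.one_le_sqrt]
  have hsd2 : √(d : ℝ) ^ 2 = d := Real.sq_sqrt (by linarith)
  have hsd1 : 1 ≤ √(d : ℝ) := Real.one_le_sqrt.2 hd1
  have hM0 : (2 + √(d : ℝ)) * (2 * v) ≤ 6 * √(d : ℝ) * v := by nlinarith
  -- This makes the quadratic remainder lower order. `216 = 6 * 6²` comes from `6 M²` with `M ≤ 6 √d
  -- v`; `93312 = 2 * 216²` accounts for `κ⁴ lam ≥ √(dT) / 2`; and `d σ₀ ≤ 1` removes the dimension.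
  have key : 216 * d * v ≤ κ ^ 2 * √lam := by
    refine le_of_sq_le_sq ?_ (by positivity)
    rw [mul_pow, mul_pow _ (√lam), Real.sq_sqrt hlam0.le, mul_pow, hv2]
    have h1 : (d : ℝ) ^ 2 * logTerm T N ≤ logTerm T N / σ₀ ^ 2 := by
      rw [le_div_iff₀ (by positivity)]
      have : (d * σ₀) ^ 2 ≤ 1 := by nlinarith [mul_pos (by linarith : (0 : ℝ) < d) hσ]
      nlinarith
    have h2 : 93312 * (logTerm T N / σ₀ ^ 2) ≤ u := by
      calc 93312 * (logTerm T N / σ₀ ^ 2) = 93312 / σ₀ ^ 2 * logTerm T N := by ring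
        _ ≤ C * logTerm T N := mul_le_mul_of_nonneg_right hC.width (by linarith)
        _ ≤ u := h.logTerm_le
    nlinarith
  have hdv : √(d : ℝ) ≤ d := by nlinarith
  constructor
  · have h3 : κ ^ 2 * √lam ≤ κ * √lam :=
      mul_le_mul_of_nonneg_right (by nlinarith) (Real.sqrt_nonneg _)
    have h4 : 6 * √(d : ℝ) * v < 216 * d * v := by
      refine mul_lt_mul_of_pos_right ?_ hv0
      linarith
    linarith
  · have h5 : 6 * ((2 + √(d : ℝ)) * (2 * v)) ^ 2 / (κ ^ 2 * √lam) ≤ v := by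
      rw [div_le_iff₀ (by positivity)]
      have h6 : ((2 + √(d : ℝ)) * (2 * v)) ^ 2 ≤ (6 * √(d : ℝ) * v) ^ 2 :=
        pow_le_pow_left₀ (by positivity) hM0 2
      have h7 : (6 * √(d : ℝ) * v) ^ 2 = 36 * d * v ^ 2 := by rw [mul_pow, mul_pow, hsd2]; ring
      nlinarith [mul_le_mul_of_nonneg_left key hv0.le]
    have h8 : κ * radius κ N T = 5 * (√2 * v) := by
      rw [radius, Real.sqrt_mul (by norm_num), ← hv]
      field_simp
    -- The budget is tight: `6 v` for the leading term and `v` for the remainder, against `5 √2 v ≥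
    -- 7 v`.
    have h9 : (7 / 5 : ℝ) ≤ √2 := Real.le_sqrt_of_sq_le (by norm_num)
    rw [h8]
    nlinarith

/-- The failure probability of the Gram matrix is at most `O(1/T)`. -/
lemma LongHorizon.mul_exp_gram_le (h : LongHorizon C d N T) (hC : LargeConstant C κ σ₀)
    (hκ : 0 < κ) (hκ1 : κ ≤ 1 / 4) (hσ : 0 < σ₀) (hd : 1 ≤ d) (hdσ : d * σ₀ ≤ 1)
    {k : ℝ} (hk : 1 ≤ k) :
    T * Real.exp (-(k * initLength 1 κ σ₀ d N T * σ₀ ^ 2 / (8 * d ^ 2))) ≤ 1 := by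
  have hd0 : (0 : ℝ) < d := by exact_mod_cast hd
  have hΛ := h.one_le_logTerm
  have hT0 : (0 : ℝ) < T := by linarith [h.three_le.trans h.le_T]
  have h3 := (h.initLength_bounds hC hκ hσ hd).1
  have h7 := hC.gram
  have hC' := h.logTerm_le
  have hll := h.log_le
  set u := √(d * T : ℝ) with hu
  set T₀ : ℝ := ((initLength 1 κ σ₀ d N T : ℕ) : ℝ) with hT₀
  have hT₀0 : 0 ≤ T₀ := Nat.cast_nonneg _
  have h4 : u / σ₀ ≤ T₀ := by
    refine le_trans ?_ h3
    refine div_le_div_of_nonneg_left (by positivity) (by positivity) ?_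
    exact mul_le_of_le_one_left hσ.le (pow_le_one₀ hκ.le (by linarith))
  have h5 : u * σ₀ ≤ k * T₀ * σ₀ ^ 2 := by
    rw [div_le_iff₀ hσ] at h4
    calc u * σ₀ ≤ T₀ * σ₀ * σ₀ := mul_le_mul_of_nonneg_right h4 hσ.le
      _ = 1 * (T₀ * σ₀ ^ 2) := by ring
      _ ≤ k * (T₀ * σ₀ ^ 2) := mul_le_mul_of_nonneg_right hk (by positivity)
      _ = _ := by ring
  -- Two of the three powers of `σ₀` will absorb `d²`; the third matches the lower bound for `k T₀
  -- σ₀²`.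
  have h6 : 8 * logTerm T N ≤ u * σ₀ ^ 3 := by
    rw [div_le_iff₀ (by positivity)] at h7
    calc 8 * logTerm T N ≤ C * σ₀ ^ 3 * logTerm T N :=
          mul_le_mul_of_nonneg_right h7 (by linarith)
      _ = C * logTerm T N * σ₀ ^ 3 := by ring
      _ ≤ u * σ₀ ^ 3 := mul_le_mul_of_nonneg_right hC' (by positivity)
  have h2 : Real.log T ≤ k * T₀ * σ₀ ^ 2 / (8 * d ^ 2) := by
    rw [le_div_iff₀ (by positivity)]
    have h8 : (d * σ₀) ^ 2 ≤ 1 := pow_le_one₀ (by positivity) hdσ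
    calc Real.log T * (8 * d ^ 2) ≤ logTerm T N * (8 * d ^ 2) :=
          mul_le_mul_of_nonneg_right hll (by positivity)
      _ = 8 * logTerm T N * d ^ 2 := by ring
      _ ≤ u * σ₀ ^ 3 * d ^ 2 := mul_le_mul_of_nonneg_right h6 (by positivity)
      _ = u * σ₀ * (d * σ₀) ^ 2 := by ring
      _ ≤ u * σ₀ * 1 := mul_le_mul_of_nonneg_left h8 (by positivity)
      _ ≤ k * T₀ * σ₀ ^ 2 := by linarith
  calc T * Real.exp (-(k * T₀ * σ₀ ^ 2 / (8 * d ^ 2)))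
      ≤ T * Real.exp (-Real.log T) :=
        mul_le_mul_of_nonneg_left (Real.exp_le_exp.2 (by linarith)) hT0.le
    _ = 1 := by rw [Real.exp_neg, Real.exp_log hT0, mul_inv_cancel₀ hT0.ne']

/-- The failure probability of the confidence widths is at most `O(d/T)`. -/
lemma LongHorizon.mul_exp_width_le (h : LongHorizon C d N T) (hd : 1 ≤ d) (hN : 1 ≤ N)
    {n : ℕ} (hn : (n : ℝ) ≤ C) :
    T * (n + T * (numStages T * (N + d))) * Real.exp (-((2 * √(logTerm T N)) ^ 2 / 2))
      ≤ 1 + 2 * d := by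
  have hd1 : (1 : ℝ) ≤ d := by exact_mod_cast hd
  have hN1 : (1 : ℝ) ≤ N := by exact_mod_cast hN
  have hΛ := h.one_le_logTerm
  have hT0 : (0 : ℝ) < T := by linarith [h.three_le.trans h.le_T]
  have hlb := h.two_le_logb
  have hL := h.numStages_le
  have hnT : (n : ℝ) ≤ T := hn.trans h.le_T
  have hY : 1 ≤ N * Real.logb 2 T := one_le_mul_of_one_le_of_one_le hN1 (by linarith)
  set Y : ℝ := N * Real.logb 2 T with hYdef
  have hX0 : 0 < T * Y := by positivity
  -- The choice `s = 2 √Λ` gives two factors `1 / (T N log₂ T)`: one for the union bound over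
  -- rounds, items and stages, the other against the price `2 T` of a failure.
  have h2 : Real.exp (-((2 * √(logTerm T N)) ^ 2 / 2)) = 1 / (T * Y) ^ 2 := by
    rw [mul_pow, Real.sq_sqrt (by linarith), show -((2 : ℝ) ^ 2 * logTerm T N / 2)
      = -(2 * Real.log (T * Y)) by rw [logTerm, hYdef]; ring_nf, Real.exp_neg, two_mul,
      Real.exp_add, Real.exp_log hX0, one_div, sq]
  have hYY : Y ≤ Y ^ 2 := le_self_pow₀ hY (by norm_num)
  have h3 : (T : ℝ) * n ≤ 1 * (T * Y) ^ 2 := by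
    calc (T : ℝ) * n ≤ T * T := mul_le_mul_of_nonneg_left hnT hT0.le
      _ = T ^ 2 * 1 := by ring
      _ ≤ T ^ 2 * Y ^ 2 := mul_le_mul_of_nonneg_left (one_le_pow₀ hY) (by positivity)
      _ = _ := by ring
  have h5 : numStages T * (N + d : ℝ) ≤ Real.logb 2 T * (2 * d * N) := by
    refine mul_le_mul hL ?_ (by positivity) (by linarith)
    nlinarith
  have h4 : (T : ℝ) * (T * (numStages T * (N + d))) ≤ 2 * d * (T * Y) ^ 2 := by
    calc (T : ℝ) * (T * (numStages T * (N + d))) = T ^ 2 * (numStages T * (N + d)) := by ring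
      _ ≤ T ^ 2 * (Real.logb 2 T * (2 * d * N)) := mul_le_mul_of_nonneg_left h5 (by positivity)
      _ = T ^ 2 * (2 * d) * Y := by rw [hYdef]; ring
      _ ≤ T ^ 2 * (2 * d) * Y ^ 2 := mul_le_mul_of_nonneg_left hYY (by positivity)
      _ = _ := by ring
  rw [h2, mul_one_div, div_le_iff₀ (by positivity)]
  linarith

/-- The failure probabilities contribute at most `O(√(dT))` to the regret. -/
lemma LongHorizon.failure_le (h : LongHorizon C d N T) (hC : LargeConstant C κ σ₀)
    (hκ : 0 < κ) (hκ1 : κ ≤ 1 / 4) (hσ : 0 < σ₀) (hd : 1 ≤ d) (hdσ : d * σ₀ ≤ 1) (hN : 1 ≤ N)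
    {n : ℕ} (hn : (n : ℝ) ≤ C) {k : ℝ} (hk : 1 ≤ k) :
    2 * T * (2 * d ^ 2 * Real.exp (-(k * initLength 1 κ σ₀ d N T * σ₀ ^ 2 / (8 * d ^ 2))) +
      (n + T * (numStages T * (N + d))) * (2 * Real.exp (-((2 * √(logTerm T N)) ^ 2 / 2))))
      ≤ 16 * √(d * T) := by
  have hd1 : (1 : ℝ) ≤ d := by exact_mod_cast hd
  have h1 := h.mul_exp_gram_le hC hκ hκ1 hσ hd hdσ hk
  have h2 := h.mul_exp_width_le hd hN hn
  have hdu := h.dim_le_sqrt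
  have hdd : (d : ℝ) ≤ d ^ 2 := le_self_pow₀ hd1 (by norm_num)
  have h3 := mul_le_mul_of_nonneg_left h1 (by positivity : (0 : ℝ) ≤ 4 * d ^ 2)
  generalize Real.exp (-(k * initLength 1 κ σ₀ d N T * σ₀ ^ 2 / (8 * d ^ 2))) = e₁ at *
  generalize Real.exp (-((2 * √(logTerm T N)) ^ 2 / 2)) = e₂ at *
  calc _ = 4 * d ^ 2 * (T * e₁) + 4 * (T * (n + T * (numStages T * (N + d))) * e₂) := by ring
    _ ≤ 4 * d ^ 2 * 1 + 4 * (1 + 2 * d) := by linarith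
    _ ≤ 16 * √(d * T) := by linarith

/-- The main part of the regret. -/
lemma LongHorizon.main_le (h : LongHorizon C d N T) (hC : LargeConstant C κ σ₀)
    (hκ : 0 < κ) (hKκ : K * κ ≤ 1 / 4) (hK : 1 ≤ K) (hσ : 0 < σ₀) (hd : 1 ≤ d)
    (hdσ : d * σ₀ ≤ 1) :
    2 * initLength 1 κ σ₀ d N T + 2 * √T + 16 * radius κ N T * √(K * (4 * (d * Real.log
      (K * T / (K * initLength 1 κ σ₀ d N T * σ₀ / 2))))) * √(numStages T * T) + 16 * √(d * T)
      ≤ 110 / (κ ^ 4 * σ₀) * √(d * T * Real.log (T / d) * logTerm T N * Real.logb 2 T) := by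
  have hd1 : (1 : ℝ) ≤ d := by exact_mod_cast hd
  have hK1 : (1 : ℝ) ≤ K := by exact_mod_cast hK
  have hκ1 : κ ≤ 1 / 4 := by nlinarith
  have hσ1 : σ₀ ≤ 1 := by nlinarith
  have hΛ := h.one_le_logTerm
  have hT3 : (3 : ℝ) ≤ T := h.three_le.trans h.le_T
  have hT0 : (0 : ℝ) < T := by linarith
  have hlb := h.two_le_logb
  have hlog := h.one_le_log_div
  obtain ⟨hlo, hup⟩ := h.initLength_bounds hC hκ hσ hd
  have hhalf := h.half_sqrt_le hC hκ hσ hd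
  set u := √(d * T : ℝ) with hu
  have hu1 : 1 ≤ u := h.one_le_sqrt
  have hu2 : u ^ 2 = d * T := Real.sq_sqrt (by positivity)
  set T₀ : ℝ := ((initLength 1 κ σ₀ d N T : ℕ) : ℝ) with hT₀
  set Z := √(d * T * Real.log (T / d) * logTerm T N * Real.logb 2 T) with hZ
  have huZ : u ≤ Z := by
    refine Real.sqrt_le_sqrt ?_
    have h1 : 1 ≤ Real.log (T / d) * logTerm T N := one_le_mul_of_one_le_of_one_le hlog hΛ
    have h2 : 1 ≤ Real.log (T / d) * logTerm T N * Real.logb 2 T :=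
      one_le_mul_of_one_le_of_one_le h1 (by linarith)
    calc (d * T : ℝ) ≤ d * T * (Real.log (T / d) * logTerm T N * Real.logb 2 T) :=
          le_mul_of_one_le_right (by positivity) h2
      _ = _ := by ring
  have hκ4 : κ ^ 4 ≤ κ ^ 2 := pow_le_pow_of_le_one hκ.le (by linarith) (by norm_num)
  have hw : 0 < κ ^ 4 * σ₀ := by positivity
  have hw1 : κ ^ 4 * σ₀ ≤ 1 := by
    have : κ ^ 4 ≤ 1 := pow_le_one₀ hκ.le (by linarith)
    nlinarith
  have hT₀0 : 0 < T₀ := lt_of_lt_of_le (by positivity) hlo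
  have hcore : 16 * radius κ N T * √(K * (4 * (d * Real.log (K * T / (K * T₀ * σ₀ / 2)))))
      * √(numStages T * T) ≤ 80 / (κ ^ 4 * σ₀) * Z := by
    -- The smallest eigenvalue is at least `K √(dT)`, so the logarithm is at most that of `T / √(dT)
    -- = √(T / d)`.
    have h1 : Real.log (K * T / (K * T₀ * σ₀ / 2)) ≤ 1 / 2 * Real.log (T / d) := by
      have h2 : (K * T / (K * T₀ * σ₀ / 2) : ℝ) ≤ T / u := by
        rw [div_le_div_iff₀ (by positivity) (by linarith)]
        have h3 : u ≤ T₀ * σ₀ / 2 := by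
          have h4 : κ ^ 4 ≤ 1 / 2 := by
            calc κ ^ 4 ≤ (1 / 4 : ℝ) ^ 4 := pow_le_pow_left₀ hκ.le hκ1 4
              _ ≤ 1 / 2 := by norm_num
          have h5 : 0 ≤ T₀ * σ₀ / 2 := by positivity
          nlinarith
        have : (0 : ℝ) ≤ K * T := by positivity
        nlinarith
      have h6 : Real.log (T / u) = 1 / 2 * Real.log (T / d) := by
        rw [Real.log_div hT0.ne' (by positivity), Real.log_div hT0.ne' (by positivity), hu,
          Real.log_sqrt (by positivity), Real.log_mul (by positivity) hT0.ne']
        ring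
      rw [← h6]
      exact Real.log_le_log (by positivity) h2
    have h7 : √(K * (4 * (d * Real.log (K * T / (K * T₀ * σ₀ / 2)))))
        ≤ √(1 / (2 * κ ^ 2) * (d * Real.log (T / d))) := by
      refine Real.sqrt_le_sqrt ?_
      -- The assortment size leaves the bound here, through `K κ ≤ 1/4` and `κ ≤ 1`.
      have h8 : (K : ℝ) ≤ 1 / (4 * κ ^ 2) := by
        rw [le_div_iff₀ (by positivity)]
        nlinarith [mul_pos (by linarith : (0 : ℝ) < K) hκ]
      calc (K : ℝ) * (4 * (d * Real.log (K * T / (K * T₀ * σ₀ / 2))))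
          ≤ K * (4 * (d * (1 / 2 * Real.log (T / d)))) := by gcongr
        _ ≤ 1 / (4 * κ ^ 2) * (4 * (d * (1 / 2 * Real.log (T / d)))) :=
            mul_le_mul_of_nonneg_right h8 (by positivity)
        _ = _ := by field_simp
    have h9 : √(numStages T * T : ℝ) ≤ √(Real.logb 2 T * T) :=
      Real.sqrt_le_sqrt (mul_le_mul_of_nonneg_right h.numStages_le hT0.le)
    have h10 : radius κ N T = 5 / κ * √(2 * logTerm T N) := rfl
    have h11 : √(2 * logTerm T N) * √(1 / (2 * κ ^ 2) * (d * Real.log (T / d)))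
        * √(Real.logb 2 T * T) = 1 / κ * Z := by
      rw [← Real.sqrt_mul (by positivity), ← Real.sqrt_mul (by positivity),
        show 2 * logTerm T N * (1 / (2 * κ ^ 2) * (d * Real.log (T / d))) * (Real.logb 2 T * T)
          = (1 / κ) ^ 2 * (d * T * Real.log (T / d) * logTerm T N * Real.logb 2 T) by
          field_simp, Real.sqrt_mul (by positivity), Real.sqrt_sq (by positivity)]
    have hr0 : 0 ≤ radius κ N T := by rw [h10]; positivity
    calc _ ≤ 16 * radius κ N T * √(1 / (2 * κ ^ 2) * (d * Real.log (T / d)))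
          * √(Real.logb 2 T * T) := by gcongr
      _ = 80 / κ * (√(2 * logTerm T N) * √(1 / (2 * κ ^ 2) * (d * Real.log (T / d)))
        * √(Real.logb 2 T * T)) := by rw [h10]; ring
      _ = 80 / κ ^ 2 * Z := by rw [h11]; field_simp
      _ ≤ 80 / (κ ^ 4 * σ₀) * Z := by
          refine mul_le_mul_of_nonneg_right ?_ (by positivity)
          refine div_le_div_of_nonneg_left (by norm_num) hw ?_
          nlinarith [pow_pos hκ 4]
  have hsqT : √(T : ℝ) ≤ u := Real.sqrt_le_sqrt (by nlinarith)
  -- `22 = 2 + 2 + 2 + 16`: the initialization, its rounding up, `2 √T`, and the failure term.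
  have hrest : 2 * T₀ + 2 * √T + 16 * u ≤ 22 / (κ ^ 4 * σ₀) * u := by
    have h1 : u ≤ u / (κ ^ 4 * σ₀) := le_div_self (by linarith) hw hw1
    have h2 : 22 / (κ ^ 4 * σ₀) * u = 22 * (u / (κ ^ 4 * σ₀)) := by ring
    rw [h2]
    linarith
  have hrest' : 22 / (κ ^ 4 * σ₀) * u ≤ 22 / (κ ^ 4 * σ₀) * Z :=
    mul_le_mul_of_nonneg_left huZ (by positivity)
  -- The constant `110` leaves `8` to spare over `22 + 80`.
  have hfin : 110 / (κ ^ 4 * σ₀) * Z = 22 / (κ ^ 4 * σ₀) * Z + 80 / (κ ^ 4 * σ₀) * Z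
      + 8 / (κ ^ 4 * σ₀) * Z := by ring
  have : 0 ≤ 8 / (κ ^ 4 * σ₀) * Z := by positivity
  linarith

end Tuning

/-! ### The expected regret with the prescribed parameters -/

section TunedRegret

variable {N d K T : ℕ} {est : Estimator N d} {tie : Finset (Finset (Fin N)) → Finset (Fin N)}
  {θstar : Vec d} {Ω : Type*} [MeasurableSpace Ω] {P : Measure Ω} [IsProbabilityMeasure P]
  {px : Measure (Vec d)} {κ σ₀ C : ℝ} {x : ℕ → Fin N → Ω → Vec d} {r : ℕ → Fin N → Ω → ℝ}
  {G : ℕ → Ω → Finset (Fin N)} {c : ℕ → Ω → Option (Fin N)}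

omit [IsProbabilityMeasure P] in
lemma ChoiceProbBound.mul_le_quarter [NeZero P] (hcp : ChoiceProbBound P K κ θstar x)
    (hKN : K ≤ N) : K * κ ≤ 1 / 4 := by
  obtain ⟨ω, hω⟩ := hcp.exists
  obtain ⟨S, -, hS⟩ := Finset.exists_subset_card_eq
    (s := (Finset.univ : Finset (Fin N))) (n := K) (by simpa using hKN)
  have := card_mul_le_quarter fun i hi => hω 0 S
    (Finset.mem_filter.2 ⟨Finset.mem_univ _, hS.le⟩) i hi θstar (by simp)
  rwa [hS] at this

/-- The regret bound for a horizon that dominates all constants. -/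
theorem integral_regret_tunedInput_le (h : LongHorizon C d N T) (hC : LargeConstant C κ σ₀)
    (hκ : 0 < κ) (hσ : 0 < σ₀) (hd : 1 ≤ d) (hK : 1 ≤ K) (hKN : K ≤ N) (hdσ : d * σ₀ ≤ 1)
    (hKκ : K * κ ≤ 1 / 4) {Q : Finset (Vec d)} (hQ : IsSphereNet Q) (hQC : (Q.card : ℝ) ≤ C)
    (hest : IsMLE est) (htie : IsSelector tie) (hx : IIDContexts P px σ₀ x)
    (hcp : ChoiceProbBound P K κ θstar x) (hrm : ∀ t i, Measurable (r t i))
    (hr : ∀ t i ω, |r t i ω| ≤ 1) (hG : UniformInit P K x r G)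
    (hc : MNLResponses P (tunedInput 1 κ σ₀ K T est tie) θstar x r G c) :
    ∫ ω, regret (tunedInput 1 κ σ₀ K T est tie) θstar x r G c ω ∂P ≤
      110 / (κ ^ 4 * σ₀) * √(d * T * Real.log (T / d) * logTerm T N * Real.logb 2 T) := by
  have hN : 1 ≤ N := hK.trans hKN
  have hK1 : (1 : ℝ) ≤ K := by exact_mod_cast hK
  have hκ1 : κ ≤ 1 / 4 := (le_mul_of_one_le_left hκ.le hK1).trans hKκ
  have hhalf := h.half_sqrt_le hC hκ hσ hd
  have hκ4 : 0 < κ ^ 4 := by positivity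
  have hκ4' : κ ^ 4 ≤ 1 / 2 :=
    (pow_le_pow_left₀ hκ.le hκ1 4).trans (by norm_num)
  set T₀ : ℝ := ((initLength 1 κ σ₀ d N T : ℕ) : ℝ) with hT₀
  have hy0 : 0 ≤ T₀ * σ₀ / 2 := by positivity
  have hy : 1 ≤ T₀ * σ₀ / 2 := by
    nlinarith [h.one_le_sqrt, mul_le_mul_of_nonneg_right hκ4' hy0]
  have hlam : (K : ℝ) ≤ K * T₀ * σ₀ / 2 := by
    rw [show (K : ℝ) * T₀ * σ₀ / 2 = K * (T₀ * σ₀ / 2) by ring]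
    exact le_mul_of_one_le_right (by linarith) hy
  have hlam' : √(d * T) / 2 ≤ κ ^ 4 * (K * T₀ * σ₀ / 2) := by
    refine hhalf.trans (mul_le_mul_of_nonneg_left ?_ hκ4.le)
    rw [show (K : ℝ) * T₀ * σ₀ / 2 = K * (T₀ * σ₀ / 2) by ring]
    exact le_mul_of_one_le_left hy0 hK1
  obtain ⟨hM, hα⟩ := h.radius_bounds hC hκ hκ1 hσ hd hdσ hlam'
  have hT1 : 1 ≤ T := by
    have : (3 : ℝ) ≤ T := h.three_le.trans h.le_T
    exact_mod_cast (by linarith : (1 : ℝ) ≤ T)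
  have hα0 : 0 ≤ radius κ N T := mul_nonneg (by positivity) (Real.sqrt_nonneg _)
  refine (integral_regret_le (p := tunedInput 1 κ σ₀ K T est tie) hest htie hd hx hcp hrm hr hG hc hκ hσ hK hKN hT1
    (h.initLength_le hC hκ hσ hd) hα0 (lam := K * T₀ * σ₀ / 2) rfl hlam
    (mul_nonneg zero_le_two (Real.sqrt_nonneg _)) rfl hM hα hQ).trans ?_
  exact (add_le_add le_rfl (h.failure_le hC hκ hκ1 hσ hd hdσ hN hQC hK1)).trans
    (h.main_le hC hκ hKκ hK hσ hd hdσ)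

end TunedRegret

end MNLBandit

end

/-! ### Choice of the constants -/

open MNLBandit in
theorem mainTheorem2 :
    ∃ C₀ : ℝ, 0 < C₀ ∧ ∃ C₂ : ℝ, 0 < C₂ ∧
    ∀ κ σ₀ : ℝ, 0 < κ → 0 < σ₀ → ∃ C₁ : ℝ, 0 < C₁ ∧
    ∀ (d N K T : ℕ), 1 ≤ d → 1 ≤ K → K ≤ N →
    C₁ * max (logTerm T N ^ 2 / d) ((d : ℝ) ^ 3) ≤ T →
    ∀ (est : Estimator N d) (tie : Finset (Finset (Fin N)) → Finset (Fin N)),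
    IsMLE est → (∀ M : Finset (Finset (Fin N)), M.Nonempty → tie M ∈ M) →
    ∀ (Ω : Type*) [MeasurableSpace Ω] (P : Measure Ω) [IsProbabilityMeasure P]
      (θstar : Vec d) (px : Measure (Vec d)) (x : ℕ → Fin N → Ω → Vec d)
      (r : ℕ → Fin N → Ω → ℝ) (G : ℕ → Ω → Finset (Fin N)) (c : ℕ → Ω → Option (Fin N)),
    IIDContexts P px σ₀ x → ChoiceProbBound P K κ θstar x →
    (∀ t i, Measurable (r t i)) → (∀ t i ω, |r t i ω| ≤ 1) →
    UniformInit P K x r G →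
    MNLResponses P (tunedInput C₀ κ σ₀ K T est tie) θstar x r G c →
    Integrable (regret (tunedInput C₀ κ σ₀ K T est tie) θstar x r G c) P ∧
    ∫ ω, regret (tunedInput C₀ κ σ₀ K T est tie) θstar x r G c ω ∂P ≤
      C₂ / (κ ^ 4 * σ₀) * √(d * T * Real.log (T / d) * logTerm T N * Real.logb 2 T) := by
  refine ⟨1, one_pos, 110, by norm_num, fun κ σ₀ hκ hσ => ?_⟩
  choose Q hQ using exists_isSphereNet
  -- `C` has to dominate the cardinality of the net but may not depend on `d`. Since `d σ₀ ≤ 1`,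
  -- only the dimensions up to `⌊1 / σ₀⌋₊` occur.
  obtain ⟨C, hC, hQC⟩ : ∃ C, LargeConstant C κ σ₀ ∧
      ∀ d ∈ Finset.range (⌊1 / σ₀⌋₊ + 1), ((Q d).card : ℝ) ≤ C :=
    exists_largeConstant hκ hσ _ fun d => (Q d).card
  refine ⟨C ^ 2, pow_pos (by linarith [hC.three_le]) 2, ?_⟩
  intro d N K T hd hK hKN hT est tie hest htie Ω _ P _ θstar px x r G c hx hcp hrm hr hG hc
  have hN : 1 ≤ N := hK.trans hKN
  have hdσ := hx.dim_mul_le_one hN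
  refine ⟨integrable_regret (p := tunedInput 1 κ σ₀ K T est tie) hest hx hrm hr hG hc,
    integral_regret_tunedInput_le (longHorizon hC.three_le hd hN hT) hC hκ hσ hd hK hKN hdσ
      (hcp.mul_le_quarter hKN) (hQ d) (hQC d (Finset.mem_range.2 (Nat.lt_succ_of_le
        (Nat.le_floor ((le_div_iff₀ hσ).2 hdσ))))) hest htie hx hcp hrm hr hG hc⟩
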